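/- Let $0<H_1\le H_2<2$, $c>0$, $\gamma>0$, $\gamma_0:=H_1/H_2$, and let $\rho_1,\rho_2$ be arbitrary nonzero real constants. Assume $H_1\ne1$ if $\gamma>\gamma_0$, and $H_2\ne1$ if $\gamma<\gamma_0$. A standard complex-valued Gaussian noise on $E=\mathbb R^2$ or $E=\mathbb R$ is a centred, jointly Gaussian family $W(A)$, indexed by the Borel sets $A\subset E$ of finite Lebesgue measure, with $\overline{W(A)}=W(-A)$ almost surely and $\mathrm E\,W(A)\overline{W(B)}=\mathrm{Leb}(A\cap B)$; the stochastic integral of $f\in L^2(E;\mathbb C)$ is the mean-square limit of the integrals of simple functions. Noises $W$ on $\mathbb R^2$ and $W_1$ on $\mathbb R$ exist on a common probability space. Given any such noises, put $h(u,v):=(|u|^2+c|v|^{2H_2/H_1})^{-H_1/2}$ and, for $x,y\ge0$, $$\kappa_x(u):=\frac{1-e^{iux}}{iu},\qquad V_\gamma(x,y):=\begin{cases} \int_{\mathbb R^2}\kappa_x(u)\kappa_y(v)\sqrt{h(u,v)}\,W(du,dv), & \gamma=\gamma_0,\\ \int_{\mathbb R^2}\kappa_x(u)\kappa_y(v)|u|^{-H_1/2}\,W(du,dv),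 & \gamma>\gamma_0,\ H_1<1,\\ x\rho_1c^{(1-H_1)/4}\int_{\mathbb R}\kappa_y(v)|v|^{-(H_1H_2-H_2)/(2H_1)}\,W_1(dv), & \gamma>\gamma_0,\ H_1>1,\\ \int_{\mathbb R^2}\kappa_x(u)\kappa_y(v)|v|^{-H_2/2}\,W(du,dv), & \gamma<\gamma_0,\ H_2<1,\\ y\rho_2c^{-H_1/(4H_2)}\int_{\mathbb R}\kappa_x(u)|u|^{-(H_1H_2-H_1)/(2H_2)}\,W_1(du), & \gamma<\gamma_0,\ H_2>1.\end{cases}$$ For a field $V$ on $[0,\infty)^2$ and a rectangle $K=(u,x]\times(v,y]$ contained in $(0,\infty)^2$, let $V(K):=V(x,y)-V(u,y)-V(x,v)+V(u,v)$. Let $\ell\ni(0,0)$ be a line in $\mathbb R^2$. The field $V$ has independent rectangular increments in direction $\ell$ if $V(K)$ and $V(K')$ are independent whenever the rectangles $K,K'$ lie on different sides of some line perpendicular to $\ell$ (boundary points on that line being allowed); invariant rectangular increments in direction $\ell$ if $V(K)=V(K')$ almost surely whenever $K'=K+p$ with $p\in\ell$; dependent rectangular increments in direction $\ell$ if neither holds.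 It has dependent rectangular increments if it has them in the direction of every line through $(0,0)$, and semi-dependent rectangular increments if, for some lines $\ell_1,\ell_2$ through $(0,0)$, it has dependent rectangular increments in direction $\ell_1$ and independent or invariant rectangular increments in direction $\ell_2$. Then: (i) $V_\gamma$ is well defined: each integrand is in $L^2$, and each $V_\gamma(x,y)$ exists, is almost surely unique and is almost surely real. The field $V_\gamma$ is Gaussian with zero mean and finite variance, vanishes almost surely at every point of the coordinate axes, and has stationary rectangular increments: for all $u,v>0$, the fields $V_\gamma((u,x]\times(v,y])$ and $V_\gamma((0,x-u]\times(0,y-v])$, indexed by $x\ge u$, $y\ge v$, have the same finite-dimensional distributions. (ii) For every $\lambda>0$ the fields $\{V_\gamma(\lambda x,\lambda^\gamma y)\}_{x,y\ge0}$ and $\{\lambda^{H(\gamma)}V_\gamma(x,y)\}_{x,y\ge0}$ have the same finite-dimensional distributions, where $H(\gamma)>0$ is given by $$H(\gamma)=\begin{cases}(1+\gamma+H_1)/2,&\gamma\ge\gamma_0,\ H_1<1,\\ (\gamma H_1+\gamma H_1H_2-\gamma H_2+2H_1)/(2H_1),&\gamma\ge\gamma_0,\ H_1>1,\\ (1+\gamma+\gamma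 H_2)/2,&\gamma\le\gamma_0,\ H_2<1,\\ (H_2+H_1H_2-H_1+2\gamma H_2)/(2H_2),&\gamma\le\gamma_0,\ H_2>1,\end{cases}$$ and $H(\gamma_0)=(H_1+H_2+H_1H_2)/(2H_2)$ (also when $H_1=1$ or $H_2=1$). (iii) $V_\gamma$ has dependent rectangular increments if and only if $\gamma=\gamma_0$, and semi-dependent rectangular increments if and only if $\gamma\ne\gamma_0$. -/

import Mathlib

open MeasureTheory ProbabilityTheory Filter Topology

noncomputable section

/-- A standard complex-valued (Hermitian) Gaussian noise with control measure `m` on `E`, as a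
family `W A` of random variables indexed by the measurable sets `A` of finite measure: it is centred
and jointly Gaussian (the real and imaginary parts of all the `W A` are jointly Gaussian), satisfies
`conj (W A) = W (-A)`, and has covariance `𝔼[W A * conj (W B)] = m (A ∩ B)`. Finite additivity (and
`σ`-additivity in mean square) follow from the covariance. -/
structure IsHermitianNoise {E Ω : Type*} [MeasurableSpace E] [Neg E] [MeasurableSpace Ω]
    (m : Measure E) (P : Measure Ω) (W : Set E → Ω → ℂ) : Prop where
  gaussian : IsGaussianProcess (fun A : {A : Set E // MeasurableSet A ∧ m A < ⊤} => W A.1) P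
  mean_zero : ∀ A : Set E, MeasurableSet A → m A < ⊤ → ∫ ω, W A ω ∂P = 0
  conj_eq : ∀ A : Set E, MeasurableSet A → m A < ⊤ →
    (fun ω => (starRingEnd ℂ) (W A ω)) =ᵐ[P] W ((fun z => -z) ⁻¹' A)
  covariance : ∀ A B : Set E, MeasurableSet A → m A < ⊤ → MeasurableSet B → m B < ⊤ →
    ∫ ω, W A ω * (starRingEnd ℂ) (W B ω) ∂P = ((m.real (A ∩ B) : ℝ) : ℂ)

/-- The stochastic integral of a simple function: `∑ z, z * W {s = z}` over its nonzero values. -/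
def simpleStochInt {E Ω : Type*} [MeasurableSpace E] (W : Set E → Ω → ℂ)
    (s : SimpleFunc E ℂ) (ω : Ω) : ℂ :=
  ∑ z ∈ s.range.filter (fun z => z ≠ 0), z * W (s ⁻¹' {z}) ω

/-- `X` is (a version of) the stochastic integral `∫ f dW`: the function `f` is square integrable,
and `X` is the mean-square limit of the integrals of simple functions which converge to `f` in
`L²(m)`. -/
def IsStochInt {E Ω : Type*} [MeasurableSpace E] [MeasurableSpace Ω]
    (m : Measure E) (P : Measure Ω) (W : Set E → Ω → ℂ) (f : E → ℂ) (X : Ω → ℂ) : Prop :=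
  MemLp f 2 m ∧ MemLp X 2 P ∧
    ∃ s : ℕ → SimpleFunc E ℂ,
      (∀ n, ∀ z : ℂ, z ≠ 0 → m (s n ⁻¹' {z}) < ⊤) ∧
      Tendsto (fun n => eLpNorm (fun e => s n e - f e) 2 m) atTop (𝓝 0) ∧
      Tendsto (fun n => eLpNorm (fun ω => simpleStochInt W (s n) ω - X ω) 2 P) atTop (𝓝 0)

/-- The limit function `h(u,v) = (|u|² + c |v|^{2 H₂/H₁})^{-H₁/2}`. -/
def hLimit (H₁ H₂ c : ℝ) (u v : ℝ) : ℝ :=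
  1 / (|u| ^ 2 + c * |v| ^ (2 * H₂ / H₁)) ^ (H₁ / 2)

/-- `(1 - e^{iux}) / (iu)`. -/
def kernelOne (x u : ℝ) : ℂ :=
  (1 - Complex.exp (Complex.I * u * x)) / (Complex.I * u)

/-- `(1 - e^{iux}) (1 - e^{ivy}) / (i² u v)`. -/
def kernelTwo (x y u v : ℝ) : ℂ :=
  (1 - Complex.exp (Complex.I * u * x)) * (1 - Complex.exp (Complex.I * v * y)) /
    (Complex.I ^ 2 * u * v)

/-- `X` is (a version of) the random variable `V_γ(x, y)`, given as a stochastic integral with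
respect to the noise `W` on `ℝ²` or the noise `W₁` on `ℝ`. The five cases are
`γ = γ₀`; `γ > γ₀` with `H₁ < 1` or `H₁ > 1`; `γ < γ₀` with `H₂ < 1` or `H₂ > 1`;
here `γ₀ = H₁ / H₂`. -/
def IsVgamma {Ω : Type*} [MeasurableSpace Ω] (P : Measure Ω)
    (W : Set (ℝ × ℝ) → Ω → ℂ) (W₁ : Set ℝ → Ω → ℂ)
    (H₁ H₂ c ρ₁ ρ₂ γ : ℝ) (x y : ℝ) (X : Ω → ℂ) : Prop :=
  (γ = H₁ / H₂ ∧
    IsStochInt volume P W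
      (fun p => kernelTwo x y p.1 p.2 * ((Real.sqrt (hLimit H₁ H₂ c p.1 p.2) : ℝ) : ℂ)) X) ∨
  (H₁ / H₂ < γ ∧ H₁ < 1 ∧
    IsStochInt volume P W
      (fun p => kernelTwo x y p.1 p.2 * ((|p.1| ^ (-H₁ / 2) : ℝ) : ℂ)) X) ∨
  (H₁ / H₂ < γ ∧ 1 < H₁ ∧
    ∃ Y : Ω → ℂ,
      IsStochInt volume P W₁
        (fun v => kernelOne y v * ((|v| ^ (-(H₁ * H₂ - H₂) / (2 * H₁)) : ℝ) : ℂ)) Y ∧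
      X =ᵐ[P] fun ω => ((x * ρ₁ * c ^ ((1 - H₁) / 4) : ℝ) : ℂ) * Y ω) ∨
  (γ < H₁ / H₂ ∧ H₂ < 1 ∧
    IsStochInt volume P W
      (fun p => kernelTwo x y p.1 p.2 * ((|p.2| ^ (-H₂ / 2) : ℝ) : ℂ)) X) ∨
  (γ < H₁ / H₂ ∧ 1 < H₂ ∧
    ∃ Y : Ω → ℂ,
      IsStochInt volume P W₁
        (fun u => kernelOne x u * ((|u| ^ (-(H₁ * H₂ - H₁) / (2 * H₂)) : ℝ) : ℂ)) Y ∧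
      X =ᵐ[P] fun ω => ((y * ρ₂ * c ^ (-H₁ / (4 * H₂)) : ℝ) : ℂ) * Y ω)

/-- Equality of all finite-dimensional distributions of two random fields. -/
def FddEq {ι Ω : Type*} [MeasurableSpace Ω] (P : Measure Ω) (X Y : ι → Ω → ℝ) : Prop :=
  ∀ s : Finset ι, IdentDistrib (fun ω (i : s) => X i ω) (fun ω (i : s) => Y i ω) P P

/-- The increment of `V` on the rectangle `(u, x] × (v, y]`. -/
def rectIncr {Ω : Type*} (V : ℝ → ℝ → Ω → ℝ) (u v x y : ℝ) (ω : Ω) : ℝ :=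
  V x y ω - V u y ω - V x v ω + V u v ω

/-- Stationarity of the rectangular increments of a field on the closed quadrant. -/
def HasStationaryRectIncr {Ω : Type*} [MeasurableSpace Ω] (P : Measure Ω)
    (V : ℝ → ℝ → Ω → ℝ) : Prop :=
  ∀ u v : ℝ, 0 < u → 0 < v →
    FddEq P
      (fun p : {p : ℝ × ℝ // u ≤ p.1 ∧ v ≤ p.2} => rectIncr V u v p.1.1 p.1.2)
      (fun p : {p : ℝ × ℝ // u ≤ p.1 ∧ v ≤ p.2} => rectIncr V 0 0 (p.1.1 - u) (p.1.2 - v))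

/-- The scaling relation `{V(λ x, λ^γ y)} = {λ^H V(x, y)}` in finite-dimensional distributions, for
all `λ > 0`, i.e. operator scaling with exponent `H > 0` and matrix `diag(1, γ)`. -/
def IsOperatorScaling {Ω : Type*} [MeasurableSpace Ω] (P : Measure Ω)
    (V : ℝ → ℝ → Ω → ℝ) (γ H : ℝ) : Prop :=
  0 < H ∧ ∀ r : ℝ, 0 < r →
    FddEq P
      (fun p : {p : ℝ × ℝ // 0 ≤ p.1 ∧ 0 ≤ p.2} => V (r * p.1.1) (r ^ γ * p.1.2))
      (fun (p : {p : ℝ × ℝ // 0 ≤ p.1 ∧ 0 ≤ p.2}) ω => r ^ H * V p.1.1 p.1.2 ω)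

/-- A rectangle `(u, x] × (v, y]` contained in the open positive quadrant. -/
structure PosRect where
  u : ℝ
  v : ℝ
  x : ℝ
  y : ℝ
  hu : 0 ≤ u
  hv : 0 ≤ v
  hux : u < x
  hvy : v < y

/-- The rectangle as a set of points. -/
def PosRect.toSet (K : PosRect) : Set (ℝ × ℝ) := Set.Ioc K.u K.x ×ˢ Set.Ioc K.v K.y

/-- The increment of `V` on the rectangle `K`. -/
def PosRect.incr {Ω : Type*} (K : PosRect) (V : ℝ → ℝ → Ω → ℝ) : Ω → ℝ :=
  rectIncr V K.u K.v K.x K.y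

/-- The sets `K`, `K'` lie on different sides of the line `{a s + b t = d}`. -/
def SeparatedByLine (a b d : ℝ) (K K' : Set (ℝ × ℝ)) : Prop :=
  ((∀ p ∈ K, a * p.1 + b * p.2 ≤ d) ∧ (∀ p ∈ K', d ≤ a * p.1 + b * p.2)) ∨
  ((∀ p ∈ K', a * p.1 + b * p.2 ≤ d) ∧ (∀ p ∈ K, d ≤ a * p.1 + b * p.2))

/-- Independent rectangular increments in the direction of the line `{a x + b y = 0}`: increments
on rectangles separated by a perpendicular line `{a' x + b' y = d}` are independent. -/
def IndepRectIncrDir {Ω : Type*} [MeasurableSpace Ω] (P : Measure Ω)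
    (V : ℝ → ℝ → Ω → ℝ) (a b : ℝ) : Prop :=
  ∀ a' b' d : ℝ, (a' ≠ 0 ∨ b' ≠ 0) → a * a' + b * b' = 0 →
    ∀ K K' : PosRect, SeparatedByLine a' b' d K.toSet K'.toSet →
      IndepFun (K.incr V) (K'.incr V) P

/-- Invariant rectangular increments in the direction of the line `{a x + b y = 0}`. -/
def InvariantRectIncrDir {Ω : Type*} [MeasurableSpace Ω] (P : Measure Ω)
    (V : ℝ → ℝ → Ω → ℝ) (a b : ℝ) : Prop :=
  ∀ z w : ℝ, a * z + b * w = 0 →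
    ∀ K K' : PosRect, K'.toSet = (fun p => p + (z, w)) '' K.toSet →
      K.incr V =ᵐ[P] K'.incr V

/-- Dependent rectangular increments in the direction of the line `{a x + b y = 0}`. -/
def DepRectIncrDir {Ω : Type*} [MeasurableSpace Ω] (P : Measure Ω)
    (V : ℝ → ℝ → Ω → ℝ) (a b : ℝ) : Prop :=
  ¬ IndepRectIncrDir P V a b ∧ ¬ InvariantRectIncrDir P V a b

/-- Dependent rectangular increments: dependent in the direction of every line through `0`. -/
def HasDepRectIncr {Ω : Type*} [MeasurableSpace Ω] (P : Measure Ω)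
    (V : ℝ → ℝ → Ω → ℝ) : Prop :=
  ∀ a b : ℝ, (a ≠ 0 ∨ b ≠ 0) → DepRectIncrDir P V a b

/-- Semi-dependent rectangular increments: dependent in the direction of some line through `0`, and
independent or invariant in the direction of another one. -/
def HasSemiDepRectIncr {Ω : Type*} [MeasurableSpace Ω] (P : Measure Ω)
    (V : ℝ → ℝ → Ω → ℝ) : Prop :=
  (∃ a b : ℝ, (a ≠ 0 ∨ b ≠ 0) ∧ DepRectIncrDir P V a b) ∧
  (∃ a b : ℝ, (a ≠ 0 ∨ b ≠ 0) ∧ (IndepRectIncrDir P V a b ∨ InvariantRectIncrDir P V a b))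

end

/-! In all five cases `V x y` is a stochastic integral of a Hermitian kernel, and f ↦ ∫ f dW is an
isometry from L² of the frequency space into L²(P) whose real parts are centred Gaussian. Every
claim about the field thus becomes a claim about kernels. Equality of laws is equality of inner
products (`IsStochIntField.fddEq`), independence is orthogonality (`IsStochInt.indepFun` and its
converse), almost sure equality is almost everywhere equality of integrands
(`IsStochInt.ae_eq_of_ae_eq`), and reality is the symmetry f(-e) = conj f(e).

`IsSpectralKernel` isolates what the cases share: the increment over a rectangle with lower corner
(u, v) is a phase exp(i(uA + vB)) times the kernel of the rectangle moved to the origin. The phase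
cancels in covariances, which gives stationarity; operator scaling is a linear change of
frequencies. Square integrability rests on ∫ |κ_x|² |u|^(-α) < ∞ for 0 ≤ α < 1. It applies to h
because the AM-GM inequality bounds h by a multiple of |u|^(-H₁/2) |v|^(-H₂/2), and to the line
kernels because H₁, H₂ < 2.

Dependence comes from a positive covariance. For unit squares at lag (s, t) the covariance is ∫ |F|²
cos(sA + tB). The identity |κ_1(u)|² cos u = 2|κ_1(2u)|² - |κ_1(u)|² and a dilation turn ∫ |κ_1|² G
cos u into ∫ |κ_1|² (G(u/2) - G(u)), which is positive when G decreases in |u|. Used in both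
variables, it produces the mixed difference of h, positive because s ↦ s^(-p) is strictly convex.
With evenness in u this settles the lags (±1, ±1), and squares touching side by side or at a corner
can be separated by a line of any slope. So at γ = γ₀ no direction is independent. Invariance is
impossible, since it would force a nonconstant phase to equal 1 wherever the kernel does not vanish.

For γ ≠ γ₀ there are two mechanisms. If the weight depends on one frequency only, the covariance
factors and the other factor pairs transforms of disjoint intervals, hence vanishes: independence in
one direction. Otherwise the field is linear in one coordinate: invariance in that direction. The
same positivity argument gives dependence in the complementary axis direction.

The noises themselves are built from an independent standard Gaussian family indexed by Hilbert
bases (`exists_isHermitianNoise_pair`). -/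

/-! ### Inner products in complex L². -/

section L2

variable {α : Type*} [MeasurableSpace α] {μ : Measure α}

/-- The order is swapped because the inner product is conjugate linear in its first argument. -/
theorem integral_mul_conj_eq_inner {f g : α → ℂ} (hf : MemLp f 2 μ) (hg : MemLp g 2 μ) :
    ∫ a, f a * (starRingEnd ℂ) (g a) ∂μ = inner ℂ (hg.toLp g) (hf.toLp f) := by
  rw [L2.inner_def]
  refine integral_congr_ae ?_
  filter_upwards [hf.coeFn_toLp, hg.coeFn_toLp] with a h1 h2
  rw [RCLike.inner_apply, h1, h2]

theorem integrable_mul_conj {f g : α → ℂ} (hf : MemLp f 2 μ) (hg : MemLp g 2 μ) :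
    Integrable (fun a => f a * (starRingEnd ℂ) (g a)) μ := by
  refine (L2.integrable_inner (𝕜 := ℂ) (hg.toLp g) (hf.toLp f)).congr ?_
  filter_upwards [hf.coeFn_toLp, hg.coeFn_toLp] with a h1 h2
  rw [RCLike.inner_apply, h1, h2]

theorem tendsto_integral_mul_conj {f g : α → ℂ} {F G : ℕ → α → ℂ} (hf : MemLp f 2 μ)
    (hg : MemLp g 2 μ) (hF : ∀ n, MemLp (F n) 2 μ) (hG : ∀ n, MemLp (G n) 2 μ)
    (hFf : Tendsto (fun n => eLpNorm (fun a => F n a - f a) 2 μ) atTop (𝓝 0))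
    (hGg : Tendsto (fun n => eLpNorm (fun a => G n a - g a) 2 μ) atTop (𝓝 0)) :
    Tendsto (fun n => ∫ a, F n a * (starRingEnd ℂ) (G n a) ∂μ) atTop
      (𝓝 (∫ a, f a * (starRingEnd ℂ) (g a) ∂μ)) := by
  rw [integral_mul_conj_eq_inner hf hg]
  simp_rw [fun n => integral_mul_conj_eq_inner (hF n) (hG n)]
  exact ((Lp.tendsto_Lp_iff_tendsto_eLpNorm'' G hG g hg).2 hGg).inner
    ((Lp.tendsto_Lp_iff_tendsto_eLpNorm'' F hF f hf).2 hFf)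

/-- The four Gram entries agree, so ‖X - Y‖² = 0. The integral over `ν` only names the common value.
Since either side may be the probability space, the lemma yields uniqueness of integrals as well as
injectivity of integration. -/
theorem ae_eq_of_integral_mul_conj_eq {α' : Type*} [MeasurableSpace α'] {ν : Measure α'}
    {X Y : α → ℂ} {f : α' → ℂ} (hX : MemLp X 2 μ) (hY : MemLp Y 2 μ)
    (hXX : ∫ a, X a * (starRingEnd ℂ) (X a) ∂μ = ∫ b, f b * (starRingEnd ℂ) (f b) ∂ν)
    (hXY : ∫ a, X a * (starRingEnd ℂ) (Y a) ∂μ = ∫ b, f b * (starRingEnd ℂ) (f b) ∂ν)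
    (hYX : ∫ a, Y a * (starRingEnd ℂ) (X a) ∂μ = ∫ b, f b * (starRingEnd ℂ) (f b) ∂ν)
    (hYY : ∫ a, Y a * (starRingEnd ℂ) (Y a) ∂μ = ∫ b, f b * (starRingEnd ℂ) (f b) ∂ν) :
    X =ᵐ[μ] Y := by
  rw [integral_mul_conj_eq_inner hX hX] at hXX
  rw [integral_mul_conj_eq_inner hX hY] at hXY
  rw [integral_mul_conj_eq_inner hY hX] at hYX
  rw [integral_mul_conj_eq_inner hY hY] at hYY
  rw [← MemLp.toLp_eq_toLp_iff hX hY, ← sub_eq_zero, ← inner_self_eq_zero (𝕜 := ℂ)]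
  rw [inner_sub_left, inner_sub_right, inner_sub_right, hXX, hXY, hYX, hYY]
  ring

end L2

/-! ### Stochastic integral: isometry, existence, linearity, reality. -/

section StochInt

variable {E Ω : Type*} [MeasurableSpace E] [MeasurableSpace Ω] {m : Measure E} {P : Measure Ω}
  {W : Set E → Ω → ℂ}

/-- A simple function vanishing outside a set of finite measure. -/
def SimpleFunc.FinLevels (m : Measure E) (s : SimpleFunc E ℂ) : Prop :=
  ∀ z : ℂ, z ≠ 0 → m (s ⁻¹' {z}) < ⊤

theorem SimpleFunc.FinLevels.memLp {s : SimpleFunc E ℂ} (hs : SimpleFunc.FinLevels m s) :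
    MemLp s 2 m :=
  (SimpleFunc.memLp_iff (by norm_num) (by norm_num)).2 hs

theorem MeasureTheory.MemLp.finLevels {s : SimpleFunc E ℂ} (hs : MemLp s 2 m) :
    SimpleFunc.FinLevels m s :=
  (SimpleFunc.memLp_iff (by norm_num) (by norm_num)).1 hs

theorem SimpleFunc.eq_sum_filter_indicator (s : SimpleFunc E ℂ) (e : E) :
    s e = ∑ z ∈ s.range.filter (fun z => z ≠ 0), (s ⁻¹' {z}).indicator (fun _ => z) e := by
  classical
  simp only [Set.indicator_apply, Set.mem_preimage, Set.mem_singleton_iff]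
  rw [Finset.sum_ite_eq]
  simp only [Finset.mem_filter, SimpleFunc.mem_range_self, true_and]
  split_ifs with h
  · rfl
  · simpa using h

theorem IsStochInt.memLp_left {f : E → ℂ} {X : Ω → ℂ} (hX : IsStochInt m P W f X) :
    MemLp f 2 m := hX.1

theorem IsStochInt.memLp_right {f : E → ℂ} {X : Ω → ℂ} (hX : IsStochInt m P W f X) :
    MemLp X 2 P := hX.2.1

theorem IsStochInt.congr_right {f : E → ℂ} {X Y : Ω → ℂ}
    (hX : IsStochInt m P W f X) (h : X =ᵐ[P] Y) : IsStochInt m P W f Y := by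
  obtain ⟨hf, hX2, s, hs, hsf, hsX⟩ := hX
  refine ⟨hf, hX2.ae_eq h, s, hs, hsf, hsX.congr fun n => eLpNorm_congr_ae ?_⟩
  filter_upwards [h] with ω hω
  rw [hω]

section Neg

variable [Neg E]

theorem IsHermitianNoise.memLp (hW : IsHermitianNoise m P W) {A : Set E} (hA : MeasurableSet A)
    (hA' : m A < ⊤) : MemLp (W A) 2 P :=
  (hW.gaussian.hasGaussianLaw_eval ⟨A, hA, hA'⟩).memLp_two

theorem IsHermitianNoise.memLp_simpleStochInt (hW : IsHermitianNoise m P W) {s : SimpleFunc E ℂ}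
    (hs : SimpleFunc.FinLevels m s) : MemLp (simpleStochInt W s) 2 P := by
  unfold simpleStochInt
  refine memLp_finsetSum _ fun z hz => ?_
  exact (hW.memLp (s.measurableSet_fiber z) (hs z (Finset.mem_filter.1 hz).2)).const_mul z

/-- Both sides are expanded over pairs of level sets, where the covariance of the noise gives the
measure of the intersection. -/
theorem IsHermitianNoise.integral_simpleStochInt_mul_conj (hW : IsHermitianNoise m P W)
    {s t : SimpleFunc E ℂ} (hs : SimpleFunc.FinLevels m s) (ht : SimpleFunc.FinLevels m t) :
    ∫ ω, simpleStochInt W s ω * (starRingEnd ℂ) (simpleStochInt W t ω) ∂P =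
      ∫ e, s e * (starRingEnd ℂ) (t e) ∂m := by
  have hL : ∀ ω, simpleStochInt W s ω * (starRingEnd ℂ) (simpleStochInt W t ω) =
      ∑ z ∈ s.range.filter (fun z => z ≠ 0), ∑ w ∈ t.range.filter (fun z => z ≠ 0),
        (z * (starRingEnd ℂ) w) * (W (s ⁻¹' {z}) ω * (starRingEnd ℂ) (W (t ⁻¹' {w}) ω)) := by
    intro ω
    simp only [simpleStochInt, map_sum, map_mul, Finset.sum_mul_sum]
    refine Finset.sum_congr rfl fun z _ => Finset.sum_congr rfl fun w _ => ?_
    ring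
  have hR : ∀ e, s e * (starRingEnd ℂ) (t e) =
      ∑ z ∈ s.range.filter (fun z => z ≠ 0), ∑ w ∈ t.range.filter (fun z => z ≠ 0),
        (s ⁻¹' {z} ∩ t ⁻¹' {w}).indicator (fun _ => z * (starRingEnd ℂ) w) e := by
    classical
    intro e
    rw [SimpleFunc.eq_sum_filter_indicator s e, SimpleFunc.eq_sum_filter_indicator t e, map_sum,
      Finset.sum_mul_sum]
    refine Finset.sum_congr rfl fun z _ => Finset.sum_congr rfl fun w _ => ?_
    simp only [Set.indicator_apply, Set.mem_inter_iff, Set.mem_preimage, Set.mem_singleton_iff]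
    split_ifs <;> simp_all
  simp_rw [hL, hR]
  have hsz : ∀ z ∈ s.range.filter (fun z => z ≠ 0), m (s ⁻¹' {z}) < ⊤ := fun z hz =>
    hs z (Finset.mem_filter.1 hz).2
  have htz : ∀ z ∈ t.range.filter (fun z => z ≠ 0), m (t ⁻¹' {z}) < ⊤ := fun z hz =>
    ht z (Finset.mem_filter.1 hz).2
  have hint : ∀ z ∈ s.range.filter (fun z => z ≠ 0), ∀ w ∈ t.range.filter (fun z => z ≠ 0),
      Integrable (fun ω => (z * (starRingEnd ℂ) w) *
        (W (s ⁻¹' {z}) ω * (starRingEnd ℂ) (W (t ⁻¹' {w}) ω))) P := fun z hz w hw =>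
    (integrable_mul_conj (hW.memLp (s.measurableSet_fiber z) (hsz z hz))
      (hW.memLp (t.measurableSet_fiber w) (htz w hw))).const_mul _
  have hint' : ∀ z ∈ s.range.filter (fun z => z ≠ 0), ∀ w ∈ t.range.filter (fun z => z ≠ 0),
      Integrable ((s ⁻¹' {z} ∩ t ⁻¹' {w}).indicator (fun _ => z * (starRingEnd ℂ) w)) m :=
    fun z hz w hw => (integrable_indicator_iff
      ((s.measurableSet_fiber z).inter (t.measurableSet_fiber w))).2
      (integrableOn_const (ne_top_of_le_ne_top (hsz z hz).ne (measure_mono Set.inter_subset_left)))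
  rw [integral_finsetSum _ fun z hz => integrable_finsetSum _ fun w hw => hint z hz w hw,
    integral_finsetSum _ fun z hz => integrable_finsetSum _ fun w hw => hint' z hz w hw]
  refine Finset.sum_congr rfl fun z hz => ?_
  rw [integral_finsetSum _ fun w hw => hint z hz w hw,
    integral_finsetSum _ fun w hw => hint' z hz w hw]
  refine Finset.sum_congr rfl fun w hw => ?_
  rw [integral_const_mul, hW.covariance _ _ (s.measurableSet_fiber z) (hsz z hz)
    (t.measurableSet_fiber w) (htz w hw),
    integral_indicator_const _ ((s.measurableSet_fiber z).inter (t.measurableSet_fiber w)),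
    Complex.real_smul, mul_comm]

/-- The isometry survives mean-square limits. Uniqueness and linearity are deduced from it without
returning to simple functions. -/
theorem IsStochInt.integral_mul_conj (hW : IsHermitianNoise m P W) {f g : E → ℂ} {X Y : Ω → ℂ}
    (hX : IsStochInt m P W f X) (hY : IsStochInt m P W g Y) :
    ∫ ω, X ω * (starRingEnd ℂ) (Y ω) ∂P = ∫ e, f e * (starRingEnd ℂ) (g e) ∂m := by
  obtain ⟨hf, hX2, s, hs, hsf, hsX⟩ := hX
  obtain ⟨hg, hY2, t, ht, htg, htY⟩ := hY
  have h1 := tendsto_integral_mul_conj hX2 hY2 (fun n => hW.memLp_simpleStochInt (hs n))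
    (fun n => hW.memLp_simpleStochInt (ht n)) hsX htY
  have h2 := tendsto_integral_mul_conj hf hg (fun n => SimpleFunc.FinLevels.memLp (hs n))
    (fun n => SimpleFunc.FinLevels.memLp (ht n)) hsf htg
  refine tendsto_nhds_unique h1 (h2.congr fun n => ?_)
  exact (hW.integral_simpleStochInt_mul_conj (hs n) (ht n)).symm

theorem IsStochInt.ae_unique (hW : IsHermitianNoise m P W) {f : E → ℂ} {X Y : Ω → ℂ}
    (hX : IsStochInt m P W f X) (hY : IsStochInt m P W f Y) : X =ᵐ[P] Y :=
  ae_eq_of_integral_mul_conj_eq hX.2.1 hY.2.1 (hX.integral_mul_conj hW hX)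
    (hX.integral_mul_conj hW hY) (hY.integral_mul_conj hW hX) (hY.integral_mul_conj hW hY)

/-- Simple approximations of f are Cauchy in L²(m), so by the isometry their integrals are Cauchy in
L²(P), which is complete. -/
theorem IsHermitianNoise.exists_isStochInt (hW : IsHermitianNoise m P W) {f : E → ℂ}
    (hf : MemLp f 2 m) : ∃ X, IsStochInt m P W f X := by
  have hex : ∀ n : ℕ, ∃ g : SimpleFunc E ℂ, eLpNorm (f - ⇑g) 2 m < ENNReal.ofReal (1 / (n + 1)) ∧
      MemLp g 2 m := fun n => hf.exists_simpleFunc_eLpNorm_sub_lt (by norm_num)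
        (by simp only [ne_eq, ENNReal.ofReal_eq_zero, not_le]; positivity)
  choose s hs hs2 using hex
  have hsf : Tendsto (fun n => eLpNorm (fun e => s n e - f e) 2 m) atTop (𝓝 0) := by
    have h0 : Tendsto (fun n : ℕ => ENNReal.ofReal (1 / ((n : ℝ) + 1))) atTop (𝓝 0) := by
      simpa using ENNReal.tendsto_ofReal tendsto_one_div_add_atTop_nhds_zero_nat
    refine tendsto_of_tendsto_of_tendsto_of_le_of_le tendsto_const_nhds h0 (fun _ => zero_le)
      fun n => ?_
    have := eLpNorm_sub_comm f (s n) 2 m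
    exact (this.symm.trans_lt (hs n)).le
  have hsX2 := fun n => hW.memLp_simpleStochInt (hs2 n).finLevels
  have hnorm : ∀ i j, dist ((hsX2 i).toLp _) ((hsX2 j).toLp _) =
      dist ((hs2 i).toLp _) ((hs2 j).toLp _) := by
    intro i j
    have key : ∀ i j, inner ℂ ((hsX2 i).toLp _) ((hsX2 j).toLp _) =
        inner ℂ ((hs2 i).toLp _) ((hs2 j).toLp _) := fun i j => by
      rw [← integral_mul_conj_eq_inner, ← integral_mul_conj_eq_inner,
        hW.integral_simpleStochInt_mul_conj (hs2 j).finLevels (hs2 i).finLevels]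
    rw [dist_eq_norm, dist_eq_norm, norm_eq_sqrt_re_inner (𝕜 := ℂ),
      norm_eq_sqrt_re_inner (𝕜 := ℂ)]
    simp only [inner_sub_left, inner_sub_right, key]
  have hconv := (Lp.tendsto_Lp_iff_tendsto_eLpNorm'' (fun n => ⇑(s n)) hs2 f hf).2 hsf
  have hcau : CauchySeq (fun n => (hsX2 n).toLp _) := by
    rw [Metric.cauchySeq_iff]
    simp_rw [hnorm]
    exact Metric.cauchySeq_iff.1 hconv.cauchySeq
  obtain ⟨X, hX⟩ := cauchySeq_tendsto_of_complete hcau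
  refine ⟨X, hf, Lp.memLp X, s, fun n => (hs2 n).finLevels, hsf, ?_⟩
  have hX' : X = (Lp.memLp X).toLp X := (Lp.toLp_coeFn X _).symm
  rw [hX'] at hX
  exact (Lp.tendsto_Lp_iff_tendsto_eLpNorm'' _ hsX2 _ (Lp.memLp X)).1 hX

/-- Let Z be the integral of f + g. By the isometry Z - (X + Y) has the norm of (f + g) - (f + g),
namely zero. This avoids adding simple functions, whose level sets do not combine well. -/
theorem IsStochInt.add (hW : IsHermitianNoise m P W) {f g : E → ℂ} {X Y : Ω → ℂ}
    (hX : IsStochInt m P W f X) (hY : IsStochInt m P W g Y) :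
    IsStochInt m P W (fun e => f e + g e) (fun ω => X ω + Y ω) := by
  obtain ⟨Z, hZ⟩ := hW.exists_isStochInt (hX.1.add hY.1)
  refine hZ.congr_right ?_
  have gram : ∀ {f g X Y} (hX : IsStochInt m P W f X) (hY : IsStochInt m P W g Y),
      inner ℂ (hX.memLp_right.toLp X) (hY.memLp_right.toLp Y) =
        inner ℂ (hX.memLp_left.toLp f) (hY.memLp_left.toLp g) := fun hX hY => by
    rw [← integral_mul_conj_eq_inner, ← integral_mul_conj_eq_inner, hY.integral_mul_conj hW hX]
  have h0 : hZ.memLp_left.toLp _ - (hX.memLp_left.toLp f + hY.memLp_left.toLp g) = 0 := by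
    rw [sub_eq_zero, ← MemLp.toLp_add]
  have h1 : hZ.memLp_right.toLp Z - (hX.memLp_right.toLp X + hY.memLp_right.toLp Y) = 0 := by
    rw [← inner_self_eq_zero (𝕜 := ℂ)] at h0 ⊢
    rw [← h0]
    simp only [inner_sub_left, inner_sub_right, inner_add_left, inner_add_right]
    rw [gram hZ hZ, gram hX hZ, gram hY hZ, gram hZ hX, gram hX hX, gram hY hX, gram hZ hY,
      gram hX hY, gram hY hY]
  rw [sub_eq_zero, ← MemLp.toLp_add] at h1
  exact (MemLp.toLp_eq_toLp_iff _ _).1 h1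

theorem IsStochInt.const_mul (hW : IsHermitianNoise m P W) {f : E → ℂ} {X : Ω → ℂ}
    (hX : IsStochInt m P W f X) (c : ℂ) :
    IsStochInt m P W (fun e => c * f e) (fun ω => c * X ω) := by
  obtain ⟨Z, hZ⟩ := hW.exists_isStochInt (hX.1.const_mul c)
  refine hZ.congr_right ?_
  have h1 : ∀ f g : Ω → ℂ, ∫ ω, (c * f ω) * (starRingEnd ℂ) (g ω) ∂P =
      c * ∫ ω, f ω * (starRingEnd ℂ) (g ω) ∂P := fun f g => by
    simp_rw [mul_assoc]; exact integral_const_mul _ _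
  have h2 : ∀ f g : Ω → ℂ, ∫ ω, f ω * (starRingEnd ℂ) (c * g ω) ∂P =
      (starRingEnd ℂ) c * ∫ ω, f ω * (starRingEnd ℂ) (g ω) ∂P := fun f g => by
    rw [← integral_const_mul]; exact integral_congr_ae (ae_of_all _ fun _ => by simp; ring)
  have h3 : ∀ f g : E → ℂ, ∫ ω, (c * f ω) * (starRingEnd ℂ) (g ω) ∂m =
      c * ∫ ω, f ω * (starRingEnd ℂ) (g ω) ∂m := fun f g => by
    simp_rw [mul_assoc]; exact integral_const_mul _ _
  have h4 : ∀ f g : E → ℂ, ∫ ω, f ω * (starRingEnd ℂ) (c * g ω) ∂m =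
      (starRingEnd ℂ) c * ∫ ω, f ω * (starRingEnd ℂ) (g ω) ∂m := fun f g => by
    rw [← integral_const_mul]; exact integral_congr_ae (ae_of_all _ fun _ => by simp; ring)
  refine ae_eq_of_integral_mul_conj_eq (f := fun e => c * f e) hZ.2.1 (hX.2.1.const_mul c)
    (hZ.integral_mul_conj hW hZ) ?_ ?_ ?_
  · rw [h2, hZ.integral_mul_conj hW hX, h4]
  · rw [h1, hX.integral_mul_conj hW hZ, h3]
  · rw [h1, h2, hX.integral_mul_conj hW hX, h3, h4]

theorem IsStochInt.sub (hW : IsHermitianNoise m P W) {f g : E → ℂ} {X Y : Ω → ℂ}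
    (hX : IsStochInt m P W f X) (hY : IsStochInt m P W g Y) :
    IsStochInt m P W (fun e => f e - g e) (fun ω => X ω - Y ω) := by
  have := hX.add hW (hY.const_mul hW (-1))
  simpa only [neg_one_mul, ← sub_eq_add_neg] using this

theorem IsStochInt.sum (hW : IsHermitianNoise m P W) {ι : Type*} (I : Finset ι) {f : ι → E → ℂ}
    {X : ι → Ω → ℂ} (hX : ∀ i ∈ I, IsStochInt m P W (f i) (X i)) :
    IsStochInt m P W (fun e => ∑ i ∈ I, f i e) (fun ω => ∑ i ∈ I, X i ω) := by
  classical
  induction I using Finset.induction_on with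
  | empty =>
    simp only [Finset.sum_empty]
    refine ⟨MemLp.zero', MemLp.zero', fun _ => 0, fun n z hz => ?_, by simp, ?_⟩
    · have : ((0 : SimpleFunc E ℂ) : E → ℂ) ⁻¹' {z} = ∅ := by
        ext e; simpa using hz.symm
      rw [this]; simp
    · have : ∀ ω, simpleStochInt W (0 : SimpleFunc E ℂ) ω = 0 := fun ω => by
        unfold simpleStochInt
        refine Finset.sum_eq_zero fun z hz => ?_
        rw [Finset.mem_filter, SimpleFunc.mem_range] at hz
        obtain ⟨⟨e, he⟩, hz⟩ := hz
        exact absurd he.symm hz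
      simp [this]
  | insert i I hi ih =>
    simp only [Finset.sum_insert hi]
    exact (hX i (Finset.mem_insert_self i I)).add hW
      (ih fun j hj => hX j (Finset.mem_insert_of_mem hj))

end Neg

section Conj

variable [InvolutiveNeg E]

/-- The level set of t at conj z is the reflection of the level set of s at z, which is where the
noise puts the conjugate. -/
theorem IsHermitianNoise.conj_simpleStochInt (hW : IsHermitianNoise m P W)
    {s t : SimpleFunc E ℂ} (hs : SimpleFunc.FinLevels m s)
    (ht : ∀ e, t e = (starRingEnd ℂ) (s (-e))) :
    (fun ω => (starRingEnd ℂ) (simpleStochInt W s ω)) =ᵐ[P] simpleStochInt W t := by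
  have hall : ∀ᵐ ω ∂P, ∀ z ∈ s.range.filter (fun z => z ≠ 0),
      (starRingEnd ℂ) (W (s ⁻¹' {z}) ω) = W ((fun z => -z) ⁻¹' (s ⁻¹' {z})) ω := by
    rw [eventually_all_finset]
    exact fun z hz => hW.conj_eq _ (s.measurableSet_fiber z) (hs z (Finset.mem_filter.1 hz).2)
  filter_upwards [hall] with ω hω
  unfold simpleStochInt
  rw [map_sum]
  refine Finset.sum_bij (fun z _ => (starRingEnd ℂ) z) ?_ ?_ ?_ ?_
  · intro z hz
    simp only [Finset.mem_filter, SimpleFunc.mem_range, Set.mem_range, ne_eq] at hz ⊢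
    obtain ⟨⟨e, rfl⟩, h⟩ := hz
    exact ⟨⟨-e, by rw [ht, neg_neg]⟩, by simpa using h⟩
  · intro z _ w _ h
    exact (starRingEnd ℂ).injective h
  · intro w hw
    simp only [Finset.mem_filter, SimpleFunc.mem_range, Set.mem_range, ne_eq] at hw
    obtain ⟨⟨e, rfl⟩, h⟩ := hw
    refine ⟨s (-e), ?_, (ht e).symm⟩
    simp only [Finset.mem_filter, SimpleFunc.mem_range_self, ne_eq, true_and]
    intro h'
    rw [ht, h'] at h
    simp at h
  · intro z hz
    rw [map_mul, hω z hz]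
    congr 2
    ext e
    simp only [Set.mem_preimage, Set.mem_singleton_iff, ht]
    constructor
    · rintro rfl; rfl
    · intro h; exact (starRingEnd ℂ).injective h

theorem IsStochInt.conj [MeasurableNeg E] [m.IsNegInvariant] (hW : IsHermitianNoise m P W) {f : E → ℂ}
    {X : Ω → ℂ} (hX : IsStochInt m P W f X) :
    IsStochInt m P W (fun e => (starRingEnd ℂ) (f (-e))) (fun ω => (starRingEnd ℂ) (X ω)) := by
  obtain ⟨hf, hX2, s, hs, hsf, hsX⟩ := hX
  have hneg : MeasurePreserving (fun e : E => -e) m m := Measure.measurePreserving_neg m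
  let t : ℕ → SimpleFunc E ℂ := fun n =>
    ((s n).comp (fun e => -e) measurable_neg).map (starRingEnd ℂ)
  have ht : ∀ n e, t n e = (starRingEnd ℂ) (s n (-e)) := fun n e => rfl
  refine ⟨(hf.star).comp_measurePreserving hneg, hX2.star, t, fun n z hz => ?_, ?_, ?_⟩
  · exact (MemLp.finLevels (((SimpleFunc.FinLevels.memLp (hs n)).star).comp_measurePreserving
      hneg)) z hz
  · refine hsf.congr fun n => ?_
    have h1 : eLpNorm ((fun e => s n e - f e) ∘ fun e => -e) 2 m =
        eLpNorm (fun e => s n e - f e) 2 m := eLpNorm_comp_measurePreserving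
      ((SimpleFunc.FinLevels.memLp (hs n)).sub hf).1 hneg
    rw [← h1]
    refine eLpNorm_congr_norm_ae (ae_of_all _ fun e => ?_)
    simp only [Function.comp, ht, ← map_sub, RCLike.norm_conj]
  · refine hsX.congr fun n => eLpNorm_congr_norm_ae ?_
    filter_upwards [hW.conj_simpleStochInt (hs n) (ht n)] with ω hω
    rw [← hω, ← map_sub, RCLike.norm_conj]

/-- The stochastic integral of a Hermitian function is real. -/
theorem IsStochInt.im_eq_zero [MeasurableNeg E] [m.IsNegInvariant] (hW : IsHermitianNoise m P W) {f : E → ℂ}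
    {X : Ω → ℂ} (hX : IsStochInt m P W f X) (hf : ∀ e, f (-e) = (starRingEnd ℂ) (f e)) :
    ∀ᵐ ω ∂P, (X ω).im = 0 := by
  have h := hX.conj hW
  simp only [hf, Complex.conj_conj] at h
  filter_upwards [h.ae_unique hW hX] with ω hω
  exact Complex.conj_eq_iff_im.1 hω

end Conj

end StochInt

/-! ### Mean-square limits of centred Gaussian variables. -/

section GaussianLimit

variable {Ω : Type*} [MeasurableSpace Ω] {P : Measure Ω}

theorem tendsto_integral_mul_of_eLpNorm {X Y : Ω → ℝ} {F G : ℕ → Ω → ℝ} (hX : MemLp X 2 P)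
    (hY : MemLp Y 2 P) (hF : ∀ n, MemLp (F n) 2 P) (hG : ∀ n, MemLp (G n) 2 P)
    (hFX : Tendsto (fun n => eLpNorm (fun ω => F n ω - X ω) 2 P) atTop (𝓝 0))
    (hGY : Tendsto (fun n => eLpNorm (fun ω => G n ω - Y ω) 2 P) atTop (𝓝 0)) :
    Tendsto (fun n => ∫ ω, F n ω * G n ω ∂P) atTop (𝓝 (∫ ω, X ω * Y ω ∂P)) := by
  have h := tendsto_integral_mul_conj (F := fun n ω => (F n ω : ℂ)) (G := fun n ω => (G n ω : ℂ))
    (f := fun ω => (X ω : ℂ)) (g := fun ω => (Y ω : ℂ)) hX.ofReal hY.ofReal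
    (fun n => (hF n).ofReal) (fun n => (hG n).ofReal)
    (hFX.congr fun n => eLpNorm_congr_norm_ae (ae_of_all _ fun ω => by
      rw [← Complex.ofReal_sub, Complex.norm_real]))
    (hGY.congr fun n => eLpNorm_congr_norm_ae (ae_of_all _ fun ω => by
      rw [← Complex.ofReal_sub, Complex.norm_real]))
  simp only [Complex.conj_ofReal, ← Complex.ofReal_mul, integral_complex_ofReal] at h
  exact_mod_cast (Complex.continuous_re.tendsto _).comp h

theorem tendsto_integral_of_eLpNorm_two [IsProbabilityMeasure P] {X : Ω → ℝ} {F : ℕ → Ω → ℝ}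
    (hX : MemLp X 2 P) (hF : ∀ n, MemLp (F n) 2 P)
    (hFX : Tendsto (fun n => eLpNorm (fun ω => F n ω - X ω) 2 P) atTop (𝓝 0)) :
    Tendsto (fun n => ∫ ω, F n ω ∂P) atTop (𝓝 (∫ ω, X ω ∂P)) := by
  have h := tendsto_integral_mul_of_eLpNorm (Y := fun _ => 1) (G := fun _ _ => 1) hX
    (memLp_const 1) hF (fun _ => memLp_const 1) hFX (by simp)
  simpa using h

theorem hasGaussianLaw_iff_of_integral_eq_zero [IsProbabilityMeasure P] {X : Ω → ℝ}
    (hX : MemLp X 2 P) (h0 : ∫ ω, X ω ∂P = 0) :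
    HasGaussianLaw X P ↔
      ∀ t : ℝ, charFun (P.map X) t = Complex.exp (-(t ^ 2 * ∫ ω, X ω * X ω ∂P : ℝ) / 2) := by
  rw [hasGaussianLaw_iff_charFun_map_eq hX.1.aemeasurable]
  refine forall_congr' fun t => ?_
  have h1 : ∫ ω, inner ℝ t (X ω) ∂P = 0 := by
    simp only [RCLike.inner_apply, conj_trivial]
    rw [integral_mul_const, h0, zero_mul]
  have h2 : Var[fun ω => inner ℝ t (X ω); P] = t ^ 2 * ∫ ω, X ω * X ω ∂P := by
    rw [variance_of_integral_eq_zero ((hX.1.aemeasurable).const_inner) h1,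
      ← integral_const_mul]
    refine integral_congr_ae (ae_of_all _ fun ω => ?_)
    simp only [RCLike.inner_apply, conj_trivial]
    ring
  rw [h1, h2]
  simp [neg_div]

/-- A mean-square limit of centred Gaussian variables is Gaussian. -/
theorem hasGaussianLaw_of_tendsto_eLpNorm [IsProbabilityMeasure P] {X : Ω → ℝ} {F : ℕ → Ω → ℝ}
    (hX : MemLp X 2 P) (hF : ∀ n, HasGaussianLaw (F n) P) (hF0 : ∀ n, ∫ ω, F n ω ∂P = 0)
    (hFX : Tendsto (fun n => eLpNorm (fun ω => F n ω - X ω) 2 P) atTop (𝓝 0)) :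
    HasGaussianLaw X P ∧ ∫ ω, X ω ∂P = 0 := by
  have hF2 := fun n => (hF n).memLp_two
  have h0 : ∫ ω, X ω ∂P = 0 := by
    have := tendsto_integral_of_eLpNorm_two hX hF2 hFX
    simp only [hF0] at this
    exact tendsto_nhds_unique this tendsto_const_nhds
  refine ⟨(hasGaussianLaw_iff_of_integral_eq_zero hX h0).2 fun t => ?_, h0⟩
  -- Mean-square convergence implies convergence in distribution, hence of characteristic functions;
  -- those of the approximants depend only on their second moments, which converge as well.
  have hdist := (tendstoInMeasure_of_tendsto_eLpNorm (by norm_num) (fun n => (hF2 n).1) hX.1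
    hFX).tendstoInDistribution fun n => (hF2 n).1.aemeasurable
  have h1 := ProbabilityMeasure.tendsto_iff_tendsto_charFun.1 hdist.tendsto t
  refine tendsto_nhds_unique h1 ?_
  have h2 : ∀ n, charFun (P.map (F n)) t =
      Complex.exp (-(t ^ 2 * ∫ ω, F n ω * F n ω ∂P : ℝ) / 2) := fun n =>
    (hasGaussianLaw_iff_of_integral_eq_zero (hF2 n) (hF0 n)).1 (hF n) t
  simp only [ProbabilityMeasure.coe_mk, h2]
  have h3 := tendsto_integral_mul_of_eLpNorm hX hX hF2 hF2 hFX hFX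
  have hc : Continuous fun a : ℝ => Complex.exp (-(t ^ 2 * a : ℝ) / 2) := by fun_prop
  exact (hc.tendsto _).comp h3

end GaussianLimit

/-! ### Joint laws: covariance determines distribution and independence. -/

section StochIntLaw

variable {E Ω : Type*} [MeasurableSpace E] [MeasurableSpace Ω] {m : Measure E} {P : Measure Ω}
  {W : Set E → Ω → ℂ} [Neg E]

theorem IsHermitianNoise.hasGaussianLaw_re_simpleStochInt (hW : IsHermitianNoise m P W)
    {s : SimpleFunc E ℂ} (hs : SimpleFunc.FinLevels m s) :
    HasGaussianLaw (fun ω => (simpleStochInt W s ω).re) P ∧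
      ∫ ω, (simpleStochInt W s ω).re ∂P = 0 := by
  have hprob := hW.gaussian.isProbabilityMeasure
  let R := s.range.filter (fun z => z ≠ 0)
  have hsz : ∀ z ∈ R, m (s ⁻¹' {z}) < ⊤ := fun z hz => hs z (Finset.mem_filter.1 hz).2
  let j : R → {A : Set E // MeasurableSet A ∧ m A < ⊤} := fun z =>
    ⟨s ⁻¹' {z.1}, s.measurableSet_fiber z, hsz z.1 z.2⟩
  -- Joint Gaussianity of the noise is over ℝ, so w ↦ Re(z w) is an admissible functional.
  let L : R → ℂ →L[ℝ] ℝ := fun z => Complex.reCLM.comp (ContinuousLinearMap.mul ℝ ℂ z.1)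
  have hsum : ∀ ω, (simpleStochInt W s ω).re = ∑ z : R, L z (W (j z).1 ω) := fun ω => by
    unfold simpleStochInt
    rw [Complex.re_sum, ← Finset.sum_coe_sort]
    rfl
  constructor
  · have h1 := ((hW.gaussian.comp_right j).comp_left L).hasGaussianLaw_fun_sum (I := Finset.univ)
    simp_rw [hsum]
    exact h1
  · have hi : ∀ z ∈ R, Integrable (fun ω => z * W (s ⁻¹' {z}) ω) P := fun z hz =>
      ((hW.memLp (s.measurableSet_fiber z) (hsz z hz)).integrable (by norm_num)).const_mul z
    have h2 : ∫ ω, simpleStochInt W s ω ∂P = 0 := by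
      unfold simpleStochInt
      rw [integral_finsetSum _ hi]
      refine Finset.sum_eq_zero fun z hz => ?_
      rw [integral_const_mul, hW.mean_zero _ (s.measurableSet_fiber z) (hsz z hz), mul_zero]
    have h3 := integral_re (𝕜 := ℂ)
      ((hW.memLp_simpleStochInt hs).integrable (q := 2) (by norm_num))
    rw [h2] at h3
    exact h3

theorem IsStochInt.hasGaussianLaw_re (hW : IsHermitianNoise m P W) {f : E → ℂ} {X : Ω → ℂ}
    (hX : IsStochInt m P W f X) :
    HasGaussianLaw (fun ω => (X ω).re) P ∧ ∫ ω, (X ω).re ∂P = 0 := by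
  have hprob := hW.gaussian.isProbabilityMeasure
  obtain ⟨hf, hX2, s, hs, hsf, hsX⟩ := hX
  refine hasGaussianLaw_of_tendsto_eLpNorm (F := fun n ω => (simpleStochInt W (s n) ω).re) hX2.re
    (fun n => (hW.hasGaussianLaw_re_simpleStochInt (hs n)).1)
    (fun n => (hW.hasGaussianLaw_re_simpleStochInt (hs n)).2) ?_
  refine tendsto_of_tendsto_of_tendsto_of_le_of_le tendsto_const_nhds hsX (fun _ => zero_le)
    fun n => ?_
  refine eLpNorm_mono fun ω => ?_
  rw [← Complex.sub_re]
  exact Complex.abs_re_le_norm _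

/-- A family of real random variables, each of which is a stochastic integral. -/
def IsStochIntField {ι : Type*} (m : Measure E) (P : Measure Ω) (W : Set E → Ω → ℂ)
    (f : ι → E → ℂ) (V : ι → Ω → ℝ) : Prop :=
  ∀ i, IsStochInt m P W (f i) (fun ω => (V i ω : ℂ))

namespace IsStochIntField

variable {ι : Type*} {f : ι → E → ℂ} {V : ι → Ω → ℝ}

omit [Neg E] in
theorem memLp (hV : IsStochIntField m P W f V) (i : ι) : MemLp (V i) 2 P := by
  simpa using (hV i).memLp_right.re

theorem integral_eq_zero (hW : IsHermitianNoise m P W) (hV : IsStochIntField m P W f V) (i : ι) :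
    ∫ ω, V i ω ∂P = 0 := by
  simpa using ((hV i).hasGaussianLaw_re hW).2

theorem integral_mul (hW : IsHermitianNoise m P W) (hV : IsStochIntField m P W f V) (i j : ι) :
    ((∫ ω, V i ω * V j ω ∂P : ℝ) : ℂ) = ∫ e, f i e * (starRingEnd ℂ) (f j e) ∂m := by
  rw [← (hV i).integral_mul_conj hW (hV j), ← integral_complex_ofReal]
  simp

theorem hasGaussianLaw [Finite ι] (hW : IsHermitianNoise m P W)
    (hV : IsStochIntField m P W f V) : HasGaussianLaw (fun ω i => V i ω) P := by
  classical
  have := Fintype.ofFinite ι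
  have hmeas : AEMeasurable (fun ω i => V i ω) P :=
    aemeasurable_pi_lambda _ fun i => (hV.memLp i).1.aemeasurable
  refine ⟨isGaussian_of_isGaussian_map fun L => ?_⟩
  rw [AEMeasurable.map_map_of_aemeasurable L.continuous.aemeasurable hmeas]
  -- A linear functional of the vector is the integral of the same combination of kernels, hence
  -- Gaussian.
  have h := ((IsStochInt.sum hW Finset.univ fun i _ => (hV i).const_mul hW
    (L (fun j => if i = j then 1 else 0))).hasGaussianLaw_re hW).1
  convert h.isGaussian_map using 2
  ext ω
  have := LinearMap.pi_apply_eq_sum_univ (L : (ι → ℝ) →ₗ[ℝ] ℝ) (fun i => V i ω)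
  simp only [ContinuousLinearMap.coe_coe] at this
  simp [this, mul_comm]

omit [Neg E] in
theorem comp (hV : IsStochIntField m P W f V) {κ : Type*} (j : κ → ι) :
    IsStochIntField m P W (fun k => f (j k)) (fun k => V (j k)) :=
  fun k => hV (j k)

theorem isGaussianProcess (hW : IsHermitianNoise m P W) (hV : IsStochIntField m P W f V) :
    IsGaussianProcess V P :=
  ⟨fun I => (hV.comp (fun i : I => i.1)).hasGaussianLaw hW⟩

/-- Two fields of stochastic integrals with the same covariance function have the same
finite-dimensional distributions. -/
theorem fddEq {E' : Type*} [MeasurableSpace E'] [Neg E'] {m' : Measure E'}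
    {W' : Set E' → Ω → ℂ} {g : ι → E' → ℂ} {V' : ι → Ω → ℝ}
    (hW : IsHermitianNoise m P W) (hW' : IsHermitianNoise m' P W')
    (hV : IsStochIntField m P W f V) (hV' : IsStochIntField m' P W' g V')
    (hcov : ∀ i j, ∫ e, f i e * (starRingEnd ℂ) (f j e) ∂m =
      ∫ e, g i e * (starRingEnd ℂ) (g j e) ∂m') : FddEq P V V' := by
  have hprob := hW.gaussian.isProbabilityMeasure
  classical
  intro I
  have h1 := (hV.comp (fun i : I => i.1)).hasGaussianLaw hW
  have h2 := (hV'.comp (fun i : I => i.1)).hasGaussianLaw hW'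
  refine ⟨h1.aemeasurable, h2.aemeasurable, ?_⟩
  have hp1 := h1.isGaussian_map
  have hp2 := h2.isGaussian_map
  refine Measure.ext_of_charFunDual ?_
  ext L
  -- Only the mean and the variance of `L` remain; the mean is zero and the variance is a quadratic
  -- form in the covariances.
  rw [h1.charFunDual_map_eq_fun, h2.charFunDual_map_eq_fun]
  have hlin : ∀ (U : ι → Ω → ℝ) (ω : Ω), L (fun i : I => U i ω) =
      ∑ i : I, U i ω * L (fun j => if i = j then 1 else 0) := fun U ω => by
    have := LinearMap.pi_apply_eq_sum_univ (L : (I → ℝ) →ₗ[ℝ] ℝ) (fun i : I => U i ω)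
    simpa only [ContinuousLinearMap.coe_coe, smul_eq_mul] using this
  have hmean : ∀ (U : ι → Ω → ℝ), (∀ i, MemLp (U i) 2 P) → (∀ i, ∫ ω, U i ω ∂P = 0) →
      ∫ ω, L (fun i : I => U i ω) ∂P = 0 := fun U hU hU0 => by
    simp_rw [hlin]
    have hi : ∀ i : I, Integrable (fun ω => U i ω * L (fun j => if i = j then 1 else 0)) P :=
      fun i => ((hU i).integrable (by norm_num)).mul_const _
    rw [integral_finsetSum _ fun i _ => hi i]
    refine Finset.sum_eq_zero fun i _ => ?_
    rw [integral_mul_const, hU0, zero_mul]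
  have hvar : ∀ (U : ι → Ω → ℝ), (∀ i, MemLp (U i) 2 P) → (∀ i, ∫ ω, U i ω ∂P = 0) →
      Var[fun ω => L (fun i : I => U i ω); P] = ∑ i : I, ∑ j : I,
        (∫ ω, U i ω * U j ω ∂P) * (L (fun k => if i = k then 1 else 0) *
          L (fun k => if j = k then 1 else 0)) := fun U hU hU0 => by
    have hi : ∀ i j : I, Integrable (fun ω => (U i ω * U j ω) *
        (L (fun k => if i = k then 1 else 0) * L (fun k => if j = k then 1 else 0))) P :=
      fun i j => ((hU i).integrable_mul (hU j)).mul_const _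
    rw [variance_of_integral_eq_zero _ (hmean U hU hU0)]
    · simp_rw [hlin, sq, Finset.sum_mul_sum]
      have h3 : ∀ ω, ∑ i : I, ∑ j : I, (U i ω * L (fun k => if i = k then 1 else 0)) *
          (U j ω * L (fun k => if j = k then 1 else 0)) = ∑ i : I, ∑ j : I, (U i ω * U j ω) *
        (L (fun k => if i = k then 1 else 0) * L (fun k => if j = k then 1 else 0)) := fun ω =>
        Finset.sum_congr rfl fun i _ => Finset.sum_congr rfl fun j _ => by ring
      simp_rw [h3]
      rw [integral_finsetSum _ fun i _ => integrable_finsetSum _ fun j _ => hi i j]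
      refine Finset.sum_congr rfl fun i _ => ?_
      rw [integral_finsetSum _ fun j _ => hi i j]
      refine Finset.sum_congr rfl fun j _ => ?_
      rw [integral_mul_const]
    · simp_rw [hlin]
      exact Finset.aemeasurable_fun_sum _ fun i _ => ((hU i).1.aemeasurable).mul_const _
  have hc : ∀ i j, ∫ ω, V i ω * V j ω ∂P = ∫ ω, V' i ω * V' j ω ∂P := fun i j => by
    have := (hV.integral_mul hW i j).trans ((hcov i j).trans (hV'.integral_mul hW' i j).symm)
    exact_mod_cast this
  rw [hmean V hV.memLp (hV.integral_eq_zero hW), hmean V' hV'.memLp (hV'.integral_eq_zero hW'),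
    hvar V hV.memLp (hV.integral_eq_zero hW), hvar V' hV'.memLp (hV'.integral_eq_zero hW')]
  simp_rw [hc]

end IsStochIntField

theorem IsStochInt.indepFun (hW : IsHermitianNoise m P W) {f g : E → ℂ} {X Y : Ω → ℝ}
    (hX : IsStochInt m P W f (fun ω => (X ω : ℂ))) (hY : IsStochInt m P W g (fun ω => (Y ω : ℂ)))
    (h : ∫ e, f e * (starRingEnd ℂ) (g e) ∂m = 0) : IndepFun X Y P := by
  have hprob := hW.gaussian.isProbabilityMeasure
  have hV : IsStochIntField m P W ![f, g] ![X, Y] := fun i => by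
    fin_cases i
    · exact hX
    · exact hY
  have hG := (hV.hasGaussianLaw hW).prodMk 0 1
  refine HasGaussianLaw.indepFun_of_covariance_eq_zero hG ?_
  have hX0 : ∫ ω, X ω ∂P = 0 := hV.integral_eq_zero hW 0
  rw [covariance_eq_sub (X := X) (Y := Y) (hV.memLp 0) (hV.memLp 1), hX0, zero_mul, sub_zero]
  have h2 := hV.integral_mul hW 0 1
  simp only [Matrix.cons_val_zero, Matrix.cons_val_one, h] at h2
  exact_mod_cast h2

/-- Independent centred variables are uncorrelated. This is the direction used to refute
independence. -/
theorem IsStochInt.integral_mul_conj_eq_zero_of_indepFun (hW : IsHermitianNoise m P W)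
    {f g : E → ℂ} {X Y : Ω → ℝ} (hX : IsStochInt m P W f (fun ω => (X ω : ℂ)))
    (hY : IsStochInt m P W g (fun ω => (Y ω : ℂ))) (h : IndepFun X Y P) :
    ∫ e, f e * (starRingEnd ℂ) (g e) ∂m = 0 := by
  have hV : IsStochIntField m P W ![f, g] ![X, Y] := fun i => by
    fin_cases i
    · exact hX
    · exact hY
  have h2 := hV.integral_mul hW 0 1
  have h3 := h.integral_mul_eq_mul_integral (hV.memLp 0).1 (hV.memLp 1).1
  have h4 : ∫ ω, X ω ∂P = 0 := hV.integral_eq_zero hW 0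
  rw [h4, zero_mul] at h3
  simp only [Matrix.cons_val_zero, Matrix.cons_val_one] at h2
  rw [← h2]
  exact_mod_cast h3

/-- Almost surely equal stochastic integrals have almost everywhere equal integrands. -/
theorem IsStochInt.ae_eq_of_ae_eq (hW : IsHermitianNoise m P W)
    {f g : E → ℂ} {X Y : Ω → ℂ} (hX : IsStochInt m P W f X) (hY : IsStochInt m P W g Y)
    (h : X =ᵐ[P] Y) : f =ᵐ[m] g := by
  have hY' := hY.congr_right h.symm
  exact ae_eq_of_integral_mul_conj_eq hX.memLp_left hY.memLp_left
    (hX.integral_mul_conj hW hX).symm (hX.integral_mul_conj hW hY').symm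
    (hY'.integral_mul_conj hW hX).symm (hY'.integral_mul_conj hW hY').symm

end StochIntLaw

/-! ### Construction of the noises. -/

section Isonormal

variable {Ω : Type*} [MeasurableSpace Ω] {P : Measure Ω} [IsProbabilityMeasure P]

/-- A linear isometry onto a space of centred Gaussian variables, built from an independent standard
Gaussian family indexed by a Hilbert basis. -/
theorem exists_isonormal {ι H : Type*} [NormedAddCommGroup H] [InnerProductSpace ℝ H]
    (b : HilbertBasis ι ℝ H) {ξ : ι → Ω → ℝ} (hξ : ∀ i, HasLaw (ξ i) (gaussianReal 0 1) P)
    (hind : iIndepFun ξ P) :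
    ∃ J : H →ₗᵢ[ℝ] Lp ℝ 2 P, ∀ h, HasGaussianLaw (J h) P ∧ ∫ ω, J h ω ∂P = 0 := by
  have hG : ∀ i, HasGaussianLaw (ξ i) P := fun i => (hξ i).hasGaussianLaw
  have hL2 : ∀ i, MemLp (ξ i) 2 P := fun i => (hG i).memLp_two
  have h0 : ∀ i, ∫ ω, ξ i ω ∂P = 0 := fun i => by
    rw [(hξ i).integral_eq, integral_id_gaussianReal]
  have hproc : IsGaussianProcess ξ P := ⟨fun I =>
    (hind.precomp (g := fun i : I => i.1) Subtype.val_injective).hasGaussianLaw fun i => hG i⟩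
  let e : ι → Lp ℝ 2 P := fun i => (hL2 i).toLp (ξ i)
  have hinner : ∀ i j, inner ℝ (e i) (e j) = ∫ ω, ξ i ω * ξ j ω ∂P := fun i j => by
    rw [L2.inner_def]
    refine integral_congr_ae ?_
    filter_upwards [(hL2 i).coeFn_toLp, (hL2 j).coeFn_toLp] with ω h1 h2
    rw [RCLike.inner_apply, h1, h2, conj_trivial, mul_comm]
  have hon : Orthonormal ℝ e := by
    classical
    rw [orthonormal_iff_ite]
    intro i j
    rw [hinner]
    split_ifs with h
    · subst h
      have := variance_of_integral_eq_zero (hL2 i).1.aemeasurable (h0 i)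
      rw [(hξ i).variance_eq, variance_id_gaussianReal] at this
      simpa [sq] using this.symm
    · have := (hind.indepFun h).integral_mul_eq_mul_integral (hL2 i).1 (hL2 j).1
      rw [h0, zero_mul] at this
      exact this
  let J : H →ₗᵢ[ℝ] Lp ℝ 2 P :=
    hon.orthogonalFamily.linearIsometry.comp b.repr.toLinearIsometry
  refine ⟨J, fun h => ?_⟩
  -- Finite combinations of the family are Gaussian, and J h is a mean-square limit of such
  -- combinations.
  let S : Set (Lp ℝ 2 P) :=
    Set.range fun c : Finset ι × (ι → ℝ) => ∑ i ∈ c.1, c.2 i • e i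
  have hmem : J h ∈ closure S := by
    refine mem_closure_of_tendsto (hon.orthogonalFamily.hasSum_linearIsometry (b.repr h))
      (Eventually.of_forall fun I => ⟨(I, b.repr h), ?_⟩)
    simp
  obtain ⟨Y, hYS, hY⟩ := mem_closure_iff_seq_limit.1 hmem
  choose c hc using hYS
  have hYeq : ∀ n, (Y n : Ω → ℝ) =ᵐ[P] fun ω => ∑ i ∈ (c n).1, (c n).2 i * ξ i ω := fun n => by
    rw [← hc n]
    refine (Lp.coeFn_finsetSum _ _).trans ?_
    have : ∀ᵐ ω ∂P, ∀ i ∈ (c n).1, ((c n).2 i • e i : Lp ℝ 2 P) ω = (c n).2 i * ξ i ω := by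
      rw [eventually_all_finset]
      intro i _
      filter_upwards [Lp.coeFn_smul ((c n).2 i) (e i), (hL2 i).coeFn_toLp] with ω h1 h2
      rw [h1, Pi.smul_apply, h2, smul_eq_mul]
    filter_upwards [this] with ω hω
    rw [Finset.sum_apply]
    exact Finset.sum_congr rfl hω
  refine hasGaussianLaw_of_tendsto_eLpNorm (F := fun n => Y n) (Lp.memLp _) (fun n => ?_)
    (fun n => ?_) ((Lp.tendsto_Lp_iff_tendsto_eLpNorm' Y (J h)).1 hY)
  · exact ((hproc.smul (c n).2).hasGaussianLaw_fun_sum (I := (c n).1)).congr (hYeq n).symm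
  · rw [integral_congr_ae (hYeq n), integral_finsetSum _ fun i _ =>
      ((hL2 i).integrable (by norm_num)).const_mul _]
    refine Finset.sum_eq_zero fun i _ => ?_
    rw [integral_const_mul, h0, mul_zero]

end Isonormal

section Noise

variable {E Ω : Type*} [MeasurableSpace E] [InvolutiveNeg E] [MeasurableNeg E]
  [MeasurableSpace Ω] {P : Measure Ω} [IsProbabilityMeasure P] {m : Measure E}

open Classical in
/-- The indicator of a set of finite measure as an element of `L²`, and `0` for other sets. -/
noncomputable def indicatorLp (m : Measure E) (A : Set E) : Lp ℝ 2 m :=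
  if h : MeasurableSet A ∧ m A ≠ ⊤ then indicatorConstLp 2 h.1 h.2 1 else 0

omit [InvolutiveNeg E] [MeasurableNeg E] in
theorem inner_indicatorLp {A B : Set E} (hA : MeasurableSet A) (hA' : m A < ⊤)
    (hB : MeasurableSet B) (hB' : m B < ⊤) :
    inner ℝ (indicatorLp m A) (indicatorLp m B) = m.real (A ∩ B) := by
  rw [indicatorLp, indicatorLp, dif_pos ⟨hA, hA'.ne⟩, dif_pos ⟨hB, hB'.ne⟩]
  exact L2.real_inner_indicatorConstLp_one_indicatorConstLp_one hA hB hA'.ne hB'.ne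

/-- The even part of an indicator in `L²`. -/
noncomputable def evenIndicatorLp (m : Measure E) (A : Set E) : Lp ℝ 2 m :=
  (1 / 2 : ℝ) • (indicatorLp m A + indicatorLp m ((fun z => -z) ⁻¹' A))

/-- The odd part of an indicator in `L²`. -/
noncomputable def oddIndicatorLp (m : Measure E) (A : Set E) : Lp ℝ 2 m :=
  (1 / 2 : ℝ) • (indicatorLp m A - indicatorLp m ((fun z => -z) ⁻¹' A))

/-- The Hermitian noise with real part `J (even part of 1_A)` and imaginary part
`J (odd part of 1_A)`. -/
noncomputable def noiseOfIsometry (m : Measure E) (J : Lp ℝ 2 m →ₗᵢ[ℝ] Lp ℝ 2 P) (A : Set E) (ω : Ω) : ℂ :=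
  J (evenIndicatorLp m A) ω + J (oddIndicatorLp m A) ω * Complex.I

/-- Reflection fixes the even part of an indicator and negates the odd part, which gives the
Hermitian symmetry. In the covariance, even and odd parts are orthogonal, so the imaginary part
vanishes; the real part is the average of m(A ∩ B) and m(-A ∩ -B), which coincide. -/
theorem isHermitianNoise_noiseOfIsometry [m.IsNegInvariant] (J : Lp ℝ 2 m →ₗᵢ[ℝ] Lp ℝ 2 P)
    (hJ : ∀ h, HasGaussianLaw (J h) P ∧ ∫ ω, J h ω ∂P = 0) :
    IsHermitianNoise m P (noiseOfIsometry m J) := by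
  have hneg : MeasurePreserving (fun e : E => -e) m m := Measure.measurePreserving_neg m
  have hnn : ∀ A : Set E, (fun z : E => -z) ⁻¹' ((fun z => -z) ⁻¹' A) = A := fun A => by
    ext z; simp
  have hL2 : ∀ h, MemLp (J h) 2 P := fun h => Lp.memLp _
  have hint : ∀ h, Integrable (J h) P := fun h => (hL2 h).integrable (by norm_num)
  have hJJ : ∀ g h, ∫ ω, J g ω * J h ω ∂P = inner ℝ g h := fun g h => by
    rw [← J.inner_map_map, L2.inner_def]
    simp only [RCLike.inner_apply, conj_trivial, mul_comm]
  refine ⟨⟨fun I => ?_⟩, fun A _ _ => ?_, fun A _ _ => ?_, fun A B hA hA' hB hB' => ?_⟩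
  · have hmeas : AEMeasurable (fun ω => I.restrict (fun A => noiseOfIsometry m J A.1 ω)) P := by
      refine aemeasurable_pi_lambda _ fun A => ?_
      exact ((Complex.measurable_ofReal.comp_aemeasurable (hL2 _).1.aemeasurable).add
        ((Complex.measurable_ofReal.comp_aemeasurable (hL2 _).1.aemeasurable).mul_const _))
    refine ⟨isGaussian_of_isGaussian_map fun L => ?_⟩
    rw [AEMeasurable.map_map_of_aemeasurable L.continuous.aemeasurable hmeas]
    classical
    -- Splitting each coordinate along 1 and i turns the functional into J of a single element of
    -- L².
    let g : Lp ℝ 2 m := ∑ A : I, (L (Pi.single A 1) • evenIndicatorLp m A.1.1 +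
      L (Pi.single A Complex.I) • oddIndicatorLp m A.1.1)
    refine (HasGaussianLaw.congr (hJ g).1 ?_).isGaussian_map
    have hJg : J g = ∑ A : I, (L (Pi.single A 1) • J (evenIndicatorLp m A.1.1) +
        L (Pi.single A Complex.I) • J (oddIndicatorLp m A.1.1)) := by
      simp only [g, map_sum, map_add, map_smul]
    rw [hJg]
    refine (Lp.coeFn_finsetSum _ _).trans ?_
    have : ∀ᵐ ω ∂P, ∀ A ∈ (Finset.univ : Finset I),
        (L (Pi.single A 1) • J (evenIndicatorLp m A.1.1) +
          L (Pi.single A Complex.I) • J (oddIndicatorLp m A.1.1) : Lp ℝ 2 P) ω =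
        L (Pi.single A (noiseOfIsometry m J A.1.1 ω)) := by
      rw [eventually_all_finset]
      intro A _
      filter_upwards [Lp.coeFn_add (L (Pi.single A 1) • J (evenIndicatorLp m A.1.1))
        (L (Pi.single A Complex.I) • J (oddIndicatorLp m A.1.1)),
        Lp.coeFn_smul (L (Pi.single A 1)) (J (evenIndicatorLp m A.1.1)),
        Lp.coeFn_smul (L (Pi.single A Complex.I)) (J (oddIndicatorLp m A.1.1))] with ω h1 h2 h3
      rw [h1, Pi.add_apply, h2, h3, Pi.smul_apply, Pi.smul_apply]
      have : (Pi.single A (noiseOfIsometry m J A.1.1 ω) : I → ℂ) =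
          J (evenIndicatorLp m A.1.1) ω • (Pi.single A 1 : I → ℂ) +
            J (oddIndicatorLp m A.1.1) ω • (Pi.single A Complex.I : I → ℂ) := by
        rw [← Pi.single_smul, ← Pi.single_smul, ← Pi.single_add]
        simp [noiseOfIsometry]
      rw [this, map_add, map_smul, map_smul]
      simp only [smul_eq_mul, mul_comm]
    filter_upwards [this] with ω hω
    rw [Finset.sum_apply, Finset.sum_congr rfl hω, ← map_sum, Function.comp,
      Finset.univ_sum_single]
    rfl
  · unfold noiseOfIsometry
    rw [integral_add (hint _).ofReal ((hint _).ofReal.mul_const _), integral_mul_const,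
      integral_complex_ofReal, integral_complex_ofReal, (hJ _).2, (hJ _).2]
    simp
  · have he : evenIndicatorLp m ((fun z => -z) ⁻¹' A) = evenIndicatorLp m A := by
      rw [evenIndicatorLp, evenIndicatorLp, hnn, add_comm]
    have ho : oddIndicatorLp m ((fun z => -z) ⁻¹' A) = -oddIndicatorLp m A := by
      rw [oddIndicatorLp, oddIndicatorLp, hnn, ← smul_neg, neg_sub]
    have hJo : J (oddIndicatorLp m ((fun z => -z) ⁻¹' A)) = -J (oddIndicatorLp m A) := by
      rw [ho, map_neg]
    filter_upwards [Lp.coeFn_neg (J (oddIndicatorLp m A))] with ω hω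
    unfold noiseOfIsometry
    rw [he, hJo, hω]
    simp
  · have hA2 : MeasurableSet ((fun z : E => -z) ⁻¹' A) := measurable_neg hA
    have hB2 : MeasurableSet ((fun z : E => -z) ⁻¹' B) := measurable_neg hB
    have hA3 : m ((fun z : E => -z) ⁻¹' A) < ⊤ := by
      rwa [hneg.measure_preimage hA.nullMeasurableSet]
    have hB3 : m ((fun z : E => -z) ⁻¹' B) < ⊤ := by
      rwa [hneg.measure_preimage hB.nullMeasurableSet]
    have hr : ∀ C : Set E, MeasurableSet C → m.real ((fun z : E => -z) ⁻¹' C) = m.real C :=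
      fun C hC => by rw [measureReal_def, measureReal_def, hneg.measure_preimage
        hC.nullMeasurableSet]
    have hr1 : m.real ((fun z : E => -z) ⁻¹' A ∩ (fun z : E => -z) ⁻¹' B) = m.real (A ∩ B) := by
      rw [← Set.preimage_inter, hr _ (hA.inter hB)]
    have hr2 : m.real ((fun z : E => -z) ⁻¹' A ∩ B) = m.real (A ∩ (fun z : E => -z) ⁻¹' B) := by
      rw [← hr _ (hA.inter hB2), Set.preimage_inter, hnn]
    have hmul : ∀ ω, noiseOfIsometry m J A ω * (starRingEnd ℂ) (noiseOfIsometry m J B ω) =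
        ((J (evenIndicatorLp m A) ω * J (evenIndicatorLp m B) ω +
          J (oddIndicatorLp m A) ω * J (oddIndicatorLp m B) ω : ℝ) : ℂ) +
        ((J (oddIndicatorLp m A) ω * J (evenIndicatorLp m B) ω -
          J (evenIndicatorLp m A) ω * J (oddIndicatorLp m B) ω : ℝ) : ℂ) * Complex.I := by
      intro ω
      unfold noiseOfIsometry
      apply Complex.ext <;> simp <;> ring
    have hi : ∀ g h, Integrable (fun ω => J g ω * J h ω) P := fun g h =>
      (hL2 g).integrable_mul (hL2 h)
    simp_rw [hmul]
    rw [integral_add ((hi _ _).add (hi _ _)).ofReal (((hi _ _).sub (hi _ _)).ofReal.mul_const _),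
      integral_mul_const, integral_complex_ofReal, integral_complex_ofReal,
      integral_add (hi _ _) (hi _ _), integral_sub (hi _ _) (hi _ _), hJJ, hJJ, hJJ, hJJ]
    simp only [evenIndicatorLp, oddIndicatorLp, real_inner_smul_left, real_inner_smul_right,
      inner_add_left, inner_add_right, inner_sub_left, inner_sub_right,
      inner_indicatorLp hA hA' hB hB', inner_indicatorLp hA2 hA3 hB hB',
      inner_indicatorLp hA hA' hB2 hB3, inner_indicatorLp hA2 hA3 hB2 hB3, hr1, hr2]
    push_cast
    ring

end Noise

/-- A single independent family indexed by the disjoint union of two Hilbert bases puts both noises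
on one probability space. -/
theorem exists_isHermitianNoise_pair {E E' : Type} [MeasurableSpace E] [InvolutiveNeg E]
    [MeasurableNeg E] [MeasurableSpace E'] [InvolutiveNeg E'] [MeasurableNeg E']
    (m : Measure E) (m' : Measure E') [m.IsNegInvariant] [m'.IsNegInvariant] :
    ∃ (Ω : Type) (_ : MeasurableSpace Ω) (P : Measure Ω)
        (W : Set E → Ω → ℂ) (W' : Set E' → Ω → ℂ),
      IsProbabilityMeasure P ∧ IsHermitianNoise m P W ∧ IsHermitianNoise m' P W' := by
  obtain ⟨ι, b, -⟩ := exists_hilbertBasis ℝ (Lp ℝ 2 m)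
  obtain ⟨ι', b', -⟩ := exists_hilbertBasis ℝ (Lp ℝ 2 m')
  obtain ⟨Ω, _, P, ξ, -, hξ, hind, hP⟩ := exists_iid (ι ⊕ ι') (gaussianReal 0 1)
  obtain ⟨J, hJ⟩ := exists_isonormal b (fun i => hξ (Sum.inl i)) (hind.precomp Sum.inl_injective)
  obtain ⟨J', hJ'⟩ :=
    exists_isonormal b' (fun i => hξ (Sum.inr i)) (hind.precomp Sum.inr_injective)
  exact ⟨Ω, _, P, _, _, hP, isHermitianNoise_noiseOfIsometry J hJ,
    isHermitianNoise_noiseOfIsometry J' hJ'⟩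

/-! ### Fields with a spectral kernel: stationarity, scaling, dependence. -/

section SpectralField

variable {E Ω : Type*} [MeasurableSpace E] [MeasurableSpace Ω] {m : Measure E} {P : Measure Ω}
  {W : Set E → Ω → ℂ}

/-- A family of square integrable Hermitian kernels on the frequency space `E`, vanishing on the axes,
whose rectangular increments are obtained by the phase factor `exp (i (u A + v B))`. -/
structure IsSpectralKernel [Neg E] (m : Measure E) (F : ℝ → ℝ → E → ℂ) (A B : E → ℝ) : Prop where
  memLp : ∀ x y, MemLp (F x y) 2 m
  hermitian : ∀ x y e, F x y (-e) = (starRingEnd ℂ) (F x y e)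
  zero_left : ∀ y e, F 0 y e = 0
  zero_right : ∀ x e, F x 0 e = 0
  increment : ∀ u v x y e, F x y e - F u y e - F x v e + F u v e =
    Complex.exp (Complex.I * (u * A e + v * B e : ℝ)) * F (x - u) (y - v) e

/-- A field on the closed quadrant given by stochastic integrals of the kernels `F`. -/
def IsSpectralField (m : Measure E) (P : Measure Ω) (W : Set E → Ω → ℂ) (F : ℝ → ℝ → E → ℂ)
    (V : ℝ → ℝ → Ω → ℝ) : Prop :=
  ∀ x y, 0 ≤ x → 0 ≤ y → IsStochInt m P W (F x y) (fun ω => (V x y ω : ℂ))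

/-- The complex phase `exp (i (u A + v B))`. -/
noncomputable def phase (A B : E → ℝ) (u v : ℝ) (e : E) : ℂ :=
  Complex.exp (Complex.I * (u * A e + v * B e : ℝ))

omit [MeasurableSpace E] in
theorem phase_mul_conj (A B : E → ℝ) (u v u' v' : ℝ) (e : E) :
    phase A B u v e * (starRingEnd ℂ) (phase A B u' v' e) = phase A B (u - u') (v - v') e := by
  simp only [phase, ← Complex.exp_conj, map_mul, Complex.conj_I, Complex.conj_ofReal,
    ← Complex.exp_add]
  congr 1
  push_cast
  ring

omit [MeasurableSpace E] in
theorem phase_zero (A B : E → ℝ) (e : E) : phase A B 0 0 e = 1 := by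
  simp [phase]

variable {F : ℝ → ℝ → E → ℂ} {A B : E → ℝ} {V : ℝ → ℝ → Ω → ℝ}

section Basic

theorem IsSpectralField.stochIntField (hV : IsSpectralField m P W F V) :
    IsStochIntField m P W (fun p : {p : ℝ × ℝ // 0 ≤ p.1 ∧ 0 ≤ p.2} => F p.1.1 p.1.2)
      (fun p => V p.1.1 p.1.2) :=
  fun p => hV _ _ p.2.1 p.2.2

variable [Neg E]

theorem IsSpectralField.isGaussianProcess (hW : IsHermitianNoise m P W)
    (hV : IsSpectralField m P W F V) :
    IsGaussianProcess (fun p : {p : ℝ × ℝ // 0 ≤ p.1 ∧ 0 ≤ p.2} => V p.1.1 p.1.2) P :=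
  hV.stochIntField.isGaussianProcess hW

theorem IsSpectralField.memLp_and_integral (hW : IsHermitianNoise m P W)
    (hV : IsSpectralField m P W F V) (x y : ℝ) (hx : 0 ≤ x) (hy : 0 ≤ y) :
    MemLp (V x y) 2 P ∧ ∫ ω, V x y ω ∂P = 0 :=
  ⟨hV.stochIntField.memLp ⟨(x, y), hx, hy⟩,
    hV.stochIntField.integral_eq_zero hW ⟨(x, y), hx, hy⟩⟩

theorem IsStochInt.ae_eq_zero (hW : IsHermitianNoise m P W) {f : E → ℂ} {X : Ω → ℝ}
    (hX : IsStochInt m P W f (fun ω => (X ω : ℂ))) (hf : ∀ e, f e = 0) : X =ᵐ[P] 0 := by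
  have h := hX.const_mul hW 0
  have hf' : (fun e => 0 * f e) = f := by ext e; simp [hf e]
  rw [hf'] at h
  filter_upwards [hX.ae_unique hW h] with ω hω
  simpa using hω

theorem IsSpectralField.ae_eq_zero (hF : IsSpectralKernel m F A B) (hW : IsHermitianNoise m P W)
    (hV : IsSpectralField m P W F V) (x : ℝ) (hx : 0 ≤ x) : V x 0 =ᵐ[P] 0 ∧ V 0 x =ᵐ[P] 0 :=
  ⟨(hV x 0 hx le_rfl).ae_eq_zero hW (hF.zero_right x),
    (hV 0 x le_rfl hx).ae_eq_zero hW (hF.zero_left x)⟩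

theorem IsSpectralField.rectIncr (hF : IsSpectralKernel m F A B) (hW : IsHermitianNoise m P W)
    (hV : IsSpectralField m P W F V) {u v x y : ℝ} (hu : 0 ≤ u) (hv : 0 ≤ v) (hx : 0 ≤ x)
    (hy : 0 ≤ y) :
    IsStochInt m P W (fun e => phase A B u v e * F (x - u) (y - v) e)
      (fun ω => (rectIncr V u v x y ω : ℂ)) := by
  have h := (((hV x y hx hy).sub hW (hV u y hu hy)).sub hW (hV x v hx hv)).add hW (hV u v hu hv)
  simp only [hF.increment] at h
  refine h.congr_right (ae_of_all _ fun ω => ?_)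
  simp only [_root_.rectIncr, Complex.ofReal_add, Complex.ofReal_sub]

omit [MeasurableSpace E] [Neg E] in
theorem phase_mul_conj_phase_mul (A B : E → ℝ) (u v : ℝ) (f g : E → ℂ) (e : E) :
    (phase A B u v e * f e) * (starRingEnd ℂ) (phase A B u v e * g e) =
      f e * (starRingEnd ℂ) (g e) := by
  have h := phase_mul_conj A B u v u v e
  rw [sub_self, sub_self, phase_zero] at h
  rw [map_mul, mul_mul_mul_comm, h, one_mul]

theorem IsSpectralField.hasStationaryRectIncr (hF : IsSpectralKernel m F A B)
    (hW : IsHermitianNoise m P W) (hV : IsSpectralField m P W F V) :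
    HasStationaryRectIncr P V := by
  intro u v hu hv
  refine IsStochIntField.fddEq hW hW (m := m) (m' := m)
    (fun p => hV.rectIncr hF hW hu.le hv.le (hu.le.trans p.2.1) (hv.le.trans p.2.2))
    (fun p => hV.rectIncr hF hW le_rfl le_rfl (sub_nonneg.2 p.2.1) (sub_nonneg.2 p.2.2)) ?_
  intro p q
  simp only [phase_mul_conj_phase_mul, sub_zero]

/-- The substitution D multiplies integrals by c and the kernel carries the factor a, so covariances
are multiplied by a²c; this has to be the square of r^H. -/
theorem IsSpectralField.isOperatorScaling (hW : IsHermitianNoise m P W)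
    (hV : IsSpectralField m P W F V) {γ H : ℝ} (hH : 0 < H)
    (hscal : ∀ r : ℝ, 0 < r → ∃ (D : E ≃ᵐ E) (a c : ℝ), 0 ≤ c ∧
      m.map D = ENNReal.ofReal c • m ∧ a ^ 2 * c = (r ^ H) ^ 2 ∧
      ∀ x y e, F (r * x) (r ^ γ * y) e = a * F x y (D e)) :
    IsOperatorScaling P V γ H := by
  refine ⟨hH, fun r hr => ?_⟩
  obtain ⟨D, a, c, hc, hD, hac, hFD⟩ := hscal r hr
  have h2 : IsStochIntField m P W
      (fun (p : {p : ℝ × ℝ // 0 ≤ p.1 ∧ 0 ≤ p.2}) e => ((r ^ H : ℝ) : ℂ) * F p.1.1 p.1.2 e)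
      (fun p ω => r ^ H * V p.1.1 p.1.2 ω) := fun p => by
    simpa using (hV _ _ p.2.1 p.2.2).const_mul hW ((r ^ H : ℝ) : ℂ)
  refine IsStochIntField.fddEq hW hW (m := m) (m' := m)
    (fun p => hV _ _ (mul_nonneg hr.le p.2.1) (mul_nonneg (Real.rpow_nonneg hr.le _) p.2.2)) h2 ?_
  intro p q
  have key : ∫ e, F p.1.1 p.1.2 (D e) * (starRingEnd ℂ) (F q.1.1 q.1.2 (D e)) ∂m =
      c * ∫ e, F p.1.1 p.1.2 e * (starRingEnd ℂ) (F q.1.1 q.1.2 e) ∂m := by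
    rw [← integral_map_equiv D (fun e => F p.1.1 p.1.2 e * (starRingEnd ℂ) (F q.1.1 q.1.2 e)), hD,
      integral_smul_measure, ENNReal.toReal_ofReal hc, Complex.real_smul]
  simp only [hFD, map_mul, Complex.conj_ofReal]
  have e1 : ∀ (s : ℝ) (z w : ℂ), (s * z) * (s * w) = ((s ^ 2 : ℝ) : ℂ) * (z * w) := fun s z w => by
    push_cast; ring
  simp only [e1]
  rw [integral_const_mul, integral_const_mul, key, ← hac]
  push_cast
  ring

end Basic

section Dependence

variable [Neg E]

theorem IsSpectralField.incr (hF : IsSpectralKernel m F A B) (hW : IsHermitianNoise m P W)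
    (hV : IsSpectralField m P W F V) (K : PosRect) :
    IsStochInt m P W (fun e => phase A B K.u K.v e * F (K.x - K.u) (K.y - K.v) e)
      (fun ω => (K.incr V ω : ℂ)) :=
  hV.rectIncr hF hW K.hu K.hv (K.hu.trans K.hux.le) (K.hv.trans K.hvy.le)

/-- The unit square with lower left corner `(u, v)`. -/
def unitSquare (u v : ℝ) (hu : 0 ≤ u) (hv : 0 ≤ v) : PosRect where
  u := u
  v := v
  x := u + 1
  y := v + 1
  hu := hu
  hv := hv
  hux := by linarith
  hvy := by linarith

theorem mem_unitSquare {u v : ℝ} {hu : 0 ≤ u} {hv : 0 ≤ v} {p : ℝ × ℝ} :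
    p ∈ (unitSquare u v hu hv).toSet ↔ (u < p.1 ∧ p.1 ≤ u + 1) ∧ (v < p.2 ∧ p.2 ≤ v + 1) :=
  Iff.rfl

/-- The vector (b, -a) spans the line. Shifting a unit square by it multiplies the integrand by a
phase, and equal increments have almost everywhere equal integrands. -/
theorem IsSpectralField.not_invariant (hF : IsSpectralKernel m F A B)
    (hW : IsHermitianNoise m P W) (hV : IsSpectralField m P W F V) {a b : ℝ}
    (h : ¬ ∀ᵐ e ∂m, F 1 1 e = 0 ∨ phase A B b (-a) e = 1) : ¬ InvariantRectIncrDir P V a b := by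
  intro hinv
  apply h
  -- The corner (|b|, |a|) keeps both the square and its translate in the quadrant.
  have hb : 0 ≤ |b| + b := by linarith [neg_abs_le b]
  have ha : 0 ≤ |a| + -a := by linarith [le_abs_self a]
  let K := unitSquare |b| |a| (abs_nonneg b) (abs_nonneg a)
  let K' := unitSquare (|b| + b) (|a| + -a) hb ha
  have hK : K'.toSet = (fun p => p + (b, -a)) '' K.toSet := by
    ext p
    simp only [K, K', mem_unitSquare, Set.mem_image]
    constructor
    · intro hp
      refine ⟨p - (b, -a), ?_, by simp⟩
      simp only [Prod.fst_sub, Prod.snd_sub]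
      refine ⟨⟨?_, ?_⟩, ?_, ?_⟩ <;> linarith [hp.1.1, hp.1.2, hp.2.1, hp.2.2]
    · rintro ⟨q, hq, rfl⟩
      simp only [Prod.fst_add, Prod.snd_add]
      refine ⟨⟨?_, ?_⟩, ?_, ?_⟩ <;> linarith [hq.1.1, hq.1.2, hq.2.1, hq.2.2]
  have h1 := hinv b (-a) (by ring) K K' hK
  have h2 := (hV.incr hF hW K').ae_eq_of_ae_eq hW (hV.incr hF hW K) (by
    filter_upwards [h1] with ω hω
    rw [hω])
  filter_upwards [h2] with e he
  simp only [K, K', unitSquare, add_sub_cancel_left] at he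
  have hp := phase_mul_conj A B (|b| + b) (|a| + -a) |b| |a| e
  rw [add_sub_cancel_left, add_sub_cancel_left] at hp
  by_cases h0 : F 1 1 e = 0
  · exact Or.inl h0
  · right
    rw [← hp, mul_right_cancel₀ h0 he, phase_mul_conj, sub_self, sub_self, phase_zero]

/-- The integral in `hcov` is the real part of the inner product of the two increment kernels, that
is, the covariance of the increments. -/
theorem IsSpectralField.not_indep (hF : IsSpectralKernel m F A B)
    (hW : IsHermitianNoise m P W) (hV : IsSpectralField m P W F V) {a b u v u' v' a' b' d : ℝ}
    (hu : 0 ≤ u) (hv : 0 ≤ v) (hu' : 0 ≤ u') (hv' : 0 ≤ v')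
    (hab' : a' ≠ 0 ∨ b' ≠ 0) (hperp : a * a' + b * b' = 0)
    (hsep : SeparatedByLine a' b' d (unitSquare u v hu hv).toSet (unitSquare u' v' hu' hv').toSet)
    (hcov : 0 < ∫ e, ‖F 1 1 e‖ ^ 2 * Real.cos ((u - u') * A e + (v - v') * B e) ∂m) :
    ¬ IndepRectIncrDir P V a b := by
  intro hind
  have h1 := hind a' b' d hab' hperp _ _ hsep
  have h2 := IsStochInt.integral_mul_conj_eq_zero_of_indepFun hW
    (hV.incr hF hW (unitSquare u v hu hv)) (hV.incr hF hW (unitSquare u' v' hu' hv')) h1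
  simp only [unitSquare, add_sub_cancel_left] at h2
  have hint := integrable_mul_conj (hV.incr hF hW (unitSquare u v hu hv)).memLp_left
    (hV.incr hF hW (unitSquare u' v' hu' hv')).memLp_left
  simp only [unitSquare, add_sub_cancel_left] at hint
  have h3 := integral_re (𝕜 := ℂ) hint
  rw [h2] at h3
  refine hcov.ne' ?_
  rw [map_zero] at h3
  rw [← h3]
  refine integral_congr_ae (ae_of_all _ fun e => ?_)
  have e1 : phase A B u v e * F 1 1 e * (starRingEnd ℂ) (phase A B u' v' e * F 1 1 e) =
      phase A B (u - u') (v - v') e * ((‖F 1 1 e‖ ^ 2 : ℝ) : ℂ) := by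
    rw [map_mul, mul_mul_mul_comm, phase_mul_conj, Complex.mul_conj, Complex.normSq_eq_norm_sq]
  have e2 : (phase A B (u - u') (v - v') e).re =
      Real.cos ((u - u') * A e + (v - v') * B e) := by
    rw [phase, mul_comm, Complex.exp_ofReal_mul_I_re]
  simp only [e1, RCLike.re_eq_complex_re, Complex.re_mul_ofReal, e2]
  ring

/-- The increments over all pairs of separated rectangles with covariance zero. -/
theorem IsSpectralField.indep_of_forall (hF : IsSpectralKernel m F A B)
    (hW : IsHermitianNoise m P W) (hV : IsSpectralField m P W F V) {a b : ℝ}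
    (h : ∀ a' b' d : ℝ, (a' ≠ 0 ∨ b' ≠ 0) → a * a' + b * b' = 0 → ∀ K K' : PosRect,
      SeparatedByLine a' b' d K.toSet K'.toSet →
      ∫ e, (phase A B K.u K.v e * F (K.x - K.u) (K.y - K.v) e) *
        (starRingEnd ℂ) (phase A B K'.u K'.v e * F (K'.x - K'.u) (K'.y - K'.v) e) ∂m = 0) :
    IndepRectIncrDir P V a b := fun a' b' d hab' hperp K K' hsep =>
  (hV.incr hF hW K).indepFun hW (hV.incr hF hW K') (h a' b' d hab' hperp K K' hsep)

end Dependence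

end SpectralField

/-! ### Geometry of rectangles. -/

theorem eq_of_Ioc_eq_Ioc {a b c d : ℝ} (hab : a < b) (h : Set.Ioc a b = Set.Ioc c d) :
    a = c ∧ b = d := by
  have hcd : c < d := Set.nonempty_Ioc.1 (h ▸ Set.nonempty_Ioc.2 hab)
  have h1 := congrArg sInf h
  have h2 := congrArg sSup h
  rw [csInf_Ioc hab, csInf_Ioc hcd] at h1
  rw [csSup_Ioc hab, csSup_Ioc hcd] at h2
  exact ⟨h1, h2⟩

theorem PosRect.eq_of_toSet_eq {K K' : PosRect} {z w : ℝ}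
    (h : K'.toSet = (fun p => p + (z, w)) '' K.toSet) :
    K'.u = K.u + z ∧ K'.x = K.x + z ∧ K'.v = K.v + w ∧ K'.y = K.y + w := by
  have himg : (fun p : ℝ × ℝ => p + (z, w)) '' K.toSet =
      Set.Ioc (K.u + z) (K.x + z) ×ˢ Set.Ioc (K.v + w) (K.y + w) := by
    ext p
    simp only [PosRect.toSet, Set.mem_image, Set.mem_prod, Set.mem_Ioc]
    constructor
    · rintro ⟨q, hq, rfl⟩
      simp only [Prod.fst_add, Prod.snd_add]
      refine ⟨⟨?_, ?_⟩, ?_, ?_⟩ <;> linarith [hq.1.1, hq.1.2, hq.2.1, hq.2.2]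
    · intro hp
      refine ⟨p - (z, w), ?_, by simp⟩
      simp only [Prod.fst_sub, Prod.snd_sub]
      refine ⟨⟨?_, ?_⟩, ?_, ?_⟩ <;> linarith [hp.1.1, hp.1.2, hp.2.1, hp.2.2]
  rw [himg, PosRect.toSet, Set.prod_eq_prod_iff_of_nonempty
    ((Set.nonempty_Ioc.2 K'.hux).prod (Set.nonempty_Ioc.2 K'.hvy))] at h
  have h1 := eq_of_Ioc_eq_Ioc K'.hux h.1
  have h2 := eq_of_Ioc_eq_Ioc K'.hvy h.2
  exact ⟨h1.1, h1.2, h2.1, h2.2⟩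

/-- If the vertical ranges overlapped, both rectangles would have points at two common levels s < t.
Separation would then force b's = d = b't. -/
theorem le_or_le_of_separated_snd {b' d : ℝ} (hb' : b' ≠ 0) {K K' : PosRect}
    (h : SeparatedByLine 0 b' d K.toSet K'.toSet) : K.y ≤ K'.v ∨ K'.y ≤ K.v := by
  have hmem : ∀ (K : PosRect) (t : ℝ), K.v < t → t ≤ K.y → (K.x, t) ∈ K.toSet :=
    fun K t h1 h2 => ⟨⟨K.hux, le_rfl⟩, h1, h2⟩
  by_contra! hcon
  obtain ⟨h1, h2⟩ := hcon
  have hmax : max K.v K'.v < min K.y K'.y :=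
    max_lt (lt_min K.hvy h2) (lt_min h1 K'.hvy)
  obtain ⟨s, hs1, hs2⟩ := exists_between hmax
  obtain ⟨t, ht1, ht2⟩ := exists_between hs2
  rw [max_lt_iff] at hs1
  rw [lt_min_iff] at ht2
  have hsK := hmem K s hs1.1 (ht1.le.trans ht2.1.le)
  have hsK' := hmem K' s hs1.2 (ht1.le.trans ht2.2.le)
  have htK := hmem K t (hs1.1.trans ht1) ht2.1.le
  have htK' := hmem K' t (hs1.2.trans ht1) ht2.2.le
  have : b' * s = b' * t := by
    rcases h with ⟨ha, hb⟩ | ⟨ha, hb⟩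
    · have := ha _ hsK; have := ha _ htK; have := hb _ hsK'; have := hb _ htK'
      simp only at *
      linarith
    · have := ha _ hsK'; have := ha _ htK'; have := hb _ hsK; have := hb _ htK
      simp only at *
      linarith
  exact ht1.ne (mul_left_cancel₀ hb' this)

theorem le_or_le_of_separated_fst {a' d : ℝ} (ha' : a' ≠ 0) {K K' : PosRect}
    (h : SeparatedByLine a' 0 d K.toSet K'.toSet) : K.x ≤ K'.u ∨ K'.x ≤ K.u := by
  have hmem : ∀ (K : PosRect) (t : ℝ), K.u < t → t ≤ K.x → (t, K.y) ∈ K.toSet :=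
    fun K t h1 h2 => ⟨⟨h1, h2⟩, K.hvy, le_rfl⟩
  by_contra! hcon
  obtain ⟨h1, h2⟩ := hcon
  have hmax : max K.u K'.u < min K.x K'.x :=
    max_lt (lt_min K.hux h2) (lt_min h1 K'.hux)
  obtain ⟨s, hs1, hs2⟩ := exists_between hmax
  obtain ⟨t, ht1, ht2⟩ := exists_between hs2
  rw [max_lt_iff] at hs1
  rw [lt_min_iff] at ht2
  have hsK := hmem K s hs1.1 (ht1.le.trans ht2.1.le)
  have hsK' := hmem K' s hs1.2 (ht1.le.trans ht2.2.le)
  have htK := hmem K t (hs1.1.trans ht1) ht2.1.le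
  have htK' := hmem K' t (hs1.2.trans ht1) ht2.2.le
  have : a' * s = a' * t := by
    rcases h with ⟨ha, hb⟩ | ⟨ha, hb⟩
    · have := ha _ hsK; have := ha _ htK; have := hb _ hsK'; have := hb _ htK'
      simp only at *
      linarith
    · have := ha _ hsK'; have := ha _ htK'; have := hb _ hsK; have := hb _ htK
      simp only at *
      linarith
  exact ht1.ne (mul_left_cancel₀ ha' this)

/-! ### The one-dimensional kernel: bounds, identities, orthogonality. -/

section Kernel

theorem kernelTwo_eq (x y u v : ℝ) : kernelTwo x y u v = kernelOne x u * kernelOne y v := by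
  unfold kernelTwo kernelOne
  rw [div_mul_div_comm]
  congr 1
  ring

theorem kernelOne_zero (u : ℝ) : kernelOne 0 u = 0 := by
  simp [kernelOne]

/-- This is the convention for division by zero, not the limit x. It changes the kernel only on a
null set. -/
theorem kernelOne_at_zero (x : ℝ) : kernelOne x 0 = 0 := by
  simp [kernelOne]

theorem kernelOne_neg (x u : ℝ) : kernelOne x (-u) = (starRingEnd ℂ) (kernelOne x u) := by
  unfold kernelOne
  simp only [map_div₀, map_sub, map_one, map_mul, Complex.conj_I, Complex.conj_ofReal,
    ← Complex.exp_conj, Complex.ofReal_neg]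
  ring_nf

/-- The kernel is, up to sign, the Fourier transform of the indicator of an interval; translation
becomes a phase. -/
theorem kernelOne_sub (a x u : ℝ) :
    kernelOne x u - kernelOne a u =
      Complex.exp (Complex.I * (a * u : ℝ)) * kernelOne (x - a) u := by
  unfold kernelOne
  rw [← sub_div, mul_div_assoc', mul_sub, ← Complex.exp_add]
  have : Complex.I * (a * u : ℝ) + Complex.I * u * (x - a : ℝ) = Complex.I * u * x := by
    push_cast; ring
  rw [this]
  have : Complex.I * (a * u : ℝ) = Complex.I * u * a := by push_cast; ring
  rw [this]
  ring

theorem kernelOne_mul {r : ℝ} (hr : r ≠ 0) (x u : ℝ) :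
    kernelOne (r * x) u = r * kernelOne x (r * u) := by
  unfold kernelOne
  have hr' : (r : ℂ) ≠ 0 := by exact_mod_cast hr
  rcases eq_or_ne u 0 with rfl | hu
  · simp
  have hu' : (u : ℂ) ≠ 0 := by exact_mod_cast hu
  have h1 : Complex.I * u * (r * x : ℝ) = Complex.I * (r * u : ℝ) * x := by push_cast; ring
  rw [h1]
  push_cast
  field_simp

theorem measurable_kernelOne (x : ℝ) : Measurable (kernelOne x) := by
  unfold kernelOne
  fun_prop

theorem norm_kernelOne_sq (x u : ℝ) : ‖kernelOne x u‖ ^ 2 = 2 * (1 - Real.cos (u * x)) / u ^ 2 := by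
  unfold kernelOne
  have h1 : Complex.I * u * x = (u * x : ℝ) * Complex.I := by push_cast; ring
  rw [norm_div, div_pow, norm_mul, Complex.norm_I, one_mul, Complex.norm_real, Real.norm_eq_abs,
    sq_abs, h1, Complex.sq_norm, Complex.normSq_apply]
  congr 1
  simp only [Complex.sub_re, Complex.sub_im, Complex.one_re, Complex.one_im,
    Complex.exp_ofReal_mul_I_re, Complex.exp_ofReal_mul_I_im]
  nlinarith [Real.sin_sq_add_cos_sq (u * x)]

theorem norm_kernelOne_sq_le (x u : ℝ) : ‖kernelOne x u‖ ^ 2 ≤ x ^ 2 := by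
  rw [norm_kernelOne_sq]
  refine div_le_of_le_mul₀ (sq_nonneg _) (sq_nonneg _) ?_
  nlinarith [Real.one_sub_sq_div_two_le_cos (x := u * x)]

theorem norm_kernelOne_sq_le_div (x u : ℝ) : ‖kernelOne x u‖ ^ 2 ≤ 4 / u ^ 2 := by
  rw [norm_kernelOne_sq]
  gcongr
  linarith [Real.neg_one_le_cos (u * x)]

theorem norm_kernelOne_mul_sq {r : ℝ} (hr : r ≠ 0) (x u : ℝ) :
    ‖kernelOne (r * x) u‖ ^ 2 = r ^ 2 * ‖kernelOne x (r * u)‖ ^ 2 := by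
  rw [kernelOne_mul hr, norm_mul, mul_pow, Complex.norm_real, Real.norm_eq_abs, sq_abs]

theorem norm_kernelOne_neg (x u : ℝ) : ‖kernelOne x (-u)‖ = ‖kernelOne x u‖ := by
  rw [kernelOne_neg, RCLike.norm_conj]

/-- The double-angle formula trades the oscillating factor for a dilation, which can be moved onto
the weight by substitution. -/
theorem norm_kernelOne_sq_mul_cos (u : ℝ) :
    ‖kernelOne 1 u‖ ^ 2 * Real.cos u = 2 * ‖kernelOne 1 (2 * u)‖ ^ 2 - ‖kernelOne 1 u‖ ^ 2 := by
  rw [norm_kernelOne_sq, norm_kernelOne_sq, mul_one, mul_one, Real.cos_two_mul]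
  rcases eq_or_ne u 0 with rfl | hu
  · simp
  field_simp
  ring

theorem exp_I_mul_ne_one {t : ℝ} (h0 : t ≠ 0) (h1 : |t| < 1) :
    Complex.exp (Complex.I * t) ≠ 1 := by
  intro h
  have h2 : Real.sin t = 0 := by
    rw [← Complex.exp_ofReal_mul_I_im, mul_comm, h, Complex.one_im]
  rw [abs_lt] at h1
  rw [Real.sin_eq_zero_iff_of_lt_of_lt (by linarith [Real.pi_gt_three])
    (by linarith [Real.pi_gt_three])] at h2
  exact h0 h2

theorem kernelOne_one_ne_zero {u : ℝ} (h0 : u ≠ 0) (h1 : |u| < 1) : kernelOne 1 u ≠ 0 := by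
  unfold kernelOne
  refine div_ne_zero ?_ (mul_ne_zero Complex.I_ne_zero (by exact_mod_cast h0))
  rw [sub_ne_zero, Complex.ofReal_one, mul_one]
  exact (exp_I_mul_ne_one h0 h1).symm

theorem integrable_of_even {f : ℝ → ℝ} (hf : ∀ x, f (-x) = f x)
    (hi : IntegrableOn f (Set.Ioi 0)) : Integrable f := by
  have h1 : IntegrableOn f (Set.Iio 0) := by
    have h := ((Measure.measurePreserving_neg (volume : Measure ℝ)).integrableOn_comp_preimage
      (MeasurableEquiv.neg ℝ).measurableEmbedding (f := f) (s := Set.Ioi 0)).2 hi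
    have e1 : f ∘ (fun x => -x) = f := funext hf
    have e2 : (fun x : ℝ => -x) ⁻¹' Set.Ioi 0 = Set.Iio 0 := by ext x; simp
    rwa [e1, e2] at h
  rw [← integrableOn_univ, ← Set.Iic_union_Ioi (a := (0 : ℝ))]
  exact ((integrableOn_Iic_iff_integrableOn_Iio (by simp)).2 h1).union hi

/-- Near 0 the kernel is bounded and α < 1 is needed; at infinity it decays like 1/u² and α ≥ 0 is
enough. -/
theorem integrable_norm_kernelOne_sq_mul_rpow (x : ℝ) {α : ℝ} (h0 : 0 ≤ α) (h1 : α < 1) :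
    Integrable fun u : ℝ => ‖kernelOne x u‖ ^ 2 * |u| ^ (-α) := by
  have hmeas : Measurable fun u : ℝ => ‖kernelOne x u‖ ^ 2 * |u| ^ (-α) :=
    ((measurable_kernelOne x).norm.pow_const 2).mul (by fun_prop)
  refine integrable_of_even (fun u => by rw [norm_kernelOne_neg, abs_neg]) ?_
  rw [← Set.Ioc_union_Ioi_eq_Ioi (zero_le_one (α := ℝ))]
  refine IntegrableOn.union ?_ ?_
  · have hi : IntegrableOn (fun u : ℝ => x ^ 2 * u ^ (-α)) (Set.Ioc 0 1) := by
      rw [← intervalIntegrable_iff_integrableOn_Ioc_of_le zero_le_one]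
      exact (intervalIntegral.intervalIntegrable_rpow' (by linarith)).const_mul _
    refine hi.mono' hmeas.aestronglyMeasurable ?_
    filter_upwards [ae_restrict_mem measurableSet_Ioc] with u hu
    rw [abs_of_pos hu.1, Real.norm_of_nonneg (by have := hu.1; positivity)]
    exact mul_le_mul_of_nonneg_right (norm_kernelOne_sq_le x u) (Real.rpow_nonneg hu.1.le _)
  · have hi : IntegrableOn (fun u : ℝ => 4 * u ^ (-2 : ℝ)) (Set.Ioi 1) :=
      (integrableOn_Ioi_rpow_of_lt (by norm_num) one_pos).const_mul 4
    refine hi.mono' hmeas.aestronglyMeasurable ?_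
    filter_upwards [ae_restrict_mem measurableSet_Ioi] with u hu
    have hu1 : 1 < u := hu
    have hu0 : 0 < u := one_pos.trans hu1
    rw [abs_of_pos hu0, Real.norm_of_nonneg (by positivity), Real.rpow_neg hu0.le 2,
      Real.rpow_two, ← div_eq_mul_inv]
    calc ‖kernelOne x u‖ ^ 2 * u ^ (-α) ≤ 4 / u ^ 2 * 1 :=
          mul_le_mul (norm_kernelOne_sq_le_div x u)
            (Real.rpow_le_one_of_one_le_of_nonpos hu1.le (by linarith))
            (Real.rpow_nonneg hu0.le _) (by positivity)
      _ = 4 / u ^ 2 := mul_one _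

theorem abs_rpow_sq (u p : ℝ) : (|u| ^ p) ^ 2 = |u| ^ (p * 2) := by
  rw [← Real.rpow_mul_natCast (abs_nonneg u)]
  norm_num

/-- Homogeneity alone replaces Plancherel here: the value of the constant plays no role. -/
theorem integral_norm_kernelOne_sq (y : ℝ) :
    ∫ v : ℝ, ‖kernelOne y v‖ ^ 2 = |y| * ∫ v : ℝ, ‖kernelOne 1 v‖ ^ 2 := by
  rcases eq_or_ne y 0 with rfl | hy
  · simp [kernelOne_zero]
  have h := fun v => norm_kernelOne_mul_sq hy 1 v
  simp only [mul_one] at h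
  simp_rw [h]
  rw [integral_const_mul, Measure.integral_comp_mul_left (fun v => ‖kernelOne 1 v‖ ^ 2) y,
    smul_eq_mul, ← mul_assoc, abs_inv, ← sq_abs]
  congr 1
  have := abs_pos.2 hy
  field_simp

theorem integrable_norm_kernelOne_sq (y : ℝ) : Integrable fun v : ℝ => ‖kernelOne y v‖ ^ 2 := by
  simpa using integrable_norm_kernelOne_sq_mul_rpow y le_rfl one_pos

theorem memLp_kernelOne (y : ℝ) : MemLp (kernelOne y) 2 := by
  rw [memLp_two_iff_integrable_sq_norm (measurable_kernelOne y).aestronglyMeasurable]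
  exact integrable_norm_kernelOne_sq y

/-- Orthogonality of the Fourier transforms of the indicators of disjoint intervals. -/
theorem integral_kernelOne_sub_mul_conj_eq_zero {a b a' b' : ℝ} (hab : a ≤ b) (hba' : b ≤ a')
    (hab' : a' ≤ b') :
    ∫ v : ℝ, (kernelOne b v - kernelOne a v) *
      (starRingEnd ℂ) (kernelOne b' v - kernelOne a' v) = 0 := by
  have hL : ∀ a b, MemLp (fun v => kernelOne b v - kernelOne a v) 2 volume := fun a b =>
    (memLp_kernelOne b).sub (memLp_kernelOne a)
  have hint := integrable_mul_conj (hL a b) (hL a' b')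
  -- The substitution v ↦ -v conjugates the integrand, so the integral is real.
  have hreal : (starRingEnd ℂ) (∫ v : ℝ, (kernelOne b v - kernelOne a v) *
      (starRingEnd ℂ) (kernelOne b' v - kernelOne a' v)) = ∫ v : ℝ,
      (kernelOne b v - kernelOne a v) * (starRingEnd ℂ) (kernelOne b' v - kernelOne a' v) := by
    rw [← integral_conj, ← integral_neg_eq_self (fun v : ℝ =>
      (kernelOne b v - kernelOne a v) * (starRingEnd ℂ) (kernelOne b' v - kernelOne a' v))]
    simp only [kernelOne_neg, map_mul, map_sub]
  rw [Complex.conj_eq_iff_im] at hreal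
  refine Complex.ext ?_ hreal
  have h1 := integral_re (𝕜 := ℂ) hint
  simp only [RCLike.re_eq_complex_re] at h1
  rw [← h1, Complex.zero_re]
  -- Polarisation: the real part is a combination of cosines of endpoint differences, each encoded
  -- by a squared kernel.
  have hpt : ∀ v : ℝ, ((kernelOne b v - kernelOne a v) *
      (starRingEnd ℂ) (kernelOne b' v - kernelOne a' v)).re =
      (1 / 2) * ((‖kernelOne (b' - a) v‖ ^ 2 - ‖kernelOne (b' - b) v‖ ^ 2) -
        (‖kernelOne (a' - a) v‖ ^ 2 - ‖kernelOne (a' - b) v‖ ^ 2)) := by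
    intro v
    rw [kernelOne_sub, kernelOne_sub, map_mul, mul_mul_mul_comm]
    simp only [norm_kernelOne_sq]
    unfold kernelOne
    rcases eq_or_ne v 0 with rfl | hv
    · simp
    have hv' : (v : ℂ) ≠ 0 := by exact_mod_cast hv
    have e1 : Complex.exp (Complex.I * (a * v : ℝ)) *
        (starRingEnd ℂ) (Complex.exp (Complex.I * (a' * v : ℝ))) *
        ((1 - Complex.exp (Complex.I * v * (b - a : ℝ))) / (Complex.I * v) *
        (starRingEnd ℂ) ((1 - Complex.exp (Complex.I * v * (b' - a' : ℝ))) / (Complex.I * v))) =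
        (Complex.exp ((v * (a - a') : ℝ) * Complex.I)
          - Complex.exp ((v * (b - a') : ℝ) * Complex.I)
          - Complex.exp ((v * (a - b') : ℝ) * Complex.I)
          + Complex.exp ((v * (b - b') : ℝ) * Complex.I)) / ((v ^ 2 : ℝ) : ℂ) := by
      have f1 : Complex.exp ((v * (a - a') : ℝ) * Complex.I) =
          Complex.exp (v * a * Complex.I) * Complex.exp (-(v * a' * Complex.I)) := by
        rw [← Complex.exp_add]; congr 1; push_cast; ring
      have f2 : Complex.exp ((v * (b - a') : ℝ) * Complex.I) =
          Complex.exp (v * b * Complex.I) * Complex.exp (-(v * a' * Complex.I)) := by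
        rw [← Complex.exp_add]; congr 1; push_cast; ring
      have f3 : Complex.exp ((v * (a - b') : ℝ) * Complex.I) =
          Complex.exp (v * a * Complex.I) * Complex.exp (-(v * b' * Complex.I)) := by
        rw [← Complex.exp_add]; congr 1; push_cast; ring
      have f4 : Complex.exp ((v * (b - b') : ℝ) * Complex.I) =
          Complex.exp (v * b * Complex.I) * Complex.exp (-(v * b' * Complex.I)) := by
        rw [← Complex.exp_add]; congr 1; push_cast; ring
      have g1 : Complex.exp (Complex.I * (a * v : ℝ)) *
          (1 - Complex.exp (Complex.I * v * (b - a : ℝ))) =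
          Complex.exp (v * a * Complex.I) - Complex.exp (v * b * Complex.I) := by
        rw [mul_sub, ← Complex.exp_add, mul_one]; congr 2 <;> push_cast <;> ring
      have g2 : (starRingEnd ℂ) (Complex.exp (Complex.I * (a' * v : ℝ))) *
          (starRingEnd ℂ) (1 - Complex.exp (Complex.I * v * (b' - a' : ℝ))) =
          Complex.exp (-(v * a' * Complex.I)) - Complex.exp (-(v * b' * Complex.I)) := by
        rw [← map_mul, mul_sub, ← Complex.exp_add, mul_one, map_sub, ← Complex.exp_conj,
          ← Complex.exp_conj]
        simp only [map_mul, map_add, Complex.conj_I, Complex.conj_ofReal]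
        congr 2 <;> push_cast <;> ring
      have g3 : (starRingEnd ℂ) (Complex.I * v) = -(Complex.I * v) := by
        simp
      rw [map_div₀, g3, f1, f2, f3, f4, div_mul_div_comm, mul_div_assoc', mul_mul_mul_comm, g1, g2]
      have g4 : Complex.I * v * -(Complex.I * v) = ((v ^ 2 : ℝ) : ℂ) := by
        push_cast; ring_nf; rw [Complex.I_sq]; ring
      rw [g4]
      ring
    rw [e1, Complex.div_ofReal_re]
    simp only [Complex.add_re, Complex.sub_re, Complex.exp_ofReal_mul_I_re]
    rw [← Real.cos_neg (v * (a - a')), ← Real.cos_neg (v * (b - a')),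
      ← Real.cos_neg (v * (a - b')), ← Real.cos_neg (v * (b - b'))]
    simp only [← mul_neg, neg_sub]
    ring
  simp_rw [hpt]
  have hi := fun t => integrable_norm_kernelOne_sq t
  have hi2 : ∀ s t, Integrable fun v => ‖kernelOne s v‖ ^ 2 - ‖kernelOne t v‖ ^ 2 :=
    fun s t => (hi s).sub (hi t)
  -- The integrals are proportional to interval lengths, and (b' - a) - (b' - b) - (a' - a) + (a' -
  -- b) = 0. The order of the endpoints is what removes the absolute values.
  rw [integral_const_mul, integral_sub (hi2 _ _) (hi2 _ _),
    integral_sub (hi _) (hi _), integral_sub (hi _) (hi _), integral_norm_kernelOne_sq (b' - a),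
    integral_norm_kernelOne_sq (b' - b), integral_norm_kernelOne_sq (a' - a),
    integral_norm_kernelOne_sq (a' - b), abs_of_nonneg (by linarith : 0 ≤ b' - a),
    abs_of_nonneg (by linarith : 0 ≤ b' - b), abs_of_nonneg (by linarith : 0 ≤ a' - a),
    abs_of_nonneg (by linarith : 0 ≤ a' - b)]
  ring

theorem integral_kernelOne_sub_mul_conj_eq_zero_of_or {a b a' b' : ℝ} (hab : a ≤ b)
    (hab' : a' ≤ b') (h : b ≤ a' ∨ b' ≤ a) :
    ∫ v : ℝ, (kernelOne b v - kernelOne a v) *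
      (starRingEnd ℂ) (kernelOne b' v - kernelOne a' v) = 0 := by
  rcases h with h | h
  · exact integral_kernelOne_sub_mul_conj_eq_zero hab h hab'
  · have h1 := congrArg (starRingEnd ℂ) (integral_kernelOne_sub_mul_conj_eq_zero hab' h hab)
    rw [← integral_conj, map_zero] at h1
    rw [← h1]
    refine integral_congr_ae (ae_of_all _ fun v => ?_)
    simp only [map_mul, Complex.conj_conj, mul_comm]

end Kernel

/-! ### Dilations and the doubling trick. -/

section Rescale

/-- The measurable equivalence `(u, v) ↦ (a u, b v)`. -/
noncomputable def prodScale (a b : ℝ) (ha : a ≠ 0) (hb : b ≠ 0) : ℝ × ℝ ≃ᵐ ℝ × ℝ :=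
  MeasurableEquiv.prodCongr (MeasurableEquiv.mulLeft₀ a ha) (MeasurableEquiv.mulLeft₀ b hb)

theorem prodScale_apply {a b : ℝ} (ha : a ≠ 0) (hb : b ≠ 0) (p : ℝ × ℝ) :
    prodScale a b ha hb p = (a * p.1, b * p.2) := rfl

theorem prodScale_symm_apply {a b : ℝ} (ha : a ≠ 0) (hb : b ≠ 0) (p : ℝ × ℝ) :
    (prodScale a b ha hb).symm p = (a⁻¹ * p.1, b⁻¹ * p.2) := rfl

theorem map_prodScale {a b : ℝ} (ha : a ≠ 0) (hb : b ≠ 0) :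
    (volume : Measure (ℝ × ℝ)).map (prodScale a b ha hb) =
      ENNReal.ofReal (|a⁻¹| * |b⁻¹|) • (volume : Measure (ℝ × ℝ)) := by
  have h : ⇑(prodScale a b ha hb) = Prod.map (a * ·) (b * ·) := rfl
  rw [h, Measure.volume_eq_prod, ← Measure.map_prod_map _ _ (measurable_const_mul a)
    (measurable_const_mul b), Real.map_volume_mul_left ha, Real.map_volume_mul_left hb,
    Measure.prod_smul_left, Measure.prod_smul_right, smul_smul,
    ← ENNReal.ofReal_mul (abs_nonneg _)]

variable {E : Type*} [MeasurableSpace E] {m : Measure E} {D : E ≃ᵐ E} {c : ℝ}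

theorem integrable_comp_scale (hc : 0 < c) (hD : m.map D = ENNReal.ofReal c • m) {g : E → ℝ} :
    Integrable (fun e => g (D e)) m ↔ Integrable g m := by
  rw [← integrable_smul_measure (f := g) (μ := m) (ENNReal.ofReal_pos.2 hc).ne'
    ENNReal.ofReal_ne_top, ← hD, integrable_map_equiv]
  rfl

theorem integral_comp_scale (hc : 0 < c) (hD : m.map D = ENNReal.ofReal c • m) (g : E → ℝ) :
    ∫ e, g (D e) ∂m = c * ∫ e, g e ∂m := by
  rw [← integral_map_equiv D g, hD, integral_smul_measure, ENNReal.toReal_ofReal hc.le, smul_eq_mul]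

/-- After `norm_kernelOne_sq_mul_cos`, the term with the doubled argument is pulled back along D;
its factor 2 cancels the Jacobian 1/2. The sign is now that of a difference of G. -/
theorem integral_norm_kernelOne_sq_mul_cos (hD : m.map D = ENNReal.ofReal (1 / 2) • m) {A : E → ℝ}
    (hA : ∀ e, A (D e) = 2 * A e) {G : E → ℝ}
    (h1 : Integrable (fun e => ‖kernelOne 1 (A e)‖ ^ 2 * G e) m)
    (h2 : Integrable (fun e => ‖kernelOne 1 (A e)‖ ^ 2 * G (D.symm e)) m) :
    ∫ e, ‖kernelOne 1 (A e)‖ ^ 2 * G e * Real.cos (A e) ∂m =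
      ∫ e, ‖kernelOne 1 (A e)‖ ^ 2 * (G (D.symm e) - G e) ∂m := by
  have hpt : ∀ e, ‖kernelOne 1 (A e)‖ ^ 2 * G e * Real.cos (A e) =
      2 * (‖kernelOne 1 (A (D e))‖ ^ 2 * G (D.symm (D e))) -
        ‖kernelOne 1 (A e)‖ ^ 2 * G e := fun e => by
    rw [mul_right_comm, norm_kernelOne_sq_mul_cos, hA, D.symm_apply_apply]
    ring
  have h3 := (integrable_comp_scale (by norm_num) hD).2 h2
  simp_rw [hpt]
  rw [integral_sub (h3.const_mul 2) h1, integral_const_mul, integral_comp_scale (by norm_num) hD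
    (fun e => ‖kernelOne 1 (A e)‖ ^ 2 * G (D.symm e))]
  simp_rw [mul_sub]
  rw [integral_sub h2 h1]
  ring

theorem integral_pos_of_isOpen [TopologicalSpace E] [m.IsOpenPosMeasure] {f : E → ℝ}
    (hf : Integrable f m) (h0 : ∀ e, 0 ≤ f e) {U : Set E} (hU : IsOpen U) (hne : U.Nonempty)
    (hpos : ∀ e ∈ U, 0 < f e) : 0 < ∫ e, f e ∂m := by
  rw [integral_pos_iff_support_of_nonneg_ae (ae_of_all _ h0) hf]
  exact (hU.measure_pos m hne).trans_le (measure_mono fun e he => (hpos e he).ne')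

end Rescale

/-! ### Positive covariances of unit squares in the plane. -/

section PlaneCovariance

/-- The power spectrum of the rectangular increment over the unit square. -/
noncomputable def planeSpectrum (h : ℝ → ℝ → ℝ) (p : ℝ × ℝ) : ℝ :=
  ‖kernelOne 1 p.1‖ ^ 2 * ‖kernelOne 1 p.2‖ ^ 2 * h p.1 p.2

/-- Square integrability of all the kernels with spectral density `h`. -/
def HasPlaneSpectrum (h : ℝ → ℝ → ℝ) : Prop :=
  ∀ x y, Integrable fun p : ℝ × ℝ => ‖kernelOne x p.1‖ ^ 2 * ‖kernelOne y p.2‖ ^ 2 * h p.1 p.2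

variable {h : ℝ → ℝ → ℝ}

/-- Contracting the frequencies in h amounts to passing to the kernel of an a × b rectangle, whose
integrability is assumed. -/
theorem HasPlaneSpectrum.rescale (hh : HasPlaneSpectrum h) {a b : ℝ} (ha : 0 < a) (hb : 0 < b) :
    Integrable fun p : ℝ × ℝ =>
      ‖kernelOne 1 p.1‖ ^ 2 * ‖kernelOne 1 p.2‖ ^ 2 * h (a⁻¹ * p.1) (b⁻¹ * p.2) := by
  have hc : 0 < |a⁻¹| * |b⁻¹| := by positivity
  rw [← integrable_comp_scale hc (map_prodScale ha.ne' hb.ne')]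
  have h1 := (hh a b).const_mul ((a ^ 2)⁻¹ * (b ^ 2)⁻¹)
  refine h1.congr (ae_of_all _ fun p => ?_)
  have h2 := norm_kernelOne_mul_sq ha.ne' 1 p.1
  have h3 := norm_kernelOne_mul_sq hb.ne' 1 p.2
  rw [mul_one] at h2 h3
  simp only [prodScale_apply, h2, h3, inv_mul_cancel_left₀ ha.ne', inv_mul_cancel_left₀ hb.ne']
  field_simp

theorem map_prodScale_fst : (volume : Measure (ℝ × ℝ)).map
    (prodScale 2 1 two_ne_zero one_ne_zero) =
      ENNReal.ofReal (1 / 2) • (volume : Measure (ℝ × ℝ)) := by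
  rw [map_prodScale]
  norm_num [abs_of_pos]

theorem map_prodScale_snd : (volume : Measure (ℝ × ℝ)).map
    (prodScale 1 2 one_ne_zero two_ne_zero) =
      ENNReal.ofReal (1 / 2) • (volume : Measure (ℝ × ℝ)) := by
  rw [map_prodScale]
  norm_num [abs_of_pos]

/-- The open square `(0, 1)²`. -/
def openSquare : Set (ℝ × ℝ) := Set.Ioo 0 1 ×ˢ Set.Ioo 0 1

theorem isOpen_openSquare : IsOpen openSquare := isOpen_Ioo.prod isOpen_Ioo

theorem openSquare_nonempty : openSquare.Nonempty :=
  ⟨(1 / 2, 1 / 2), by norm_num [openSquare]⟩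

theorem norm_kernelOne_sq_pos {u : ℝ} (hu : u ∈ Set.Ioo (0 : ℝ) 1) :
    0 < ‖kernelOne 1 u‖ ^ 2 := by
  have := kernelOne_one_ne_zero hu.1.ne' (by rw [abs_of_pos hu.1]; exact hu.2)
  positivity

theorem HasPlaneSpectrum.integrable_one (hh : HasPlaneSpectrum h) :
    Integrable (planeSpectrum h) := hh 1 1

theorem HasPlaneSpectrum.integral_cos_fst_pos (hh : HasPlaneSpectrum h)
    (hle : ∀ u v, h u v ≤ h (2⁻¹ * u) v) (hlt : ∀ u v, 0 < u → 0 < v → h u v < h (2⁻¹ * u) v) :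
    0 < ∫ p, planeSpectrum h p * Real.cos p.1 := by
  have h1 := hh.rescale (a := 2) (b := 1) (by norm_num) (by norm_num)
  have key := integral_norm_kernelOne_sq_mul_cos (m := volume) map_prodScale_fst
    (A := Prod.fst) (fun e => rfl)
    (G := fun p => ‖kernelOne 1 p.2‖ ^ 2 * h p.1 p.2)
    (by simpa only [mul_assoc] using hh 1 1)
    (by simpa only [prodScale_symm_apply, inv_one, one_mul, mul_assoc] using h1)
  simp only [prodScale_symm_apply, inv_one, one_mul, ← mul_assoc] at key
  unfold planeSpectrum
  rw [key]
  refine integral_pos_of_isOpen ?_ (fun p => ?_) isOpen_openSquare openSquare_nonempty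
    fun p hp => ?_
  · refine (h1.sub (hh 1 1)).congr (ae_of_all _ fun p => ?_)
    simp only [Pi.sub_apply, inv_one, one_mul]
    ring
  · rw [← mul_sub]
    exact mul_nonneg (sq_nonneg _) (mul_nonneg (sq_nonneg _) (sub_nonneg.2 (hle _ _)))
  · rw [← mul_sub]
    exact mul_pos (norm_kernelOne_sq_pos hp.1) (mul_pos (norm_kernelOne_sq_pos hp.2)
      (sub_pos.2 (hlt _ _ hp.1.1 hp.2.1)))

theorem HasPlaneSpectrum.swap (hh : HasPlaneSpectrum h) : HasPlaneSpectrum fun u v => h v u := by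
  intro x y
  refine ((hh y x).swap).congr (ae_of_all _ fun p => ?_)
  simp only [Function.comp, Prod.fst_swap, Prod.snd_swap]
  ring

theorem HasPlaneSpectrum.integral_cos_snd_pos (hh : HasPlaneSpectrum h)
    (hle : ∀ u v, h u v ≤ h u (2⁻¹ * v)) (hlt : ∀ u v, 0 < u → 0 < v → h u v < h u (2⁻¹ * v)) :
    0 < ∫ p, planeSpectrum h p * Real.cos p.2 := by
  have h1 := hh.swap.integral_cos_fst_pos (fun u v => hle v u) (fun u v hu hv => hlt v u hv hu)
  rw [Measure.volume_eq_prod, ← integral_prod_swap] at h1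
  refine h1.trans_eq (integral_congr_ae (ae_of_all _ fun p => ?_))
  simp only [planeSpectrum, Prod.fst_swap, Prod.snd_swap]
  ring

/-- The doubling trick in u is applied with cos v kept inside the weight, then the trick in v is
applied to the resulting difference. What remains is the mixed difference of h. -/
theorem HasPlaneSpectrum.integral_cos_mul_cos_pos (hh : HasPlaneSpectrum h)
    (hle : ∀ u v, 0 ≤ h (2⁻¹ * u) (2⁻¹ * v) - h u (2⁻¹ * v) - (h (2⁻¹ * u) v - h u v))
    (hlt : ∀ u v, 0 < u → 0 < v →
      0 < h (2⁻¹ * u) (2⁻¹ * v) - h u (2⁻¹ * v) - (h (2⁻¹ * u) v - h u v)) :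
    0 < ∫ p, planeSpectrum h p * (Real.cos p.1 * Real.cos p.2) := by
  have h21 := hh.rescale (a := 2) (b := 1) (by norm_num) (by norm_num)
  have h12 := hh.rescale (a := 1) (b := 2) (by norm_num) (by norm_num)
  have h22 := hh.rescale (a := 2) (b := 2) (by norm_num) (by norm_num)
  simp only [inv_one, one_mul] at h21 h12 h22
  have h11 := hh 1 1
  have hcos : ∀ {f : ℝ × ℝ → ℝ}, Integrable f → Integrable fun p => f p * Real.cos p.2 :=
    fun {f} hf => hf.mul_bdd (c := 1) (by fun_prop)
      (ae_of_all _ fun p => by simpa using Real.abs_cos_le_one p.2)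
  have key1 := integral_norm_kernelOne_sq_mul_cos (m := volume) map_prodScale_fst
    (A := Prod.fst) (fun e => rfl)
    (G := fun p => ‖kernelOne 1 p.2‖ ^ 2 * h p.1 p.2 * Real.cos p.2)
    (by simpa only [mul_assoc] using hcos h11)
    (by simpa only [prodScale_symm_apply, inv_one, one_mul, mul_assoc] using hcos h21)
  have key2 := integral_norm_kernelOne_sq_mul_cos (m := volume) map_prodScale_snd
    (A := Prod.snd) (fun e => rfl)
    (G := fun p => ‖kernelOne 1 p.1‖ ^ 2 * (h (2⁻¹ * p.1) p.2 - h p.1 p.2))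
    ((h21.sub h11).congr (ae_of_all _ fun p => by simp only [Pi.sub_apply]; ring))
    ((h22.sub h12).congr (ae_of_all _ fun p => by
      simp only [Pi.sub_apply, prodScale_symm_apply, inv_one, one_mul]; ring))
  have e1 : ∫ p, planeSpectrum h p * (Real.cos p.1 * Real.cos p.2) =
      ∫ p : ℝ × ℝ, ‖kernelOne 1 p.2‖ ^ 2 * (‖kernelOne 1 p.1‖ ^ 2 *
        (h (2⁻¹ * p.1) p.2 - h p.1 p.2)) * Real.cos p.2 := by
    refine Eq.trans ?_ (key1.trans ?_)
    · refine integral_congr_ae (ae_of_all _ fun p => ?_)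
      simp only [planeSpectrum]; ring
    · refine integral_congr_ae (ae_of_all _ fun p => ?_)
      simp only [prodScale_symm_apply, inv_one, one_mul]; ring
  rw [e1, key2]
  refine integral_pos_of_isOpen ?_ (fun p => ?_) isOpen_openSquare openSquare_nonempty
    fun p hp => ?_
  · refine ((h22.sub h12).sub (h21.sub h11)).congr (ae_of_all _ fun p => ?_)
    simp only [Pi.sub_apply, prodScale_symm_apply, inv_one, one_mul]; ring
  · simp only [prodScale_symm_apply, inv_one, one_mul]
    rw [← mul_sub]
    exact mul_nonneg (sq_nonneg _) (mul_nonneg (sq_nonneg _) (hle _ _))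
  · simp only [prodScale_symm_apply, inv_one, one_mul]
    rw [← mul_sub]
    exact mul_pos (norm_kernelOne_sq_pos hp.2) (mul_pos (norm_kernelOne_sq_pos hp.1)
      (hlt _ _ hp.1.1 hp.2.1))

/-- By the addition formulas both integrals differ from the cos · cos integral only by the sin · sin
integral, which vanishes since h is even in u. -/
theorem HasPlaneSpectrum.integral_cos_add_pos (hh : HasPlaneSpectrum h)
    (heven : ∀ u v, h (-u) v = h u v)
    (hle : ∀ u v, 0 ≤ h (2⁻¹ * u) (2⁻¹ * v) - h u (2⁻¹ * v) - (h (2⁻¹ * u) v - h u v))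
    (hlt : ∀ u v, 0 < u → 0 < v →
      0 < h (2⁻¹ * u) (2⁻¹ * v) - h u (2⁻¹ * v) - (h (2⁻¹ * u) v - h u v)) :
    0 < ∫ p, planeSpectrum h p * Real.cos (p.1 + p.2) ∧
      0 < ∫ p, planeSpectrum h p * Real.cos (p.1 - p.2) := by
  have hcc := hh.integral_cos_mul_cos_pos hle hlt
  have hb : ∀ {g : ℝ × ℝ → ℝ}, Continuous g → (∀ p, |g p| ≤ 1) →
      Integrable fun p => planeSpectrum h p * g p := fun {g} hg hg1 =>
    hh.integrable_one.mul_bdd (c := 1) hg.aestronglyMeasurable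
      (ae_of_all _ fun p => by simpa using hg1 p)
  have hi1 : Integrable fun p : ℝ × ℝ => planeSpectrum h p * (Real.cos p.1 * Real.cos p.2) :=
    hb (by fun_prop) fun p => by
      rw [abs_mul]; exact mul_le_one₀ (Real.abs_cos_le_one _) (abs_nonneg _) (Real.abs_cos_le_one _)
  have hi2 : Integrable fun p : ℝ × ℝ => planeSpectrum h p * (Real.sin p.1 * Real.sin p.2) :=
    hb (by fun_prop) fun p => by
      rw [abs_mul]; exact mul_le_one₀ (Real.abs_sin_le_one _) (abs_nonneg _) (Real.abs_sin_le_one _)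
  have hss : ∫ p, planeSpectrum h p * (Real.sin p.1 * Real.sin p.2) = 0 := by
    have h1 := integral_comp_scale (m := volume) (c := 1) one_pos
      (D := prodScale (-1) 1 (by norm_num) one_ne_zero) (by rw [map_prodScale]; norm_num)
      (fun p => planeSpectrum h p * (Real.sin p.1 * Real.sin p.2))
    simp only [prodScale_apply, planeSpectrum, neg_mul, one_mul, norm_kernelOne_neg, heven,
      Real.sin_neg, mul_neg, integral_neg] at h1
    simp only [planeSpectrum]
    linarith
  constructor
  · simp_rw [Real.cos_add, mul_sub]
    rw [integral_sub hi1 hi2, hss, sub_zero]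
    exact hcc
  · simp_rw [Real.cos_sub, mul_add]
    rw [integral_add hi1 hi2, hss, add_zero]
    exact hcc

end PlaneCovariance

/-! ### Plane kernels: spectral structure, nontrivial phases, scaling. -/

section PlaneKernel

/-- The kernels `κ_x(u) κ_y(v) w(u, v)`. -/
noncomputable def planeKernel (w : ℝ × ℝ → ℝ) (x y : ℝ) (p : ℝ × ℝ) : ℂ :=
  kernelTwo x y p.1 p.2 * (w p : ℂ)

variable {w : ℝ × ℝ → ℝ} {h : ℝ → ℝ → ℝ}

theorem norm_planeKernel_sq (hwh : ∀ p, w p ^ 2 = h p.1 p.2) (x y : ℝ) (p : ℝ × ℝ) :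
    ‖planeKernel w x y p‖ ^ 2 = ‖kernelOne x p.1‖ ^ 2 * ‖kernelOne y p.2‖ ^ 2 * h p.1 p.2 := by
  rw [planeKernel, kernelTwo_eq, norm_mul, norm_mul, mul_pow, mul_pow, Complex.norm_real,
    Real.norm_eq_abs, sq_abs, hwh]

theorem isSpectralKernel_planeKernel (hw : Measurable w) (hweven : ∀ p, w (-p) = w p)
    (hwh : ∀ p, w p ^ 2 = h p.1 p.2) (hh : HasPlaneSpectrum h) :
    IsSpectralKernel volume (planeKernel w) Prod.fst Prod.snd where
  memLp x y := by
    have hmeas : Measurable (planeKernel w x y) := by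
      have : planeKernel w x y =
          fun p => kernelOne x p.1 * kernelOne y p.2 * (w p : ℂ) := by
        ext p; rw [planeKernel, kernelTwo_eq]
      rw [this]
      exact (((measurable_kernelOne x).comp measurable_fst).mul
        ((measurable_kernelOne y).comp measurable_snd)).mul (Complex.measurable_ofReal.comp hw)
    rw [memLp_two_iff_integrable_sq_norm hmeas.aestronglyMeasurable]
    simp_rw [norm_planeKernel_sq hwh]
    exact hh x y
  hermitian x y p := by
    simp only [planeKernel, kernelTwo_eq, hweven, map_mul, Complex.conj_ofReal, Prod.fst_neg,
      Prod.snd_neg, kernelOne_neg]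
  zero_left y p := by simp [planeKernel, kernelTwo_eq, kernelOne_zero]
  zero_right x p := by simp [planeKernel, kernelTwo_eq, kernelOne_zero]
  increment u v x y p := by
    have h1 := kernelOne_sub u x p.1
    have h2 := kernelOne_sub v y p.2
    have h3 : Complex.exp (Complex.I * (u * p.1 + v * p.2 : ℝ)) =
        Complex.exp (Complex.I * (u * p.1 : ℝ)) * Complex.exp (Complex.I * (v * p.2 : ℝ)) := by
      rw [← Complex.exp_add]; congr 1; push_cast; ring
    simp only [planeKernel, kernelTwo_eq]
    rw [h3]
    calc _ = (kernelOne x p.1 - kernelOne u p.1) * (kernelOne y p.2 - kernelOne v p.2) *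
          (w p : ℂ) := by ring
      _ = _ := by rw [h1, h2]; ring

/-- Some nonempty open part of the unit square has 0 < |bu - av| < 1; there the kernel is nonzero
and the phase is not 1. -/
theorem planeKernel_not_ae {a b : ℝ} (hab : a ≠ 0 ∨ b ≠ 0)
    (hw0 : ∀ p ∈ openSquare, w p ≠ 0) :
    ¬ ∀ᵐ p ∂(volume : Measure (ℝ × ℝ)), planeKernel w 1 1 p = 0 ∨
      phase Prod.fst Prod.snd b (-a) p = 1 := by
  intro hae
  let U : Set (ℝ × ℝ) := openSquare ∩ {p | b * p.1 + -a * p.2 ≠ 0 ∧ |b * p.1 + -a * p.2| < 1}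
  have hU : IsOpen U := isOpen_openSquare.inter
    ((isOpen_ne_fun (f := fun p : ℝ × ℝ => b * p.1 + -a * p.2) (g := fun _ => 0) (by fun_prop)
      (by fun_prop)).inter (isOpen_lt (f := fun p : ℝ × ℝ => |b * p.1 + -a * p.2|)
      (g := fun _ => 1) (by fun_prop) (by fun_prop)))
  have hne : U.Nonempty := by
    have hden : 0 < 2 * (1 + |a| + |b|) := by positivity
    -- Small enough that |bs - at| < 1 whenever 0 < t ≤ s.
    let s := 1 / (2 * (1 + |a| + |b|))
    have hs : 0 < s := by positivity
    have hs1 : s < 1 := by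
      rw [div_lt_one hden]; linarith [abs_nonneg a, abs_nonneg b]
    have hs2 : s * (|a| + |b|) < 1 := by
      rw [div_mul_eq_mul_div, div_lt_one hden]; linarith [abs_nonneg a, abs_nonneg b]
    have hbd : ∀ t, 0 < t → t ≤ s → |b * s + -a * t| < 1 := fun t ht hts => by
      refine lt_of_le_of_lt (abs_add_le _ _) ?_
      rw [abs_mul, abs_mul, abs_neg, abs_of_pos hs, abs_of_pos ht]
      nlinarith [abs_nonneg a, abs_nonneg b, mul_le_mul_of_nonneg_left hts (abs_nonneg a)]
    -- For a = b the phase is trivial on the diagonal, so a point off it is taken.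
    by_cases hba : b = a
    · refine ⟨(s, s / 2), ⟨⟨hs, hs1⟩, by simp only; linarith, by simp only; linarith⟩, ?_,
        hbd _ (by linarith) (by linarith)⟩
      have ha : a ≠ 0 := by
        rcases hab with ha | hb
        · exact ha
        · rwa [← hba]
      have : b * s + -a * (s / 2) = a * (s / 2) := by rw [hba]; ring
      simp only [this]
      exact mul_ne_zero ha (by linarith)
    · refine ⟨(s, s), ⟨⟨hs, hs1⟩, hs, hs1⟩, ?_, hbd _ hs le_rfl⟩
      have : b * s + -a * s = (b - a) * s := by ring
      simp only [this]
      exact mul_ne_zero (sub_ne_zero.2 hba) hs.ne'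
  have hfreq := (frequently_ae_mem_iff.2 (hU.measure_pos volume hne).ne').and_eventually hae
  obtain ⟨p, hpU, hp⟩ := hfreq.exists
  rcases hp with hp | hp
  · refine absurd hp ?_
    rw [planeKernel, kernelTwo_eq]
    refine mul_ne_zero (mul_ne_zero ?_ ?_) (by exact_mod_cast hw0 p hpU.1)
    · exact kernelOne_one_ne_zero hpU.1.1.1.ne' (by rw [abs_of_pos hpU.1.1.1]; exact hpU.1.1.2)
    · exact kernelOne_one_ne_zero hpU.1.2.1.ne' (by rw [abs_of_pos hpU.1.2.1]; exact hpU.1.2.2)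
  · exact exp_I_mul_ne_one hpU.2.1 hpU.2.2 hp

/-- The two kernel factors give r^(1+γ), the weight r^(τ/2) and the Jacobian r^(-1-γ), so the
covariance scales by r^(1+γ+τ). -/
theorem planeKernel_scaling {γ τ H r : ℝ} (hr : 0 < r)
    (hw : ∀ p : ℝ × ℝ, w p = r ^ (τ / 2) * w (r * p.1, r ^ γ * p.2)) (hH : 2 * H = 1 + γ + τ) :
    ∃ (D : ℝ × ℝ ≃ᵐ ℝ × ℝ) (a c : ℝ), 0 ≤ c ∧
      (volume : Measure (ℝ × ℝ)).map D = ENNReal.ofReal c • (volume : Measure (ℝ × ℝ)) ∧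
      a ^ 2 * c = (r ^ H) ^ 2 ∧
      ∀ x y e, planeKernel w (r * x) (r ^ γ * y) e = a * planeKernel w x y (D e) := by
  have hrγ : 0 < r ^ γ := Real.rpow_pos_of_pos hr γ
  refine ⟨prodScale r (r ^ γ) hr.ne' hrγ.ne', r * r ^ γ * r ^ (τ / 2), |r⁻¹| * |(r ^ γ)⁻¹|,
    by positivity, map_prodScale _ _, ?_, fun x y p => ?_⟩
  · rw [abs_of_pos (inv_pos.2 hr), abs_of_pos (inv_pos.2 hrγ), ← Real.rpow_mul_natCast hr.le,
      mul_pow, ← Real.rpow_mul_natCast hr.le]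
    have e1 : H * (2 : ℕ) = 1 + γ + τ := by push_cast; linarith
    have e2 : τ / 2 * (2 : ℕ) = τ := by push_cast; ring
    rw [e1, e2, Real.rpow_add hr, Real.rpow_add hr, Real.rpow_one]
    field_simp
  · rw [planeKernel, planeKernel, kernelTwo_eq, kernelTwo_eq, prodScale_apply,
      kernelOne_mul hr.ne', kernelOne_mul hrγ.ne', hw p]
    push_cast
    ring

end PlaneKernel

/-! ### Power weights. -/

section Power

theorem rpow_scale {r : ℝ} (hr : 0 < r) (u p : ℝ) : |u| ^ p = r ^ (-p) * |r * u| ^ p := by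
  rw [abs_mul, abs_of_pos hr, Real.mul_rpow hr.le (abs_nonneg u), ← mul_assoc,
    ← Real.rpow_add hr, neg_add_cancel, Real.rpow_zero, one_mul]

theorem hasPlaneSpectrum_fst {α : ℝ} (h0 : 0 ≤ α) (h1 : α < 1) :
    HasPlaneSpectrum fun u _ => |u| ^ (-α) := by
  intro x y
  refine ((integrable_norm_kernelOne_sq_mul_rpow x h0 h1).mul_prod
    (integrable_norm_kernelOne_sq y)).congr (ae_of_all _ fun p => ?_)
  simp only
  ring

theorem rpow_neg_half_lt {α u : ℝ} (h0 : 0 < α) (hu : 0 < u) :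
    |u| ^ (-α) < |2⁻¹ * u| ^ (-α) := by
  rw [abs_of_pos hu, abs_of_pos (by positivity)]
  exact Real.rpow_lt_rpow_of_neg (by positivity) (by linarith) (by linarith)

theorem rpow_neg_half_le {α : ℝ} (h0 : 0 < α) (u : ℝ) : |u| ^ (-α) ≤ |2⁻¹ * u| ^ (-α) := by
  rcases eq_or_ne u 0 with rfl | hu
  · simp
  · have := rpow_neg_half_lt h0 (abs_pos.2 hu)
    simp only [abs_mul, abs_abs] at this ⊢
    exact this.le

end Power

/-! ### Line kernels, for fields linear in one coordinate. -/

section LineKernel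

/-- The kernels `x C κ_y(v) |v|^q` on the line. -/
noncomputable def lineKernel (C q x y v : ℝ) : ℂ :=
  ((x * C : ℝ) : ℂ) * (kernelOne y v * ((|v| ^ q : ℝ) : ℂ))

theorem norm_lineKernel_sq (C q x y v : ℝ) :
    ‖lineKernel C q x y v‖ ^ 2 = (x * C) ^ 2 * (‖kernelOne y v‖ ^ 2 * |v| ^ (-(-(q * 2)))) := by
  rw [lineKernel, norm_mul, norm_mul, mul_pow, mul_pow, Complex.norm_real, Complex.norm_real,
    Real.norm_eq_abs, Real.norm_eq_abs, sq_abs, sq_abs, abs_rpow_sq, neg_neg]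

theorem memLp_lineKernel (C : ℝ) {q : ℝ} (hq0 : q ≤ 0) (hq1 : -1 < q * 2) (x y : ℝ) :
    MemLp (lineKernel C q x y) 2 := by
  have hmeas : Measurable (lineKernel C q x y) := by
    unfold lineKernel
    exact (((measurable_kernelOne y)).mul
      (Complex.measurable_ofReal.comp (by fun_prop))).const_mul _
  rw [memLp_two_iff_integrable_sq_norm hmeas.aestronglyMeasurable]
  simp_rw [norm_lineKernel_sq]
  exact (integrable_norm_kernelOne_sq_mul_rpow y (by linarith) (by linarith)).const_mul _

theorem lineKernel_neg (C q x y v : ℝ) :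
    lineKernel C q x y (-v) = (starRingEnd ℂ) (lineKernel C q x y v) := by
  simp only [lineKernel, map_mul, Complex.conj_ofReal, kernelOne_neg, abs_neg]

theorem lineKernel_increment (C q u v x y e : ℝ) :
    lineKernel C q x y e - lineKernel C q u y e - lineKernel C q x v e + lineKernel C q u v e =
      Complex.exp (Complex.I * (v * e : ℝ)) * lineKernel C q (x - u) (y - v) e := by
  have h := kernelOne_sub v y e
  simp only [lineKernel]
  calc _ = (((x - u) * C : ℝ) : ℂ) * ((kernelOne y e - kernelOne v e) *
        ((|e| ^ q : ℝ) : ℂ)) := by push_cast; ring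
    _ = _ := by rw [h]; ring

theorem isSpectralKernel_lineKernel (C : ℝ) {q : ℝ} (hq0 : q ≤ 0) (hq1 : -1 < q * 2) :
    IsSpectralKernel volume (lineKernel C q) (fun _ => 0) id where
  memLp := memLp_lineKernel C hq0 hq1
  hermitian x y e := lineKernel_neg C q x y e
  zero_left y e := by simp [lineKernel]
  zero_right x e := by simp [lineKernel, kernelOne_zero]
  increment u v x y e := by
    simpa only [id, mul_zero, zero_add] using lineKernel_increment C q u v x y e

theorem isSpectralKernel_lineKernel_swap (C : ℝ) {q : ℝ} (hq0 : q ≤ 0) (hq1 : -1 < q * 2) :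
    IsSpectralKernel volume (fun x y => lineKernel C q y x) id (fun _ => 0) where
  memLp x y := memLp_lineKernel C hq0 hq1 y x
  hermitian x y e := lineKernel_neg C q y x e
  zero_left y e := by simp [lineKernel, kernelOne_zero]
  zero_right x e := by simp [lineKernel]
  increment u v x y e := by
    have h := lineKernel_increment C q v u y x e
    simp only [id, mul_zero, add_zero]
    rw [← h]
    ring

theorem lineKernel_scaling {C q s t : ℝ} (hs : 0 < s) (x y e : ℝ) :
    lineKernel C q (t * x) (s * y) e =
      ((t * s * s ^ (-q) : ℝ) : ℂ) * lineKernel C q x y (s * e) := by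
  rw [lineKernel, lineKernel, kernelOne_mul hs.ne', rpow_scale hs e]
  push_cast
  ring

theorem map_mulLeft {s : ℝ} (hs : 0 < s) : (volume : Measure ℝ).map
    (MeasurableEquiv.mulLeft₀ s hs.ne') = ENNReal.ofReal s⁻¹ • (volume : Measure ℝ) := by
  have := Real.map_volume_mul_left hs.ne'
  rw [abs_of_pos (inv_pos.2 hs)] at this
  exact this

theorem lineKernel_not_ae {C q : ℝ} (hC : C ≠ 0) :
    ¬ ∀ᵐ v : ℝ, lineKernel C q 1 1 v = 0 ∨ Complex.exp (Complex.I * (v : ℝ)) = 1 := by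
  intro hae
  have hfreq := (frequently_ae_mem_iff.2 ((isOpen_Ioo (a := (0 : ℝ)) (b := 1)).measure_pos volume
    ⟨1 / 2, by norm_num⟩).ne').and_eventually hae
  obtain ⟨v, hv, hp⟩ := hfreq.exists
  have habs : |v| < 1 := by rw [abs_of_pos hv.1]; exact hv.2
  rcases hp with hp | hp
  · refine absurd hp (mul_ne_zero ?_ (mul_ne_zero (kernelOne_one_ne_zero hv.1.ne' habs) ?_))
    · rw [one_mul]; exact_mod_cast hC
    · exact_mod_cast (Real.rpow_pos_of_pos (abs_pos.2 hv.1.ne') q).ne'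
  · exact exp_I_mul_ne_one hv.1.ne' habs hp

/-- Doubling with the weight |v|^(2q), strictly decreasing in |v| because q < 0; for q = 0 the
difference, and with it the covariance, would vanish. -/
theorem lineKernel_cov_pos {C q : ℝ} (hC : C ≠ 0) (hq0 : q < 0) (hq1 : -1 < q * 2) :
    0 < ∫ v, ‖lineKernel C q 1 1 v‖ ^ 2 * Real.cos v := by
  have h2 : (0 : ℝ) < 2 := two_pos
  have hD := map_mulLeft h2
  rw [← one_div] at hD
  have hα : 0 < -(q * 2) := by linarith
  have hi := integrable_norm_kernelOne_sq_mul_rpow 1 (α := -(q * 2)) (by linarith) (by linarith)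
  have hsymm : ∀ v : ℝ, (MeasurableEquiv.mulLeft₀ (2 : ℝ) h2.ne').symm v = 2⁻¹ * v := fun v => rfl
  have hi2 : Integrable fun v : ℝ => ‖kernelOne 1 v‖ ^ 2 * |2⁻¹ * v| ^ (-(-(q * 2))) := by
    have h := hi.const_mul (2⁻¹ ^ (-(-(q * 2))))
    refine h.congr (ae_of_all _ fun v => ?_)
    simp only
    rw [abs_mul, Real.mul_rpow (abs_nonneg _) (abs_nonneg _), abs_of_pos (inv_pos.2 h2)]
    ring
  have key := integral_norm_kernelOne_sq_mul_cos (m := volume) hD (A := id) (fun e => rfl)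
    (G := fun v => |v| ^ (-(-(q * 2)))) hi hi2
  simp only [id, hsymm] at key
  have e1 : ∫ v, ‖lineKernel C q 1 1 v‖ ^ 2 * Real.cos v = C ^ 2 * ∫ v : ℝ,
      ‖kernelOne 1 v‖ ^ 2 * |v| ^ (-(-(q * 2))) * Real.cos v := by
    rw [← integral_const_mul]
    refine integral_congr_ae (ae_of_all _ fun v => ?_)
    simp only [norm_lineKernel_sq]
    ring
  rw [e1, key]
  refine mul_pos (by positivity) ?_
  refine integral_pos_of_isOpen ?_ (fun v => ?_) (isOpen_Ioo (a := (0 : ℝ)) (b := 1))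
    ⟨1 / 2, by norm_num⟩ fun v hv => ?_
  · refine (hi2.sub hi).congr (ae_of_all _ fun v => ?_)
    simp only [Pi.sub_apply]
    ring
  · exact mul_nonneg (sq_nonneg _) (sub_nonneg.2 (rpow_neg_half_le hα v))
  · exact mul_pos (norm_kernelOne_sq_pos hv) (sub_pos.2 (rpow_neg_half_lt hα hv.1))

end LineKernel

/-! ### The density h: monotonicity, mixed differences, integrability, homogeneity. -/

section HLimit

theorem one_div_rpow_lt {p s t : ℝ} (hp : 0 < p) (hs : 0 < s) (hst : s < t) :
    1 / t ^ p < 1 / s ^ p :=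
  one_div_lt_one_div_of_lt (Real.rpow_pos_of_pos hs p) (Real.rpow_lt_rpow hs.le hst hp)

/-- The function is exp(-p log s): strict concavity of log gives the strict inequality, and exp is
increasing and convex. -/
theorem strictConvexOn_one_div_rpow {p : ℝ} (hp : 0 < p) :
    StrictConvexOn ℝ (Set.Ioi 0) fun s : ℝ => 1 / s ^ p := by
  have hexp : ∀ s : ℝ, 0 < s → 1 / s ^ p = Real.exp (-p * Real.log s) := fun s hs => by
    rw [one_div, ← Real.rpow_neg hs.le, Real.rpow_def_of_pos hs, mul_comm]
  refine ⟨convex_Ioi 0, fun x hx y hy hxy a b ha hb hab => ?_⟩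
  have hx0 : 0 < x := hx
  have hy0 : 0 < y := hy
  simp only [smul_eq_mul]
  have hlog := strictConcaveOn_log_Ioi.2 hx hy hxy ha hb hab
  have hconv := convexOn_exp.2 (Set.mem_univ (-p * Real.log x)) (Set.mem_univ (-p * Real.log y))
    ha.le hb.le hab
  simp only [smul_eq_mul] at hlog hconv
  rw [hexp _ (by positivity), hexp x hx0, hexp y hy0]
  refine lt_of_lt_of_le (Real.exp_lt_exp.2 ?_) hconv
  nlinarith

/-- The points x + y' and x' + y are convex combinations of x + y and x' + y' with interchanged
weights. Adding the two strict convexity inequalities gives the claim. -/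
theorem one_div_rpow_second_difference_pos {p x x' y y' : ℝ} (hp : 0 < p) (hx : 0 < x)
    (hxx' : x < x') (hy : 0 < y) (hyy' : y < y') :
    0 < 1 / (x + y) ^ p - 1 / (x' + y) ^ p - (1 / (x + y') ^ p - 1 / (x' + y') ^ p) := by
  have hc := (strictConvexOn_one_div_rpow hp).2
  have hL : 0 < (x' - x) + (y' - y) := by linarith
  have hne : x + y ≠ x' + y' := by linarith
  have ha : 0 < (x' - x) / ((x' - x) + (y' - y)) := div_pos (by linarith) hL
  have hb : 0 < (y' - y) / ((x' - x) + (y' - y)) := div_pos (by linarith) hL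
  have hab : (x' - x) / ((x' - x) + (y' - y)) + (y' - y) / ((x' - x) + (y' - y)) = 1 := by
    rw [← add_div, div_self hL.ne']
  have m1 : x + y ∈ Set.Ioi (0 : ℝ) := add_pos hx hy
  have m2 : x' + y' ∈ Set.Ioi (0 : ℝ) := add_pos (hx.trans hxx') (hy.trans hyy')
  have h1 := hc m1 m2 hne ha hb hab
  have h2 := hc m1 m2 hne hb ha (by rw [add_comm]; exact hab)
  simp only [smul_eq_mul] at h1 h2
  have e1 : (x' - x) / ((x' - x) + (y' - y)) * (x + y) +
      (y' - y) / ((x' - x) + (y' - y)) * (x' + y') = x + y' := by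
    field_simp; ring
  have e2 : (y' - y) / ((x' - x) + (y' - y)) * (x + y) +
      (x' - x) / ((x' - x) + (y' - y)) * (x' + y') = x' + y := by
    field_simp; ring
  rw [e1] at h1
  rw [e2] at h2
  have e3 : ((x' - x) / ((x' - x) + (y' - y))) * (1 / (x + y) ^ p) +
      ((y' - y) / ((x' - x) + (y' - y))) * (1 / (x + y) ^ p) = 1 / (x + y) ^ p := by
    rw [← add_mul, hab, one_mul]
  have e4 : ((x' - x) / ((x' - x) + (y' - y))) * (1 / (x' + y') ^ p) +
      ((y' - y) / ((x' - x) + (y' - y))) * (1 / (x' + y') ^ p) = 1 / (x' + y') ^ p := by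
    rw [← add_mul, hab, one_mul]
  linarith

variable {H₁ H₂ c : ℝ}

theorem hLimit_neg_left (u v : ℝ) : hLimit H₁ H₂ c (-u) v = hLimit H₁ H₂ c u v := by
  simp [hLimit]

theorem hLimit_neg_right (u v : ℝ) : hLimit H₁ H₂ c u (-v) = hLimit H₁ H₂ c u v := by
  simp [hLimit]

theorem hLimit_nonneg (hc : 0 < c) (u v : ℝ) : 0 ≤ hLimit H₁ H₂ c u v := by
  unfold hLimit
  positivity

theorem hLimit_pos (hc : 0 < c) {u : ℝ} (hu : u ≠ 0) (v : ℝ) : 0 < hLimit H₁ H₂ c u v := by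
  unfold hLimit
  positivity

theorem measurable_hLimit : Measurable fun p : ℝ × ℝ => hLimit H₁ H₂ c p.1 p.2 := by
  unfold hLimit
  fun_prop

section Monotone

variable (hH₁ : 0 < H₁) (hH₂ : 0 < H₂) (hc : 0 < c)

include hH₁ hH₂ in
theorem rpow_half_lt {v : ℝ} (hv : v ≠ 0) :
    |2⁻¹ * v| ^ (2 * H₂ / H₁) < |v| ^ (2 * H₂ / H₁) := by
  have := abs_pos.2 hv
  refine Real.rpow_lt_rpow (abs_nonneg _) ?_ (by positivity)
  rw [abs_mul, abs_of_pos (by norm_num : (0 : ℝ) < 2⁻¹)]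
  linarith

theorem sq_half_lt {u : ℝ} (hu : u ≠ 0) : |2⁻¹ * u| ^ 2 < |u| ^ 2 := by
  have := abs_pos.2 hu
  rw [abs_mul, abs_of_pos (by norm_num : (0 : ℝ) < 2⁻¹)]
  nlinarith

include hH₁ hc in
theorem hLimit_half_left_lt {u : ℝ} (hu : u ≠ 0) (v : ℝ) :
    hLimit H₁ H₂ c u v < hLimit H₁ H₂ c (2⁻¹ * u) v := by
  unfold hLimit
  exact one_div_rpow_lt (by linarith) (by positivity) (by linarith [sq_half_lt hu])

include hH₁ hc in
theorem hLimit_half_left_le (u v : ℝ) :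
    hLimit H₁ H₂ c u v ≤ hLimit H₁ H₂ c (2⁻¹ * u) v := by
  rcases eq_or_ne u 0 with rfl | hu
  · simp
  · exact (hLimit_half_left_lt hH₁ hc hu v).le

include hH₁ hH₂ hc in
theorem hLimit_half_right_lt (u : ℝ) {v : ℝ} (hv : v ≠ 0) :
    hLimit H₁ H₂ c u v < hLimit H₁ H₂ c u (2⁻¹ * v) := by
  unfold hLimit
  exact one_div_rpow_lt (by linarith) (by positivity)
    (by have := mul_lt_mul_of_pos_left (rpow_half_lt hH₁ hH₂ hv) hc; linarith)

include hH₁ hH₂ hc in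
theorem hLimit_half_right_le (u v : ℝ) :
    hLimit H₁ H₂ c u v ≤ hLimit H₁ H₂ c u (2⁻¹ * v) := by
  rcases eq_or_ne v 0 with rfl | hv
  · simp
  · exact (hLimit_half_right_lt hH₁ hH₂ hc u hv).le

include hH₁ hH₂ hc in
theorem hLimit_second_difference_pos {u v : ℝ} (hu : u ≠ 0) (hv : v ≠ 0) :
    0 < hLimit H₁ H₂ c (2⁻¹ * u) (2⁻¹ * v) - hLimit H₁ H₂ c u (2⁻¹ * v) -
      (hLimit H₁ H₂ c (2⁻¹ * u) v - hLimit H₁ H₂ c u v) := by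
  unfold hLimit
  exact one_div_rpow_second_difference_pos (by linarith) (by positivity) (sq_half_lt hu)
    (by positivity) (mul_lt_mul_of_pos_left (rpow_half_lt hH₁ hH₂ hv) hc)

include hH₁ hH₂ hc in
theorem hLimit_second_difference_nonneg (u v : ℝ) :
    0 ≤ hLimit H₁ H₂ c (2⁻¹ * u) (2⁻¹ * v) - hLimit H₁ H₂ c u (2⁻¹ * v) -
      (hLimit H₁ H₂ c (2⁻¹ * u) v - hLimit H₁ H₂ c u v) := by
  rcases eq_or_ne u 0 with rfl | hu
  · simp
  rcases eq_or_ne v 0 with rfl | hv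
  · simp
  exact (hLimit_second_difference_pos hH₁ hH₂ hc hu hv).le

-- AM-GM: |u|² + c|v|^(2H₂/H₁) ≥ 2√c |u| |v|^(H₂/H₁). The bound separates the variables with
-- exponents H₁/2 and H₂/2, both below 1 when H₁, H₂ < 2.
include hH₁ hc in
theorem hLimit_le {u v : ℝ} (hu : u ≠ 0) (hv : v ≠ 0) :
    hLimit H₁ H₂ c u v ≤
      1 / (2 * √c) ^ (H₁ / 2) * (|u| ^ (-(H₁ / 2)) * |v| ^ (-(H₂ / 2))) := by
  have hu' := abs_pos.2 hu
  have hv' := abs_pos.2 hv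
  have hsc : 0 < √c := Real.sqrt_pos.2 hc
  have hvp : 0 < |v| ^ (H₂ / H₁) := Real.rpow_pos_of_pos hv' _
  have e1 : |v| ^ (2 * H₂ / H₁) = (|v| ^ (H₂ / H₁)) ^ 2 := by
    rw [abs_rpow_sq]; congr 1; ring
  have h1 : 2 * √c * (|u| * |v| ^ (H₂ / H₁)) ≤ |u| ^ 2 + c * |v| ^ (2 * H₂ / H₁) := by
    rw [e1]
    nlinarith [sq_nonneg (|u| - √c * |v| ^ (H₂ / H₁)), Real.sq_sqrt hc.le]
  have h2 : (2 * √c * (|u| * |v| ^ (H₂ / H₁))) ^ (H₁ / 2) =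
      (2 * √c) ^ (H₁ / 2) * (|u| ^ (H₁ / 2) * |v| ^ (H₂ / 2)) := by
    rw [Real.mul_rpow (by positivity) (by positivity), Real.mul_rpow hu'.le hvp.le,
      ← Real.rpow_mul hv'.le]
    congr 3
    field_simp
  unfold hLimit
  refine (one_div_le_one_div_of_le (by positivity)
    (Real.rpow_le_rpow (by positivity) h1 (by linarith))).trans_eq ?_
  rw [h2, Real.rpow_neg hu'.le, Real.rpow_neg hv'.le]
  field_simp

include hH₁ hH₂ hc in
theorem hasPlaneSpectrum_hLimit (h1 : H₁ < 2) (h2 : H₂ < 2) :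
    HasPlaneSpectrum (hLimit H₁ H₂ c) := by
  intro x y
  have hdom := ((integrable_norm_kernelOne_sq_mul_rpow x (α := H₁ / 2) (by linarith)
    (by linarith)).mul_prod (integrable_norm_kernelOne_sq_mul_rpow y (α := H₂ / 2) (by linarith)
    (by linarith))).const_mul (1 / (2 * √c) ^ (H₁ / 2))
  refine hdom.mono' ?_ (ae_of_all _ fun p => ?_)
  · exact (((((measurable_kernelOne x).comp measurable_fst).norm.pow_const 2).mul
      (((measurable_kernelOne y).comp measurable_snd).norm.pow_const 2)).mul
      measurable_hLimit).aestronglyMeasurable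
  · rw [Real.norm_of_nonneg (mul_nonneg (by positivity) (hLimit_nonneg hc _ _))]
    -- On the axes the bound for h is not available, but there the kernel is zero by convention.
    rcases eq_or_ne p.1 0 with hu | hu
    · rw [hu, kernelOne_at_zero]; simp
    rcases eq_or_ne p.2 0 with hv | hv
    · rw [hv, kernelOne_at_zero]; simp
    have := mul_le_mul_of_nonneg_left (hLimit_le (H₂ := H₂) hH₁ hc hu hv)
      (by positivity : 0 ≤ ‖kernelOne x p.1‖ ^ 2 * ‖kernelOne y p.2‖ ^ 2)
    refine this.trans_eq ?_
    ring

include hH₁ hc in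
theorem hLimit_scale (hH₂ : 0 < H₂) {r : ℝ} (hr : 0 < r) (u v : ℝ) :
    hLimit H₁ H₂ c u v = r ^ H₁ * hLimit H₁ H₂ c (r * u) (r ^ (H₁ / H₂) * v) := by
  have hr' : 0 < r ^ (H₁ / H₂) := Real.rpow_pos_of_pos hr _
  unfold hLimit
  have e1 : |r ^ (H₁ / H₂) * v| ^ (2 * H₂ / H₁) = r ^ 2 * |v| ^ (2 * H₂ / H₁) := by
    rw [abs_mul, abs_of_pos hr', Real.mul_rpow hr'.le (abs_nonneg v), ← Real.rpow_mul hr.le]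
    congr 1
    rw [← Real.rpow_two]
    congr 1
    field_simp
  have e2 : |r * u| ^ 2 + c * |r ^ (H₁ / H₂) * v| ^ (2 * H₂ / H₁) =
      r ^ 2 * (|u| ^ 2 + c * |v| ^ (2 * H₂ / H₁)) := by
    rw [e1, abs_mul, abs_of_pos hr]; ring
  have e3 : (r ^ 2) ^ (H₁ / 2) = r ^ H₁ := by
    rw [← Real.rpow_two, ← Real.rpow_mul hr.le]; congr 1; ring
  rw [e2, Real.mul_rpow (by positivity) (by positivity), e3]
  have : r ^ H₁ ≠ 0 := (Real.rpow_pos_of_pos hr _).ne'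
  field_simp

end Monotone

end HLimit

/-! ### Conclusions common to all cases. -/

section Conclusions

variable {E Ω : Type*} [MeasurableSpace E] [MeasurableSpace Ω] {m : Measure E} {P : Measure Ω}
  {W : Set E → Ω → ℂ} {F : ℝ → ℝ → E → ℂ} {A B : E → ℝ}

/-- `Q` stands for the defining relation of the field in one case, `C` for the conclusions that
depend on the case. -/
theorem IsSpectralKernel.field_properties [InvolutiveNeg E] [MeasurableNeg E] [m.IsNegInvariant]
    (hF : IsSpectralKernel m F A B) (hW : IsHermitianNoise m P W)
    {Q : ℝ → ℝ → (Ω → ℂ) → Prop} (hQ : ∀ x y X, Q x y X ↔ IsStochInt m P W (F x y) X)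
    {C : (ℝ → ℝ → Ω → ℝ) → Prop} (hC : ∀ V, IsSpectralField m P W F V → C V) :
    (∀ x y : ℝ, 0 ≤ x → 0 ≤ y → ∃ X : Ω → ℂ, Q x y X ∧ (∀ᵐ ω ∂P, (X ω).im = 0) ∧
      ∀ X' : Ω → ℂ, Q x y X' → X' =ᵐ[P] X) ∧
    ∀ V : ℝ → ℝ → Ω → ℝ, (∀ x y : ℝ, 0 ≤ x → 0 ≤ y → Q x y (fun ω => (V x y ω : ℂ))) →
      IsGaussianProcess (fun p : {p : ℝ × ℝ // 0 ≤ p.1 ∧ 0 ≤ p.2} => V p.1.1 p.1.2) P ∧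
      (∀ x y : ℝ, 0 ≤ x → 0 ≤ y → MemLp (V x y) 2 P ∧ ∫ ω, V x y ω ∂P = 0) ∧
      (∀ x : ℝ, 0 ≤ x → V x 0 =ᵐ[P] 0 ∧ V 0 x =ᵐ[P] 0) ∧
      HasStationaryRectIncr P V ∧ C V := by
  refine ⟨fun x y _ _ => ?_, fun V hV => ?_⟩
  · obtain ⟨X, hX⟩ := hW.exists_isStochInt (hF.memLp x y)
    exact ⟨X, (hQ x y X).2 hX, hX.im_eq_zero hW (hF.hermitian x y),
      fun X' hX' => ((hQ x y X').1 hX').ae_unique hW hX⟩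
  · have hV' : IsSpectralField m P W F V := fun x y hx hy => (hQ x y _).1 (hV x y hx hy)
    exact ⟨hV'.isGaussianProcess hW, hV'.memLp_and_integral hW, hV'.ae_eq_zero hF hW,
      hV'.hasStationaryRectIncr hF hW, hC V hV'⟩

theorem HasDepRectIncr.not_hasSemiDepRectIncr {V : ℝ → ℝ → Ω → ℝ} (h : HasDepRectIncr P V) :
    ¬ HasSemiDepRectIncr P V := by
  rintro ⟨-, a, b, hab, hi | hi⟩
  · exact (h a b hab).1 hi
  · exact (h a b hab).2 hi

theorem HasSemiDepRectIncr.not_hasDepRectIncr {V : ℝ → ℝ → Ω → ℝ} (h : HasSemiDepRectIncr P V) :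
    ¬ HasDepRectIncr P V :=
  fun h' => h'.not_hasSemiDepRectIncr h

/-- This must hold for k = 0 too, which occurs on an axis. Then Y cannot be recovered from X, so it
is taken from the existence theorem. -/
theorem isStochInt_const_mul_iff [Neg E] (hW : IsHermitianNoise m P W) {f : E → ℂ}
    (hf : MemLp f 2 m) (k : ℂ) {X : Ω → ℂ} :
    (∃ Y, IsStochInt m P W f Y ∧ X =ᵐ[P] fun ω => k * Y ω) ↔
      IsStochInt m P W (fun e => k * f e) X := by
  constructor
  · rintro ⟨Y, hY, hXY⟩
    exact (hY.const_mul hW k).congr_right hXY.symm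
  · intro hX
    obtain ⟨Y, hY⟩ := hW.exists_isStochInt hf
    exact ⟨Y, hY, hX.ae_unique hW (hY.const_mul hW k)⟩

end Conclusions

/-! ### Increments of plane fields. -/

section PlaneField

variable {Ω : Type*} [MeasurableSpace Ω] {P : Measure Ω} {W : Set (ℝ × ℝ) → Ω → ℂ}
  {V : ℝ → ℝ → Ω → ℝ} {w : ℝ × ℝ → ℝ} {h : ℝ → ℝ → ℝ}

theorem norm_planeKernel_one_sq (hwh : ∀ p, w p ^ 2 = h p.1 p.2) (p : ℝ × ℝ) :
    ‖planeKernel w 1 1 p‖ ^ 2 = planeSpectrum h p :=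
  norm_planeKernel_sq hwh 1 1 p

theorem phase_mul_planeKernel (u v x y : ℝ) (p : ℝ × ℝ) :
    phase Prod.fst Prod.snd u v p * planeKernel w (x - u) (y - v) p =
      (kernelOne x p.1 - kernelOne u p.1) * (kernelOne y p.2 - kernelOne v p.2) * (w p : ℂ) := by
  have h1 := kernelOne_sub u x p.1
  have h2 := kernelOne_sub v y p.2
  have h3 : phase Prod.fst Prod.snd u v p =
      Complex.exp (Complex.I * (u * p.1 : ℝ)) * Complex.exp (Complex.I * (v * p.2 : ℝ)) := by
    rw [phase, ← Complex.exp_add]; congr 1; push_cast; ring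
  rw [h3, h1, h2, planeKernel, kernelTwo_eq]
  ring

variable (hW : IsHermitianNoise volume P W) (hV : IsSpectralField volume P W (planeKernel w) V)
  (hF : IsSpectralKernel volume (planeKernel w) Prod.fst Prod.snd)
  (hwh : ∀ p, w p ^ 2 = h p.1 p.2)

include hW hV hF hwh in
theorem not_indepRectIncrDir_of_cos_snd (hcos : 0 < ∫ p, planeSpectrum h p * Real.cos p.2)
    (a : ℝ) : ¬ IndepRectIncrDir P V a 0 := by
  refine hV.not_indep hF hW (u := 0) (v := 0) (u' := 0) (v' := 1) (a' := 0) (b' := 1) (d := 1)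
    le_rfl le_rfl le_rfl zero_le_one (Or.inr one_ne_zero) (by simp)
    (Or.inl ⟨fun p hp => ?_, fun p hp => ?_⟩) ?_
  · rw [mem_unitSquare] at hp; linarith [hp.2.2]
  · rw [mem_unitSquare] at hp; linarith [hp.2.1]
  · simpa [norm_planeKernel_one_sq hwh] using hcos

include hW hV hF hwh in
theorem not_indepRectIncrDir_of_cos_fst (hcos : 0 < ∫ p, planeSpectrum h p * Real.cos p.1)
    (b : ℝ) : ¬ IndepRectIncrDir P V 0 b := by
  refine hV.not_indep hF hW (u := 0) (v := 0) (u' := 1) (v' := 0) (a' := 1) (b' := 0) (d := 1)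
    le_rfl le_rfl zero_le_one le_rfl (Or.inl one_ne_zero) (by simp)
    (Or.inl ⟨fun p hp => ?_, fun p hp => ?_⟩) ?_
  · rw [mem_unitSquare] at hp; linarith [hp.1.2]
  · rw [mem_unitSquare] at hp; linarith [hp.1.1]
  · simpa [norm_planeKernel_one_sq hwh] using hcos

-- The squares at (1, 1) and (0, 0) meet at the corner (1, 1), and every line through it with a
-- normal in the open quadrant separates them.
include hW hV hF hwh in
theorem not_indepRectIncrDir_of_cos_add (hcos : 0 < ∫ p, planeSpectrum h p * Real.cos (p.1 + p.2))
    {s t : ℝ} (hs : 0 < s) (ht : 0 < t) {a b : ℝ} (hab : a * s + b * t = 0) :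
    ¬ IndepRectIncrDir P V a b := by
  refine hV.not_indep hF hW (u := 1) (v := 1) (u' := 0) (v' := 0) (a' := s) (b' := t) (d := s + t)
    zero_le_one zero_le_one le_rfl le_rfl (Or.inl hs.ne') hab
    (Or.inr ⟨fun p hp => ?_, fun p hp => ?_⟩) ?_
  · rw [mem_unitSquare] at hp; nlinarith [hp.1.2, hp.2.2]
  · rw [mem_unitSquare] at hp; nlinarith [hp.1.1, hp.2.1]
  · simpa [norm_planeKernel_one_sq hwh] using hcos

-- Here the squares at (1, 0) and (0, 1) meet at the corner (1, 1), and the separating normals are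
-- (s, -t).
include hW hV hF hwh in
theorem not_indepRectIncrDir_of_cos_sub (hcos : 0 < ∫ p, planeSpectrum h p * Real.cos (p.1 - p.2))
    {s t : ℝ} (hs : 0 < s) (ht : 0 < t) {a b : ℝ} (hab : a * s = b * t) :
    ¬ IndepRectIncrDir P V a b := by
  refine hV.not_indep hF hW (u := 1) (v := 0) (u' := 0) (v' := 1) (a' := s) (b' := -t)
    (d := s - t) zero_le_one le_rfl le_rfl zero_le_one (Or.inl hs.ne') (by linarith)
    (Or.inr ⟨fun p hp => ?_, fun p hp => ?_⟩) ?_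
  · rw [mem_unitSquare] at hp; nlinarith [hp.1.2, hp.2.1]
  · rw [mem_unitSquare] at hp; nlinarith [hp.1.1, hp.2.2]
  · simpa [norm_planeKernel_one_sq hwh, ← sub_eq_add_neg] using hcos

include hW hV hF hwh in
theorem hasDepRectIncr_of_second_difference (hh : HasPlaneSpectrum h)
    (heven : ∀ u v, h (-u) v = h u v)
    (hfst : ∀ u v, h u v ≤ h (2⁻¹ * u) v) (hfst' : ∀ u v, 0 < u → 0 < v → h u v < h (2⁻¹ * u) v)
    (hsnd : ∀ u v, h u v ≤ h u (2⁻¹ * v)) (hsnd' : ∀ u v, 0 < u → 0 < v → h u v < h u (2⁻¹ * v))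
    (hle : ∀ u v, 0 ≤ h (2⁻¹ * u) (2⁻¹ * v) - h u (2⁻¹ * v) - (h (2⁻¹ * u) v - h u v))
    (hlt : ∀ u v, 0 < u → 0 < v →
      0 < h (2⁻¹ * u) (2⁻¹ * v) - h u (2⁻¹ * v) - (h (2⁻¹ * u) v - h u v))
    (hw0 : ∀ p ∈ openSquare, w p ≠ 0) : HasDepRectIncr P V := by
  intro a b hab
  refine ⟨?_, hV.not_invariant hF hW (planeKernel_not_ae hab hw0)⟩
  obtain ⟨hadd, hsub⟩ := hh.integral_cos_add_pos heven hle hlt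
  rcases eq_or_ne b 0 with rfl | hb
  · exact not_indepRectIncrDir_of_cos_snd hW hV hF hwh (hh.integral_cos_snd_pos hsnd hsnd') a
  rcases eq_or_ne a 0 with rfl | ha
  · exact not_indepRectIncrDir_of_cos_fst hW hV hF hwh (hh.integral_cos_fst_pos hfst hfst') b
  have hb' := abs_pos.2 hb
  have ha' := abs_pos.2 ha
  -- The normal (|b|, ±|a|) is perpendicular to (a, b): the sign is + when a and b have opposite
  -- signs and - when they agree.
  rcases hb.lt_or_gt with hb0 | hb0 <;> rcases ha.lt_or_gt with ha0 | ha0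
  · refine not_indepRectIncrDir_of_cos_sub hW hV hF hwh hsub hb' ha' ?_
    rw [abs_of_neg hb0, abs_of_neg ha0]; ring
  · refine not_indepRectIncrDir_of_cos_add hW hV hF hwh hadd hb' ha' ?_
    rw [abs_of_neg hb0, abs_of_pos ha0]; ring
  · refine not_indepRectIncrDir_of_cos_add hW hV hF hwh hadd hb' ha' ?_
    rw [abs_of_pos hb0, abs_of_neg ha0]; ring
  · refine not_indepRectIncrDir_of_cos_sub hW hV hF hwh hsub hb' ha' ?_
    rw [abs_of_pos hb0, abs_of_pos ha0]; ring

-- With no weight in v, Fubini splits off the inner product of transforms of two intervals; a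
-- horizontal separating line makes these intervals disjoint.
include hW hV hF in
theorem indepRectIncrDir_of_weight_fst {g : ℝ → ℝ} (hg : ∀ p, w p = g p.1) :
    IndepRectIncrDir P V 1 0 := by
  refine hV.indep_of_forall hF hW fun a' b' d hab' hperp K K' hsep => ?_
  obtain rfl : a' = 0 := by linarith
  have hb' : b' ≠ 0 := by simpa using hab'
  simp only [phase_mul_planeKernel, hg]
  have h0 := integral_kernelOne_sub_mul_conj_eq_zero_of_or K.hvy.le K'.hvy.le
    (le_or_le_of_separated_snd hb' hsep)
  have h1 := integral_prod_mul (μ := (volume : Measure ℝ)) (ν := (volume : Measure ℝ))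
    (fun u => ((kernelOne K.x u - kernelOne K.u u) * (g u : ℂ)) *
      (starRingEnd ℂ) ((kernelOne K'.x u - kernelOne K'.u u) * (g u : ℂ)))
    (fun v => (kernelOne K.y v - kernelOne K.v v) *
      (starRingEnd ℂ) (kernelOne K'.y v - kernelOne K'.v v))
  rw [h0, mul_zero] at h1
  rw [← h1, Measure.volume_eq_prod]
  refine integral_congr_ae (ae_of_all _ fun p => ?_)
  simp only [map_mul]
  ring

include hW hV hF in
theorem indepRectIncrDir_of_weight_snd {g : ℝ → ℝ} (hg : ∀ p, w p = g p.2) :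
    IndepRectIncrDir P V 0 1 := by
  refine hV.indep_of_forall hF hW fun a' b' d hab' hperp K K' hsep => ?_
  obtain rfl : b' = 0 := by linarith
  have ha' : a' ≠ 0 := by simpa using hab'
  simp only [phase_mul_planeKernel, hg]
  have h0 := integral_kernelOne_sub_mul_conj_eq_zero_of_or K.hux.le K'.hux.le
    (le_or_le_of_separated_fst ha' hsep)
  have h1 := integral_prod_mul (μ := (volume : Measure ℝ)) (ν := (volume : Measure ℝ))
    (fun u => (kernelOne K.x u - kernelOne K.u u) *
      (starRingEnd ℂ) (kernelOne K'.x u - kernelOne K'.u u))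
    (fun v => ((kernelOne K.y v - kernelOne K.v v) * (g v : ℂ)) *
      (starRingEnd ℂ) ((kernelOne K'.y v - kernelOne K'.v v) * (g v : ℂ)))
  rw [h0, zero_mul] at h1
  rw [← h1, Measure.volume_eq_prod]
  refine integral_congr_ae (ae_of_all _ fun p => ?_)
  simp only [map_mul]
  ring

include hW hV hF hwh in
theorem hasSemiDepRectIncr_of_weight_fst {g : ℝ → ℝ} (hg : ∀ p, w p = g p.1)
    (hcos : 0 < ∫ p, planeSpectrum h p * Real.cos p.1) (hw0 : ∀ p ∈ openSquare, w p ≠ 0) :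
    HasSemiDepRectIncr P V :=
  ⟨⟨0, 1, Or.inr one_ne_zero, not_indepRectIncrDir_of_cos_fst hW hV hF hwh hcos 1,
    hV.not_invariant hF hW (planeKernel_not_ae (Or.inr one_ne_zero) hw0)⟩,
    1, 0, Or.inl one_ne_zero, Or.inl (indepRectIncrDir_of_weight_fst hW hV hF hg)⟩

include hW hV hF hwh in
theorem hasSemiDepRectIncr_of_weight_snd {g : ℝ → ℝ} (hg : ∀ p, w p = g p.2)
    (hcos : 0 < ∫ p, planeSpectrum h p * Real.cos p.2) (hw0 : ∀ p ∈ openSquare, w p ≠ 0) :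
    HasSemiDepRectIncr P V :=
  ⟨⟨1, 0, Or.inl one_ne_zero, not_indepRectIncrDir_of_cos_snd hW hV hF hwh hcos 1,
    hV.not_invariant hF hW (planeKernel_not_ae (Or.inl one_ne_zero) hw0)⟩,
    0, 1, Or.inr one_ne_zero, Or.inl (indepRectIncrDir_of_weight_snd hW hV hF hg)⟩

end PlaneField

/-! ### Increments and scaling of line fields. -/

section LineField

variable {Ω : Type*} [MeasurableSpace Ω] {P : Measure Ω} {W : Set ℝ → Ω → ℂ}
  {V : ℝ → ℝ → Ω → ℝ} {C q : ℝ}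

theorem hasSemiDepRectIncr_lineKernel (hW : IsHermitianNoise volume P W) (hC : C ≠ 0) (hq0 : q < 0)
    (hq1 : -1 < q * 2) (hV : IsSpectralField volume P W (lineKernel C q) V) :
    HasSemiDepRectIncr P V := by
  have hF := isSpectralKernel_lineKernel C hq0.le hq1
  refine ⟨⟨-1, 0, Or.inl (by norm_num), ?_, ?_⟩, 0, 1, Or.inr one_ne_zero, Or.inr ?_⟩
  · refine hV.not_indep hF hW (u := 0) (v := 1) (u' := 0) (v' := 0) (a' := 0) (b' := 1) (d := 1)
      le_rfl zero_le_one le_rfl le_rfl (Or.inr one_ne_zero) (by simp)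
      (Or.inr ⟨fun p hp => ?_, fun p hp => ?_⟩) ?_
    · rw [mem_unitSquare] at hp; linarith [hp.2.2]
    · rw [mem_unitSquare] at hp; linarith [hp.2.1]
    · simpa using lineKernel_cov_pos hC hq0 hq1
  · refine hV.not_invariant hF hW ?_
    simpa [phase] using lineKernel_not_ae (q := q) hC
  · intro z w hzw K K' hK
    obtain ⟨h1, h2, h3, h4⟩ := PosRect.eq_of_toSet_eq hK
    have hw : w = 0 := by linarith
    rw [hw, add_zero] at h3 h4
    have hK1 := hV.incr hF hW K
    have hK2 := hV.incr hF hW K'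
    simp only [phase, mul_zero, h1, h2, h3, h4, add_sub_add_right_eq_sub] at hK1 hK2
    filter_upwards [hK1.ae_unique hW hK2] with ω hω
    exact_mod_cast hω

theorem hasSemiDepRectIncr_lineKernel_swap (hW : IsHermitianNoise volume P W) (hC : C ≠ 0)
    (hq0 : q < 0) (hq1 : -1 < q * 2)
    (hV : IsSpectralField volume P W (fun x y => lineKernel C q y x) V) :
    HasSemiDepRectIncr P V := by
  have hF := isSpectralKernel_lineKernel_swap C hq0.le hq1
  refine ⟨⟨0, 1, Or.inr one_ne_zero, ?_, ?_⟩, 1, 0, Or.inl one_ne_zero, Or.inr ?_⟩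
  · refine hV.not_indep hF hW (u := 1) (v := 0) (u' := 0) (v' := 0) (a' := 1) (b' := 0) (d := 1)
      zero_le_one le_rfl le_rfl le_rfl (Or.inl one_ne_zero) (by simp)
      (Or.inr ⟨fun p hp => ?_, fun p hp => ?_⟩) ?_
    · rw [mem_unitSquare] at hp; linarith [hp.1.2]
    · rw [mem_unitSquare] at hp; linarith [hp.1.1]
    · simpa using lineKernel_cov_pos hC hq0 hq1
  · refine hV.not_invariant hF hW ?_
    simpa [phase] using lineKernel_not_ae (q := q) hC
  · intro z w hzw K K' hK
    obtain ⟨h1, h2, h3, h4⟩ := PosRect.eq_of_toSet_eq hK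
    have hz : z = 0 := by linarith
    rw [hz, add_zero] at h1 h2
    have hK1 := hV.incr hF hW K
    have hK2 := hV.incr hF hW K'
    simp only [phase, mul_zero, h1, h2, h3, h4, add_sub_add_right_eq_sub] at hK1 hK2
    filter_upwards [hK1.ae_unique hW hK2] with ω hω
    exact_mod_cast hω

theorem lineKernel_isOperatorScaling (hW : IsHermitianNoise volume P W) {γ H : ℝ} (hH : 0 < H)
    (hHq : 2 * H = 2 + γ * (1 - 2 * q))
    (hV : IsSpectralField volume P W (lineKernel C q) V) : IsOperatorScaling P V γ H := by
  refine hV.isOperatorScaling hW hH fun r hr => ?_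
  have hs : 0 < r ^ γ := Real.rpow_pos_of_pos hr γ
  refine ⟨MeasurableEquiv.mulLeft₀ (r ^ γ) hs.ne', r * r ^ γ * (r ^ γ) ^ (-q), (r ^ γ)⁻¹,
    by positivity, map_mulLeft hs, ?_, fun x y e => lineKernel_scaling hs x y e⟩
  rw [← Real.rpow_mul hr.le, ← Real.rpow_neg hr.le]
  nth_rewrite 1 [← Real.rpow_one r]
  rw [← Real.rpow_add hr, ← Real.rpow_add hr, ← Real.rpow_mul_natCast hr.le,
    ← Real.rpow_add hr, ← Real.rpow_mul_natCast hr.le]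
  congr 1
  push_cast
  linarith

theorem lineKernel_swap_isOperatorScaling (hW : IsHermitianNoise volume P W) {γ H : ℝ} (hH : 0 < H)
    (hHq : 2 * H = 2 * γ + 1 - 2 * q)
    (hV : IsSpectralField volume P W (fun x y => lineKernel C q y x) V) :
    IsOperatorScaling P V γ H := by
  refine hV.isOperatorScaling hW hH fun r hr => ?_
  refine ⟨MeasurableEquiv.mulLeft₀ r hr.ne', r ^ γ * r * r ^ (-q), r⁻¹,
    by positivity, map_mulLeft hr, ?_, fun x y e => lineKernel_scaling hr y x e⟩
  rw [← Real.rpow_neg_one r]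
  nth_rewrite 2 [← Real.rpow_one r]
  rw [← Real.rpow_add hr, ← Real.rpow_add hr, ← Real.rpow_mul_natCast hr.le,
    ← Real.rpow_add hr, ← Real.rpow_mul_natCast hr.le]
  congr 1
  push_cast
  linarith

end LineField

/-! ### The five regimes. -/

section Cases

variable {Ω : Type*} [MeasurableSpace Ω] {P : Measure Ω} {W : Set (ℝ × ℝ) → Ω → ℂ}
  {W₁ : Set ℝ → Ω → ℂ} {H₁ H₂ c ρ₁ ρ₂ γ : ℝ}

/-- The square root of the spectral density of the field in the balanced case. -/
noncomputable def balancedWeight (H₁ H₂ c : ℝ) (p : ℝ × ℝ) : ℝ := √(hLimit H₁ H₂ c p.1 p.2)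

/-- The conditions of the five cases are mutually exclusive, so the disjunction reduces to the
single integral of the regime. -/
theorem isVgamma_iff_balanced (h : γ = H₁ / H₂) (x y : ℝ) (X : Ω → ℂ) :
    IsVgamma P W W₁ H₁ H₂ c ρ₁ ρ₂ γ x y X ↔
      IsStochInt volume P W (planeKernel (balancedWeight H₁ H₂ c) x y) X := by
  simp only [IsVgamma, h, lt_irrefl, false_and, or_false, true_and]
  rfl

theorem isVgamma_iff_fst (h : H₁ / H₂ < γ) (h1 : H₁ < 1) (x y : ℝ) (X : Ω → ℂ) :
    IsVgamma P W W₁ H₁ H₂ c ρ₁ ρ₂ γ x y X ↔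
      IsStochInt volume P W (planeKernel (fun p => |p.1| ^ (-H₁ / 2)) x y) X := by
  simp only [IsVgamma, h, h.ne', h1, h1.not_gt, h.not_gt, false_and, or_false, true_and, false_or,
    and_false]
  rfl

theorem isVgamma_iff_snd (h : γ < H₁ / H₂) (h2 : H₂ < 1) (x y : ℝ) (X : Ω → ℂ) :
    IsVgamma P W W₁ H₁ H₂ c ρ₁ ρ₂ γ x y X ↔
      IsStochInt volume P W (planeKernel (fun p => |p.2| ^ (-H₂ / 2)) x y) X := by
  simp only [IsVgamma, h, h.ne, h2, h2.not_gt, h.not_gt, false_and, or_false, true_and, false_or,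
    and_false]
  rfl

theorem memLp_kernelOne_mul_rpow {q : ℝ} (hq0 : q ≤ 0) (hq1 : -1 < q * 2) (y : ℝ) :
    MemLp (fun v => kernelOne y v * ((|v| ^ q : ℝ) : ℂ)) 2 := by
  have := memLp_lineKernel 1 hq0 hq1 1 y
  unfold lineKernel at this
  simpa using this

theorem isVgamma_iff_line (hW₁ : IsHermitianNoise volume P W₁) (h : H₁ / H₂ < γ) (h1 : 1 < H₁)
    (hq0 : -(H₁ * H₂ - H₂) / (2 * H₁) ≤ 0) (hq1 : -1 < -(H₁ * H₂ - H₂) / (2 * H₁) * 2)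
    (x y : ℝ) (X : Ω → ℂ) :
    IsVgamma P W W₁ H₁ H₂ c ρ₁ ρ₂ γ x y X ↔ IsStochInt volume P W₁
      (lineKernel (ρ₁ * c ^ ((1 - H₁) / 4)) (-(H₁ * H₂ - H₂) / (2 * H₁)) x y) X := by
  simp only [IsVgamma, h, h.ne', h1, h1.not_gt, h.not_gt, false_and, or_false, true_and, false_or,
    and_false]
  rw [isStochInt_const_mul_iff hW₁ (memLp_kernelOne_mul_rpow hq0 hq1 y), mul_assoc]
  rfl

theorem isVgamma_iff_line_swap (hW₁ : IsHermitianNoise volume P W₁) (h : γ < H₁ / H₂) (h2 : 1 < H₂)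
    (hq0 : -(H₁ * H₂ - H₁) / (2 * H₂) ≤ 0) (hq1 : -1 < -(H₁ * H₂ - H₁) / (2 * H₂) * 2)
    (x y : ℝ) (X : Ω → ℂ) :
    IsVgamma P W W₁ H₁ H₂ c ρ₁ ρ₂ γ x y X ↔ IsStochInt volume P W₁
      (lineKernel (ρ₂ * c ^ (-H₁ / (4 * H₂))) (-(H₁ * H₂ - H₁) / (2 * H₂)) y x) X := by
  simp only [IsVgamma, h, h.ne, h2, h2.not_gt, h.not_gt, false_and, true_and, false_or,
    and_false]
  rw [isStochInt_const_mul_iff hW₁ (memLp_kernelOne_mul_rpow hq0 hq1 x), mul_assoc]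
  rfl

section Weights

theorem balancedWeight_sq (hc : 0 < c) (p : ℝ × ℝ) :
    balancedWeight H₁ H₂ c p ^ 2 = hLimit H₁ H₂ c p.1 p.2 :=
  Real.sq_sqrt (hLimit_nonneg hc _ _)

theorem isSpectralKernel_balancedWeight (hH₁ : 0 < H₁) (hH₂ : 0 < H₂) (hc : 0 < c) (h1 : H₁ < 2)
    (h2 : H₂ < 2) :
    IsSpectralKernel volume (planeKernel (balancedWeight H₁ H₂ c)) Prod.fst Prod.snd :=
  isSpectralKernel_planeKernel measurable_hLimit.sqrt
    (fun p => by simp only [balancedWeight, Prod.fst_neg, Prod.snd_neg, hLimit_neg_left,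
      hLimit_neg_right])
    (balancedWeight_sq hc) (hasPlaneSpectrum_hLimit hH₁ hH₂ hc h1 h2)

theorem balancedWeight_scale (hH₁ : 0 < H₁) (hH₂ : 0 < H₂) (hc : 0 < c) {r : ℝ} (hr : 0 < r)
    (p : ℝ × ℝ) : balancedWeight H₁ H₂ c p =
      r ^ (H₁ / 2) * balancedWeight H₁ H₂ c (r * p.1, r ^ (H₁ / H₂) * p.2) := by
  rw [balancedWeight, hLimit_scale hH₁ hc hH₂ hr, Real.sqrt_mul (by positivity),
    Real.sqrt_eq_rpow (r ^ H₁), ← Real.rpow_mul hr.le, mul_one_div]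
  rfl

theorem rpow_weight_sq (a u : ℝ) : (|u| ^ (-a / 2)) ^ 2 = |u| ^ (-a) := by
  rw [abs_rpow_sq]
  congr 1
  ring

theorem isSpectralKernel_weight_fst {a : ℝ} (h0 : 0 ≤ a) (h1 : a < 1) :
    IsSpectralKernel volume (planeKernel fun p => |p.1| ^ (-a / 2)) Prod.fst Prod.snd :=
  isSpectralKernel_planeKernel (by fun_prop) (fun p => by simp) (fun p => rpow_weight_sq a p.1)
    (hasPlaneSpectrum_fst h0 h1)

theorem isSpectralKernel_weight_snd {a : ℝ} (h0 : 0 ≤ a) (h1 : a < 1) :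
    IsSpectralKernel volume (planeKernel fun p => |p.2| ^ (-a / 2)) Prod.fst Prod.snd :=
  isSpectralKernel_planeKernel (by fun_prop) (fun p => by simp) (fun p => rpow_weight_sq a p.2)
    (hasPlaneSpectrum_fst h0 h1).swap

end Weights

variable {V : ℝ → ℝ → Ω → ℝ}

theorem hasDepRectIncr_balanced (hW : IsHermitianNoise volume P W) (hH₁ : 0 < H₁) (hH₂ : 0 < H₂)
    (hc : 0 < c) (h1 : H₁ < 2) (h2 : H₂ < 2)
    (hV : IsSpectralField volume P W (planeKernel (balancedWeight H₁ H₂ c)) V) :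
    HasDepRectIncr P V :=
  hasDepRectIncr_of_second_difference hW hV (isSpectralKernel_balancedWeight hH₁ hH₂ hc h1 h2)
    (balancedWeight_sq hc) (hasPlaneSpectrum_hLimit hH₁ hH₂ hc h1 h2) hLimit_neg_left
    (hLimit_half_left_le hH₁ hc) (fun _ v hu _ => hLimit_half_left_lt hH₁ hc hu.ne' v)
    (hLimit_half_right_le hH₁ hH₂ hc) (fun u _ _ hv => hLimit_half_right_lt hH₁ hH₂ hc u hv.ne')
    (hLimit_second_difference_nonneg hH₁ hH₂ hc)
    (fun _ _ hu hv => hLimit_second_difference_pos hH₁ hH₂ hc hu.ne' hv.ne')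
    (fun _ hp => (Real.sqrt_pos.2 (hLimit_pos hc hp.1.1.ne' _)).ne')

theorem isOperatorScaling_balanced (hW : IsHermitianNoise volume P W) (hH₁ : 0 < H₁) (hH₂ : 0 < H₂)
    (hc : 0 < c) (hV : IsSpectralField volume P W (planeKernel (balancedWeight H₁ H₂ c)) V) :
    IsOperatorScaling P V (H₁ / H₂) ((1 + H₁ / H₂ + H₁) / 2) :=
  hV.isOperatorScaling hW (by positivity) fun _ hr =>
    planeKernel_scaling hr (balancedWeight_scale hH₁ hH₂ hc hr) (by ring)

theorem hasSemiDepRectIncr_weight_fst (hW : IsHermitianNoise volume P W) {a : ℝ} (h0 : 0 < a)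
    (h1 : a < 1) (hV : IsSpectralField volume P W (planeKernel fun p => |p.1| ^ (-a / 2)) V) :
    HasSemiDepRectIncr P V :=
  hasSemiDepRectIncr_of_weight_fst hW hV (isSpectralKernel_weight_fst h0.le h1)
    (h := fun u _ => |u| ^ (-a)) (fun p => rpow_weight_sq a p.1) (g := fun u => |u| ^ (-a / 2))
    (fun _ => rfl)
    ((hasPlaneSpectrum_fst h0.le h1).integral_cos_fst_pos (fun u _ => rpow_neg_half_le h0 u)
      (fun _ _ hu _ => rpow_neg_half_lt h0 hu))
    (fun _ hp => (Real.rpow_pos_of_pos (abs_pos.2 hp.1.1.ne') _).ne')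

theorem hasSemiDepRectIncr_weight_snd (hW : IsHermitianNoise volume P W) {a : ℝ} (h0 : 0 < a)
    (h1 : a < 1) (hV : IsSpectralField volume P W (planeKernel fun p => |p.2| ^ (-a / 2)) V) :
    HasSemiDepRectIncr P V :=
  hasSemiDepRectIncr_of_weight_snd hW hV (isSpectralKernel_weight_snd h0.le h1)
    (h := fun _ v => |v| ^ (-a)) (fun p => rpow_weight_sq a p.2) (g := fun v => |v| ^ (-a / 2))
    (fun _ => rfl)
    ((hasPlaneSpectrum_fst h0.le h1).swap.integral_cos_snd_pos (fun _ v => rpow_neg_half_le h0 v)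
      (fun _ _ _ hv => rpow_neg_half_lt h0 hv))
    (fun _ hp => (Real.rpow_pos_of_pos (abs_pos.2 hp.2.1.ne') _).ne')

theorem isOperatorScaling_weight_fst (hW : IsHermitianNoise volume P W) {a : ℝ} (h0 : 0 < a)
    (hγ : 0 < γ) (hV : IsSpectralField volume P W (planeKernel fun p => |p.1| ^ (-a / 2)) V) :
    IsOperatorScaling P V γ ((1 + γ + a) / 2) :=
  hV.isOperatorScaling hW (by positivity) fun _ hr =>
    planeKernel_scaling (τ := a) hr (fun p => by rw [rpow_scale hr p.1, neg_div, neg_neg])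
      (by ring)

theorem isOperatorScaling_weight_snd (hW : IsHermitianNoise volume P W) {a : ℝ} (h0 : 0 < a)
    (hγ : 0 < γ) (hV : IsSpectralField volume P W (planeKernel fun p => |p.2| ^ (-a / 2)) V) :
    IsOperatorScaling P V γ ((1 + γ + γ * a) / 2) :=
  hV.isOperatorScaling hW (by positivity) fun _ hr =>
    planeKernel_scaling (τ := γ * a) hr
      (fun p => by
        rw [rpow_scale (Real.rpow_pos_of_pos hr γ) p.2, neg_div, neg_neg, ← Real.rpow_mul hr.le,
          mul_div_assoc])
      (by ring)

end Cases

/-- For the exponent q of a line kernel, q < 0 yields dependence and 2q > -1 square integrability.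
-/
theorem lineExponent_bounds {a b : ℝ} (ha : 0 < a) (hb : 1 < b) (h : a * (b - 1) < b) :
    -(b * a - a) / (2 * b) < 0 ∧ -1 < -(b * a - a) / (2 * b) * 2 := by
  have hb0 : 0 < b := by linarith
  have e : -(b * a - a) / (2 * b) * 2 = -(a * (b - 1)) / b := by field_simp
  refine ⟨div_neg_of_neg_of_pos (by nlinarith) (by linarith), ?_⟩
  rw [e, lt_div_iff₀ hb0]
  linarith

/-! ### The main theorem. -/

theorem mainTheorem10 (H₁ H₂ c ρ₁ ρ₂ γ : ℝ)
    (hH₁ : 0 < H₁) (hH₁₂ : H₁ ≤ H₂) (hH₂ : H₂ < 2) (hc : 0 < c) (hγ : 0 < γ)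
    (hρ₁ : ρ₁ ≠ 0) (hρ₂ : ρ₂ ≠ 0)
    (hgt : H₁ / H₂ < γ → H₁ ≠ 1) (hlt : γ < H₁ / H₂ → H₂ ≠ 1) :
    -- the standard Gaussian noises on the plane and on the line exist
    (∃ (Ω : Type) (_ : MeasurableSpace Ω) (P : Measure Ω)
        (W : Set (ℝ × ℝ) → Ω → ℂ) (W₁ : Set ℝ → Ω → ℂ),
      IsProbabilityMeasure P ∧
      IsHermitianNoise volume P W ∧ IsHermitianNoise volume P W₁) ∧
    ∀ (Ω : Type*) [MeasurableSpace Ω] (P : Measure Ω) [IsProbabilityMeasure P]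
      (W : Set (ℝ × ℝ) → Ω → ℂ) (W₁ : Set ℝ → Ω → ℂ),
      IsHermitianNoise volume P W → IsHermitianNoise volume P W₁ →
      -- the stochastic integral exists, is almost surely unique and is almost surely real
      (∀ x y : ℝ, 0 ≤ x → 0 ≤ y →
        ∃ X : Ω → ℂ, IsVgamma P W W₁ H₁ H₂ c ρ₁ ρ₂ γ x y X ∧ (∀ᵐ ω ∂P, (X ω).im = 0) ∧
          ∀ X' : Ω → ℂ, IsVgamma P W W₁ H₁ H₂ c ρ₁ ρ₂ γ x y X' → X' =ᵐ[P] X) ∧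
      ∀ V : ℝ → ℝ → Ω → ℝ,
        (∀ x y : ℝ, 0 ≤ x → 0 ≤ y →
          IsVgamma P W W₁ H₁ H₂ c ρ₁ ρ₂ γ x y (fun ω => (V x y ω : ℂ))) →
        -- Gaussian with zero mean and finite variance
        IsGaussianProcess (fun p : {p : ℝ × ℝ // 0 ≤ p.1 ∧ 0 ≤ p.2} => V p.1.1 p.1.2) P ∧
        (∀ x y : ℝ, 0 ≤ x → 0 ≤ y → MemLp (V x y) 2 P ∧ ∫ ω, V x y ω ∂P = 0) ∧
        -- vanishing on the axes, stationary rectangular increments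
        (∀ x : ℝ, 0 ≤ x → V x 0 =ᵐ[P] 0 ∧ V 0 x =ᵐ[P] 0) ∧
        HasStationaryRectIncr P V ∧
        -- operator scaling with the explicit exponent
        (H₁ / H₂ ≤ γ → H₁ < 1 → IsOperatorScaling P V γ ((1 + γ + H₁) / 2)) ∧
        (H₁ / H₂ ≤ γ → 1 < H₁ →
          IsOperatorScaling P V γ ((γ * H₁ + γ * H₁ * H₂ - γ * H₂ + 2 * H₁) / (2 * H₁))) ∧
        (γ ≤ H₁ / H₂ → H₂ < 1 → IsOperatorScaling P V γ ((1 + γ + γ * H₂) / 2)) ∧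
        (γ ≤ H₁ / H₂ → 1 < H₂ →
          IsOperatorScaling P V γ ((H₂ + H₁ * H₂ - H₁ + 2 * γ * H₂) / (2 * H₂))) ∧
        (γ = H₁ / H₂ → IsOperatorScaling P V γ ((H₁ + H₂ + H₁ * H₂) / (2 * H₂))) ∧
        -- dependence of the rectangular increments
        (HasDepRectIncr P V ↔ γ = H₁ / H₂) ∧
        (HasSemiDepRectIncr P V ↔ γ ≠ H₁ / H₂) := by
  have hH₂0 : 0 < H₂ := hH₁.trans_le hH₁₂
  have hH₁2 : H₁ < 2 := hH₁₂.trans_lt hH₂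
  refine ⟨?_, fun Ω _ P _ W W₁ hW hW₁ => ?_⟩
  · obtain ⟨Ω, hΩ, P, W, W₁, hP, hW, hW₁⟩ :=
      exists_isHermitianNoise_pair (volume : Measure (ℝ × ℝ)) (volume : Measure ℝ)
    exact ⟨Ω, hΩ, P, W, W₁, hP, hW, hW₁⟩
  rcases lt_trichotomy γ (H₁ / H₂) with h | h | h
  · rcases lt_or_gt_of_ne (hlt h) with h2 | h2
    · refine (isSpectralKernel_weight_snd hH₂0.le h2).field_properties hW
        (isVgamma_iff_snd h h2) fun V hV => ?_
      have hdep := hasSemiDepRectIncr_weight_snd hW hH₂0 h2 hV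
      exact ⟨fun h' => absurd h h'.not_gt, fun h' => absurd h h'.not_gt,
        fun _ _ => isOperatorScaling_weight_snd hW hH₂0 hγ hV, fun _ h' => absurd h2 h'.not_gt,
        fun h' => absurd h' h.ne, iff_of_false hdep.not_hasDepRectIncr h.ne, iff_of_true hdep h.ne⟩
    -- Since H₁, H₂ < 2 and H₂ > 1, one has H₁(H₂ - 1) < 2(H₂ - 1) < H₂.
    · obtain ⟨hq0, hq1⟩ := lineExponent_bounds hH₁ h2 (by nlinarith)
      rw [mul_comm H₂ H₁] at hq0 hq1
      refine (isSpectralKernel_lineKernel_swap _ hq0.le hq1).field_properties hW₁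
        (isVgamma_iff_line_swap hW₁ h h2 hq0.le hq1) fun V hV => ?_
      have hdep := hasSemiDepRectIncr_lineKernel_swap hW₁
        (mul_ne_zero hρ₂ (Real.rpow_pos_of_pos hc _).ne') hq0 hq1 hV
      refine ⟨fun h' => absurd h h'.not_gt, fun h' => absurd h h'.not_gt,
        fun _ h' => absurd h2 h'.not_gt,
        fun _ _ => lineKernel_swap_isOperatorScaling hW₁ (div_pos ?_ (by positivity)) ?_ hV,
        fun h' => absurd h' h.ne, iff_of_false hdep.not_hasDepRectIncr h.ne, iff_of_true hdep h.ne⟩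
      · have : 0 < γ * H₂ := by positivity
        nlinarith
      · field_simp
        ring
  · refine (isSpectralKernel_balancedWeight hH₁ hH₂0 hc hH₁2 hH₂).field_properties hW
      (isVgamma_iff_balanced h) fun V hV => ?_
    have hdep := hasDepRectIncr_balanced hW hH₁ hH₂0 hc hH₁2 hH₂ hV
    have hsc := isOperatorScaling_balanced hW hH₁ hH₂0 hc hV
    rw [← h] at hsc
    -- At γ = H₁/H₂ all the exponent formulas agree, so one scaling relation serves every clause.
    have hs : ∀ H : ℝ, H = (1 + γ + H₁) / 2 → IsOperatorScaling P V γ H := by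
      rintro _ rfl
      exact hsc
    refine ⟨fun _ _ => hsc, fun _ _ => hs _ ?_, fun _ _ => hs _ ?_, fun _ _ => hs _ ?_,
      fun _ => hs _ ?_, iff_of_true hdep h, iff_of_false hdep.not_hasSemiDepRectIncr (not_not.2 h)⟩
    all_goals
      rw [h]
      field_simp
      try ring
  · rcases lt_or_gt_of_ne (hgt h) with h1 | h1
    · refine (isSpectralKernel_weight_fst hH₁.le h1).field_properties hW
        (isVgamma_iff_fst h h1) fun V hV => ?_
      have hdep := hasSemiDepRectIncr_weight_fst hW hH₁ h1 hV
      exact ⟨fun _ _ => isOperatorScaling_weight_fst hW hH₁ hγ hV, fun _ h' => absurd h1 h'.not_gt,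
        fun h' => absurd h h'.not_gt, fun h' => absurd h h'.not_gt,
        fun h' => absurd h' h.ne', iff_of_false hdep.not_hasDepRectIncr h.ne',
        iff_of_true hdep h.ne'⟩
    · obtain ⟨hq0, hq1⟩ := lineExponent_bounds hH₂0 h1 (by nlinarith)
      refine (isSpectralKernel_lineKernel _ hq0.le hq1).field_properties hW₁
        (isVgamma_iff_line hW₁ h h1 hq0.le hq1) fun V hV => ?_
      have hdep := hasSemiDepRectIncr_lineKernel hW₁
        (mul_ne_zero hρ₁ (Real.rpow_pos_of_pos hc _).ne') hq0 hq1 hV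
      refine ⟨fun _ h' => absurd h1 h'.not_gt,
        fun _ _ => lineKernel_isOperatorScaling hW₁ (div_pos ?_ (by positivity)) ?_ hV,
        fun h' => absurd h h'.not_gt, fun h' => absurd h h'.not_gt,
        fun h' => absurd h' h.ne', iff_of_false hdep.not_hasDepRectIncr h.ne',
        iff_of_true hdep h.ne'⟩
      · have h3 : 0 < γ * H₁ := by positivity
        have h4 : 0 < γ * (H₁ * H₂ - H₂) := mul_pos hγ (by nlinarith)
        nlinarith
      · field_simp
        ring
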